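/- Let $n,\ell\ge 1$, $V=\mathbb{C}^n$, $G=GL(V)$, and let $T^*\overline R=\mathfrak{sl}(V)^{\oplus 2\ell}\oplus V^*\oplus V$ be the space of tuples $(X_1,\dots,X_\ell,Y_1,\dots,Y_\ell,i,j)$ with the symplectic form $\omega=\sum_k \operatorname{tr}(dX_k\wedge dY_k)+di\wedge dj$ and the natural action $g\cdot(X,Y,i,j)=(gXg^{-1},gYg^{-1},ig^{-1},gj)$ of $G$, whose moment map is $\mu(X,Y,i,j)=\sum_{k=1}^{\ell}[X_k,Y_k]-ji\in\mathfrak{gl}(V)$. Let $\theta=\det^{-1}$, let $\mathbb{C}[\mu^{-1}(0)]^{G,\theta^m}$ be the space of functions $f$ with $f(g^{-1}x)=\theta(g)^m f(x)$, let $\overline{\mathcal M}(n,\ell)=\mu^{-1}(0)/\!/G=\operatorname{Spec}\mathbb{C}[\mu^{-1}(0)]^G$ and $\overline{\mathcal M}^\theta(n,\ell)=\mu^{-1}(0)^{\theta\text{-}ss}/\!/^{\theta}G =\operatorname{Proj}\bigoplus_{m\ge 0}\mathbb{C}[\mu^{-1}(0)]^{G,\theta^m}$, with the natural morphism $\bar\rho:\overline{\mathcal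 M}^\theta(n,\ell)\to\overline{\mathcal M}(n,\ell)$. The central fiber $\bar\rho^{-1}(0)$ is the preimage of the image $0$ of the zero tuple, regarded as a (reduced) subvariety of $\overline{\mathcal M}^\theta(n,\ell)$. (a) For every $\ell\ge 1$, the variety $\bar\rho^{-1}(0)\subset\overline{\mathcal M}^\theta(2,\ell)$ is isomorphic to the projective space $\mathbb{P}^{2\ell-1}$. (b) Let $n,\ell>1$. Then $\dim\bar\rho^{-1}(0)<\frac12\dim\overline{\mathcal M}^\theta(n,\ell)$. Moreover there is exactly one field of bilinear forms on the tangent spaces of $\overline{\mathcal M}^\theta(n,\ell)$ whose pullback to $\mu^{-1}(0)^{\theta\text{-}ss}$ is the restriction of $\omega$ (the symplectic form of $\overline{\mathcal M}^\theta(n,\ell)$). With respect to it, $\bar\rho^{-1}(0)$ is isotropic, i.e. the form vanishes on the tangent spaces of $\bar\rho^{-1}(0)$ at its smooth points, but $\bar\rho^{-1}(0)$ is not Lagrangian, i.e. it is not the case that it is isotropic with all irreducible components of dimension $\frac12\dim\overline{\mathcal M}^\theta(n,\ell)$. -/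

import Mathlib

noncomputable section

namespace BouquetQuiver

open Filter Topology

/-! ### Complex varieties as spaces with functions -/

section SpacesWithFunctions

instance germAlgebra {X : Type*} (l : Filter X) : Algebra ℂ (l.Germ ℂ) :=
  Algebra.ofModule
    (fun r x y => Quotient.inductionOn₂' x y fun f g =>
      congrArg (fun h : X → ℂ => (h : l.Germ ℂ)) (smul_mul_assoc r f g))
    (fun r x y => Quotient.inductionOn₂' x y fun f g =>
      congrArg (fun h : X → ℂ => (h : l.Germ ℂ)) (mul_smul_comm r f g))

/-- A sheaf of `ℂ`-valued functions on a topological space, given by its stalks: a function is a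
section over an open set iff its germ at each point of that set lies in the stalk there. The
classical complex varieties (points: closed points, Zariski topology, regular functions) below are
spaces of this kind, and `stalk x` is the local ring `𝒪_{X,x}`. -/
class RegularFunctions (X : Type*) [TopologicalSpace X] where
  stalk : ∀ x : X, Subalgebra ℂ ((𝓝 x).Germ ℂ)
  eventually_mem : ∀ (x : X) (f : X → ℂ), (f : (𝓝 x).Germ ℂ) ∈ stalk x →
    ∀ᶠ y in 𝓝 x, (f : (𝓝 y).Germ ℂ) ∈ stalk y

/-- Pullback of germs of functions along a continuous map. -/
def pullbackGerm {X Y : Type*} [TopologicalSpace X] [TopologicalSpace Y] (φ : C(X, Y)) (x : X) :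
    (𝓝 (φ x)).Germ ℂ →ₐ[ℂ] (𝓝 x).Germ ℂ where
  toFun g := g.compTendsto φ φ.continuous.continuousAt
  map_one' := rfl
  map_mul' a b := Quotient.inductionOn₂' a b fun _ _ => rfl
  map_zero' := rfl
  map_add' a b := Quotient.inductionOn₂' a b fun _ _ => rfl
  commutes' _ := rfl

variable {X Y : Type*} [TopologicalSpace X] [TopologicalSpace Y]

/-- A morphism: a continuous map that pulls regular functions back to regular functions. -/
structure Morphism (X Y : Type*) [TopologicalSpace X] [TopologicalSpace Y]
    [RegularFunctions X] [RegularFunctions Y] where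
  toMap : C(X, Y)
  pullback_mem : ∀ (x : X), ∀ g ∈ RegularFunctions.stalk (toMap x),
    pullbackGerm toMap x g ∈ RegularFunctions.stalk x

/-- Two varieties are isomorphic if there are mutually inverse morphisms between them. -/
def IsIsomorphic (X Y : Type*) [TopologicalSpace X] [TopologicalSpace Y]
    [RegularFunctions X] [RegularFunctions Y] : Prop :=
  ∃ (φ : Morphism X Y) (ψ : Morphism Y X),
    (∀ x, ψ.toMap (φ.toMap x) = x) ∧ (∀ y, φ.toMap (ψ.toMap y) = y)

/-- The continuous inclusion of a subset. -/
def inclusionMap (Z : Set X) : C(Z, X) := ⟨Subtype.val, continuous_subtype_val⟩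

/-- A subset of a variety, with its reduced structure: the regular functions are locally the
restrictions of regular functions. -/
instance inducedFunctions [RegularFunctions X] (Z : Set X) : RegularFunctions Z where
  stalk z := (RegularFunctions.stalk (inclusionMap Z z)).map (pullbackGerm (inclusionMap Z) z)
  eventually_mem := by
    rintro z f ⟨g, hg, hgf⟩
    induction g using Filter.Germ.inductionOn with
    | _ G =>
      have h1 := (inclusionMap Z).continuous.continuousAt.eventually
        (RegularFunctions.eventually_mem (inclusionMap Z z) G hg)
      have h2 : (fun y : Z => G y) =ᶠ[𝓝 z] f := Filter.Germ.coe_eq.mp hgf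
      filter_upwards [h1, h2.eventually_nhds] with y hy1 hy2
      exact ⟨_, hy1, Filter.Germ.coe_eq.mpr hy2⟩

/-- The inclusion morphism of a subvariety. -/
def inclusion [RegularFunctions X] (Z : Set X) : Morphism Z X where
  toMap := inclusionMap Z
  pullback_mem _ g hg := ⟨g, hg, rfl⟩

/-- The Zariski tangent space at `x`: the `ℂ`-linear derivations `𝒪_{X,x} → ℂ`, where `𝒪_{X,x}`
acts on `ℂ` by evaluation at `x`. -/
def TangentVec [RegularFunctions X] (x : X) :
    Submodule ℂ (Module.Dual ℂ (RegularFunctions.stalk x)) where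
  carrier := {D | ∀ f g, D (f * g) = f.1.value * D g + g.1.value * D f}
  add_mem' := by
    intro a b ha hb f g
    simp only [LinearMap.add_apply, ha f g, hb f g]
    ring
  zero_mem' := by
    intro f g
    simp
  smul_mem' := by
    intro c a ha f g
    simp only [LinearMap.smul_apply, ha f g, smul_eq_mul]
    ring

/-- Pullback of local rings along a morphism. -/
def Morphism.stalkMap [RegularFunctions X] [RegularFunctions Y] (φ : Morphism X Y) (x : X) :
    RegularFunctions.stalk (φ.toMap x) →ₐ[ℂ] RegularFunctions.stalk x :=
  ((pullbackGerm φ.toMap x).comp (RegularFunctions.stalk (φ.toMap x)).val).codRestrict _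
    (fun g => φ.pullback_mem x g.1 g.2)

/-- The differential of a morphism at a point. -/
def Morphism.differential [RegularFunctions X] [RegularFunctions Y] (φ : Morphism X Y) (x : X) :
    TangentVec x →ₗ[ℂ] TangentVec (φ.toMap x) where
  toFun D := ⟨D.1 ∘ₗ (φ.stalkMap x).toLinearMap, by
    intro f g
    have hv : ∀ h : RegularFunctions.stalk (φ.toMap x), (φ.stalkMap x h).1.value = h.1.value := by
      rintro ⟨h, hh⟩
      induction h using Filter.Germ.inductionOn with
      | _ H => rfl
    have := D.2 (φ.stalkMap x f) (φ.stalkMap x g)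
    rw [hv, hv] at this
    simpa using this⟩
  map_add' _ _ := rfl
  map_smul' _ _ := rfl

/-- `x` is a smooth point of `X`: the dimension of the Zariski tangent space equals the Krull
dimension of the local ring. -/
def IsSmoothPoint [RegularFunctions X] (x : X) : Prop :=
  Module.Finite ℂ (TangentVec x) ∧
    ((Module.finrank ℂ (TangentVec x) : ℕ) : WithBot ℕ∞) = ringKrullDim (RegularFunctions.stalk x)

end SpacesWithFunctions

/-! ### Zariski topology and regular functions from a graded algebra of functions -/

section Graded

variable {P W : Type*} (rep : P → W) (S : ℕ → Submodule ℂ (W → ℂ))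

/-- The topology with basis the sets `f ≠ 0`, for `f` homogeneous, where points of `P` are
represented by points of `W` through `rep`. -/
@[reducible]
def zariskiTopology : TopologicalSpace P :=
  TopologicalSpace.generateFrom {U | ∃ m, ∃ f ∈ S m, U = {p | f (rep p) ≠ 0}}

theorem eventually_ne {m : ℕ} {f : W → ℂ} (hf : f ∈ S m) (p : P) (hp : f (rep p) ≠ 0) :
    ∀ᶠ q in @nhds P (zariskiTopology rep S) p, f (rep q) ≠ 0 := by
  let := zariskiTopology rep S
  exact IsOpen.mem_nhds (TopologicalSpace.isOpen_generateFrom_of_mem ⟨m, f, hf, rfl⟩) hp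

/-- The functions that are locally of the form `a / b` with `a`, `b` homogeneous of the same
degree and `b` nowhere zero. -/
@[reducible]
def ratioFunctions [SetLike.GradedMonoid S] :
    @RegularFunctions P (zariskiTopology rep S) :=
  letI := zariskiTopology rep S
  { stalk := fun p =>
      { carrier := {g | ∃ m, ∃ a ∈ S m, ∃ b ∈ S m, b (rep p) ≠ 0 ∧
          g = ((fun q => a (rep q) / b (rep q) : P → ℂ) : (𝓝 p).Germ ℂ)}
        mul_mem' := by
          rintro _ _ ⟨m, a, ha, b, hb, hbp, rfl⟩ ⟨m', a', ha', b', hb', hbp', rfl⟩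
          refine ⟨m + m', a * a', SetLike.mul_mem_graded ha ha', b * b',
            SetLike.mul_mem_graded hb hb', mul_ne_zero hbp hbp', ?_⟩
          rw [← Filter.Germ.coe_mul]
          refine Filter.Germ.coe_eq.mpr (Filter.Eventually.of_forall fun q => ?_)
          simp [div_mul_div_comm]
        add_mem' := by
          rintro _ _ ⟨m, a, ha, b, hb, hbp, rfl⟩ ⟨m', a', ha', b', hb', hbp', rfl⟩
          refine ⟨m + m', a * b' + b * a', Submodule.add_mem _ (SetLike.mul_mem_graded ha hb')
            (SetLike.mul_mem_graded hb ha'), b * b',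
            SetLike.mul_mem_graded hb hb', mul_ne_zero hbp hbp', ?_⟩
          rw [← Filter.Germ.coe_add]
          refine Filter.Germ.coe_eq.mpr ?_
          filter_upwards [eventually_ne rep S hb p hbp, eventually_ne rep S hb' p hbp']
            with q h1 h2
          simp [div_add_div _ _ h1 h2]
        algebraMap_mem' := by
          intro r
          refine ⟨0, r • 1, Submodule.smul_mem _ _ SetLike.GradedOne.one_mem, 1,
            SetLike.GradedOne.one_mem, by simp, ?_⟩
          rw [Algebra.algebraMap_eq_smul_one, ← Filter.Germ.coe_one, ← Filter.Germ.coe_smul]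
          refine Filter.Germ.coe_eq.mpr (Filter.Eventually.of_forall fun q => ?_)
          simp }
    eventually_mem := by
      rintro p f ⟨m, a, ha, b, hb, hbp, hf⟩
      filter_upwards [(Filter.Germ.coe_eq.mp hf).eventually_nhds, eventually_ne rep S hb p hbp]
        with q h1 h2
      exact ⟨m, a, ha, b, hb, h2, Filter.Germ.coe_eq.mpr h1⟩ }

end Graded

/-! ### Projective space -/

section ProjectiveSpace

/-- Homogeneous polynomial functions of degree `m` on `ℂ^{N+1}`. -/
def homogeneousFunctions (N m : ℕ) : Submodule ℂ ((Fin (N + 1) → ℂ) → ℂ) where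
  carrier := {f | ∃ F : MvPolynomial (Fin (N + 1)) ℂ, F.IsHomogeneous m ∧
    f = fun v => MvPolynomial.eval v F}
  add_mem' := by
    rintro _ _ ⟨F, hF, rfl⟩ ⟨G, hG, rfl⟩
    exact ⟨F + G, hF.add hG, by ext v; simp⟩
  zero_mem' := ⟨0, MvPolynomial.isHomogeneous_zero _ _ _, by ext v; simp⟩
  smul_mem' := by
    rintro c _ ⟨F, hF, rfl⟩
    exact ⟨c • F, (MvPolynomial.homogeneousSubmodule _ _ m).smul_mem c hF,
      by ext v; simp [MvPolynomial.smul_eval]⟩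

instance (N : ℕ) : SetLike.GradedMonoid (homogeneousFunctions N) where
  one_mem := ⟨1, MvPolynomial.isHomogeneous_one _ _, by ext v; simp⟩
  mul_mem := by
    rintro i j _ _ ⟨F, hF, rfl⟩ ⟨G, hG, rfl⟩
    exact ⟨F * G, hF.mul hG, by ext v; simp⟩

/-- Complex projective space `ℙ^N`, with the Zariski topology and its regular functions. -/
def ProjectiveSpace (N : ℕ) : Type := Projectivization ℂ (Fin (N + 1) → ℂ)

/-- Homogeneous coordinates of a point. -/
def ProjectiveSpace.coords {N : ℕ} (p : ProjectiveSpace N) : Fin (N + 1) → ℂ :=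
  Projectivization.rep p

instance (N : ℕ) : TopologicalSpace (ProjectiveSpace N) :=
  zariskiTopology ProjectiveSpace.coords (homogeneousFunctions N)

instance (N : ℕ) : RegularFunctions (ProjectiveSpace N) :=
  ratioFunctions ProjectiveSpace.coords (homogeneousFunctions N)

end ProjectiveSpace

/-! ### The quiver varieties -/

section Quiver

open Matrix

variable {n ℓ : ℕ}

/-- `𝔤𝔩(V)^{2ℓ} ⊕ V^* ⊕ V`, `V = ℂ^n`: the points are `(X, Y, i, j)`. -/
abbrev Rep (n ℓ : ℕ) : Type :=
  (Fin ℓ → Matrix (Fin n) (Fin n) ℂ) × (Fin ℓ → Matrix (Fin n) (Fin n) ℂ) ×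
    (Fin n → ℂ) × (Fin n → ℂ)

abbrev Rep.X (x : Rep n ℓ) : Fin ℓ → Matrix (Fin n) (Fin n) ℂ := x.1
abbrev Rep.Y (x : Rep n ℓ) : Fin ℓ → Matrix (Fin n) (Fin n) ℂ := x.2.1
/-- The covector `i : V → ℂ`. -/
abbrev Rep.i (x : Rep n ℓ) : Fin n → ℂ := x.2.2.1
/-- The vector `j : ℂ → V`. -/
abbrev Rep.j (x : Rep n ℓ) : Fin n → ℂ := x.2.2.2

/-- `T^*R̄ = 𝔰𝔩(V)^{2ℓ} ⊕ V^* ⊕ V`, for `R̄ = 𝔰𝔩(V)^ℓ ⊕ V^*`. -/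
def cotangentBar (n ℓ : ℕ) : Submodule ℂ (Rep n ℓ) where
  carrier := {x | (∀ k, (x.X k).trace = 0) ∧ ∀ k, (x.Y k).trace = 0}
  add_mem' := by
    rintro a b ⟨ha, ha'⟩ ⟨hb, hb'⟩
    exact ⟨fun k => (Matrix.trace_add _ _).trans (by rw [ha k, hb k, add_zero]),
      fun k => (Matrix.trace_add _ _).trans (by rw [ha' k, hb' k, add_zero])⟩
  zero_mem' := ⟨fun _ => Matrix.trace_zero _ _, fun _ => Matrix.trace_zero _ _⟩
  smul_mem' := by
    rintro c a ⟨ha, ha'⟩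
    exact ⟨fun k => (Matrix.trace_smul c (a.X k)).trans (by rw [ha k, smul_zero]),
      fun k => (Matrix.trace_smul c (a.Y k)).trans (by rw [ha' k, smul_zero])⟩

/-- The symplectic form `∑ tr (dX_k ∧ dY_k) + di ∧ dj`. -/
def omega (u v : Rep n ℓ) : ℂ :=
  ∑ k, ((u.X k * v.Y k).trace - (v.X k * u.Y k).trace) + (u.i ⬝ᵥ v.j - v.i ⬝ᵥ u.j)

/-- The action of `g ∈ GL(V)`: `(gXg⁻¹, gYg⁻¹, ig⁻¹, gj)`. -/
def act (g : GL (Fin n) ℂ) (x : Rep n ℓ) : Rep n ℓ :=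
  (fun k => g.1 * x.X k * g⁻¹.1, fun k => g.1 * x.Y k * g⁻¹.1, x.i ᵥ* g⁻¹.1, g.1 *ᵥ x.j)

/-- The moment map `∑ [X_k, Y_k] - j i`. -/
def moment (x : Rep n ℓ) : Matrix (Fin n) (Fin n) ℂ :=
  ∑ k, (x.X k * x.Y k - x.Y k * x.X k) - vecMulVec x.j x.i

theorem moment_act (g : GL (Fin n) ℂ) (x : Rep n ℓ) :
    moment (act g x) = g.1 * moment x * g⁻¹.1 := by
  have h : g⁻¹.1 * g.1 = 1 := by rw [← Units.val_mul]; simp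
  have hc : ∀ A B : Matrix (Fin n) (Fin n) ℂ,
      g.1 * A * g⁻¹.1 * (g.1 * B * g⁻¹.1) = g.1 * (A * B) * g⁻¹.1 := by
    intro A B
    calc g.1 * A * g⁻¹.1 * (g.1 * B * g⁻¹.1) = g.1 * A * (g⁻¹.1 * g.1) * B * g⁻¹.1 := by
          simp only [Matrix.mul_assoc]
      _ = g.1 * (A * B) * g⁻¹.1 := by rw [h]; simp only [Matrix.mul_assoc, Matrix.one_mul]
  simp only [moment, act, Rep.X, Rep.Y, Rep.i, Rep.j, hc]
  rw [Matrix.mul_sub, Matrix.sub_mul, Finset.mul_sum, Finset.sum_mul, mul_vecMulVec,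
    vecMulVec_mul]
  simp only [Matrix.mul_sub, Matrix.sub_mul]

theorem trace_conj (g : GL (Fin n) ℂ) (A : Matrix (Fin n) (Fin n) ℂ) :
    (g.1 * A * g⁻¹.1).trace = A.trace := by
  have h : g⁻¹.1 * g.1 = 1 := by rw [← Units.val_mul]; simp
  rw [Matrix.trace_mul_comm, ← Matrix.mul_assoc, h, Matrix.one_mul]

/-- The zero fibre `μ⁻¹(0) ⊂ T^*R̄` of the moment map. -/
def MomentZero (n ℓ : ℕ) : Type := {x : Rep n ℓ // x ∈ cotangentBar n ℓ ∧ moment x = 0}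

def MomentZero.act (g : GL (Fin n) ℂ) (x : MomentZero n ℓ) : MomentZero n ℓ :=
  ⟨BouquetQuiver.act g x.1,
    ⟨fun k => (trace_conj g _).trans (x.2.1.1 k), fun k => (trace_conj g _).trans (x.2.1.2 k)⟩,
    by rw [moment_act, x.2.2]; simp⟩

/-- The zero representation. -/
def MomentZero.zero (n ℓ : ℕ) : MomentZero n ℓ :=
  ⟨0, Submodule.zero_mem _, by simp [moment, Rep.X, Rep.Y, Rep.i, Rep.j]⟩

/-- The coordinate ring `ℂ[μ⁻¹(0)]`: restrictions of polynomial functions. -/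
def coordinateRing (n ℓ : ℕ) : Subalgebra ℂ (MomentZero n ℓ → ℂ) :=
  Algebra.adjoin ℂ {f | ∃ φ : Module.Dual ℂ (Rep n ℓ), f = fun x => φ x.1}

instance (n ℓ : ℕ) :
    SetLike.GradedMonoid (fun _ : ℕ => Subalgebra.toSubmodule (coordinateRing n ℓ)) where
  one_mem := (coordinateRing n ℓ).one_mem
  mul_mem _ _ _ _ := (coordinateRing n ℓ).mul_mem

instance (n ℓ : ℕ) : TopologicalSpace (MomentZero n ℓ) :=
  zariskiTopology id (fun _ => Subalgebra.toSubmodule (coordinateRing n ℓ))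

instance (n ℓ : ℕ) : RegularFunctions (MomentZero n ℓ) :=
  ratioFunctions id (fun _ => Subalgebra.toSubmodule (coordinateRing n ℓ))

/-- The character `θ = det⁻¹` of `GL(V)`. -/
def theta (n : ℕ) : GL (Fin n) ℂ →* ℂˣ := (Matrix.GeneralLinearGroup.det)⁻¹

/-- The semi-invariants of weight `θ^m`: `f ∈ ℂ[μ⁻¹(0)]` with `g · f = θ(g)^m f` for all `g`, where
`(g · f)(x) = f(g⁻¹ x)`. -/
def semiInvariants (n ℓ m : ℕ) : Submodule ℂ (MomentZero n ℓ → ℂ) where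
  carrier := {f | f ∈ coordinateRing n ℓ ∧
    ∀ g x, f (MomentZero.act g⁻¹ x) = ((theta n g : ℂˣ) : ℂ) ^ m * f x}
  add_mem' := by
    rintro a b ⟨ha, ha'⟩ ⟨hb, hb'⟩
    exact ⟨add_mem ha hb, fun g x => by simp only [Pi.add_apply, ha' g x, hb' g x]; ring⟩
  zero_mem' := ⟨zero_mem _, fun g x => by simp⟩
  smul_mem' := by
    rintro c a ⟨ha, ha'⟩
    exact ⟨Subalgebra.smul_mem _ ha c,
      fun g x => by simp only [Pi.smul_apply, smul_eq_mul, ha' g x]; ring⟩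

instance (n ℓ : ℕ) : SetLike.GradedMonoid (semiInvariants n ℓ) where
  one_mem := ⟨one_mem _, fun g x => by simp⟩
  mul_mem := by
    rintro i j a b ⟨ha, ha'⟩ ⟨hb, hb'⟩
    exact ⟨mul_mem ha hb, fun g x => by simp only [Pi.mul_apply, ha' g x, hb' g x]; ring⟩

/-- The ring of invariants `ℂ[μ⁻¹(0)]^G`. -/
def invariants (n ℓ : ℕ) : Subalgebra ℂ (MomentZero n ℓ → ℂ) where
  carrier := {f | f ∈ coordinateRing n ℓ ∧ ∀ g x, f (MomentZero.act g x) = f x}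
  mul_mem' := by
    rintro a b ⟨ha, ha'⟩ ⟨hb, hb'⟩
    exact ⟨mul_mem ha hb, fun g x => by simp only [Pi.mul_apply, ha' g x, hb' g x]⟩
  add_mem' := by
    rintro a b ⟨ha, ha'⟩ ⟨hb, hb'⟩
    exact ⟨add_mem ha hb, fun g x => by simp only [Pi.add_apply, ha' g x, hb' g x]⟩
  algebraMap_mem' r := ⟨Subalgebra.algebraMap_mem _ r, fun _ _ => rfl⟩

/-- The points of the affine quiver variety `M̄(n,ℓ) = Spec ℂ[μ⁻¹(0)]^G`. -/
abbrev AffineQuiverVariety (n ℓ : ℕ) : Type := invariants n ℓ →ₐ[ℂ] ℂ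

/-- The quotient map `μ⁻¹(0) → M̄(n,ℓ)`. -/
def affineQuotientMap (x : MomentZero n ℓ) : AffineQuiverVariety n ℓ :=
  (Pi.evalAlgHom ℂ (fun _ : MomentZero n ℓ => ℂ) x).comp (invariants n ℓ).val

/-- The point `0 ∈ M̄(n,ℓ)`, the image of the zero representation. -/
def AffineQuiverVariety.zero (n ℓ : ℕ) : AffineQuiverVariety n ℓ :=
  affineQuotientMap (MomentZero.zero n ℓ)

/-- The `θ`-semistable locus. -/
def semistable (n ℓ : ℕ) : Set (MomentZero n ℓ) :=
  {x | ∃ m, 1 ≤ m ∧ ∃ f ∈ semiInvariants n ℓ m, f x ≠ 0}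

/-- Two semistable points are identified iff they define the same homogeneous prime ideal of the
graded ring `⨁ ℂ[μ⁻¹(0)]^{G,θ^m}` of semi-invariants. -/
def gitSetoid (n ℓ : ℕ) : Setoid (semistable n ℓ) where
  r x y := ∀ m, ∀ f ∈ semiInvariants n ℓ m, f x = 0 ↔ f y = 0
  iseqv := ⟨fun _ _ _ _ => Iff.rfl, fun h m f hf => (h m f hf).symm,
    fun h h' m f hf => (h m f hf).trans (h' m f hf)⟩

/-- The quiver variety `M̄^θ(n,ℓ) = μ⁻¹(0)^{θ-ss} //^θ G = Proj ⨁ ℂ[μ⁻¹(0)]^{G,θ^m}` as a classical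
variety: its points are the homogeneous prime ideals defined by semistable points, a basis of its
topology is given by the nonvanishing loci of semi-invariants, and its regular functions are locally
the quotients of semi-invariants of the same weight. -/
def QuiverVariety (n ℓ : ℕ) : Type := Quotient (gitSetoid n ℓ)

/-- A semistable representative. -/
def QuiverVariety.rep (p : QuiverVariety n ℓ) : MomentZero n ℓ := (Quotient.out p).1

instance (n ℓ : ℕ) : TopologicalSpace (QuiverVariety n ℓ) :=
  zariskiTopology QuiverVariety.rep (semiInvariants n ℓ)

instance (n ℓ : ℕ) : RegularFunctions (QuiverVariety n ℓ) :=
  ratioFunctions QuiverVariety.rep (semiInvariants n ℓ)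

theorem semiInvariants_zero {f : MomentZero n ℓ → ℂ} :
    f ∈ semiInvariants n ℓ 0 ↔ f ∈ invariants n ℓ := by
  refine ⟨fun h => ⟨h.1, fun g x => ?_⟩, fun h => ⟨h.1, fun g x => ?_⟩⟩
  · simpa using h.2 g⁻¹ x
  · simpa using h.2 g⁻¹ x

/-- Equivalent semistable points have equal values of homogeneous fractions. -/
theorem div_eq_div_of_rel {x y : semistable n ℓ} (h : (gitSetoid n ℓ).r x y) {m : ℕ}
    {a b : MomentZero n ℓ → ℂ} (ha : a ∈ semiInvariants n ℓ m) (hb : b ∈ semiInvariants n ℓ m) :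
    a x / b x = a y / b y := by
  by_cases hx : b x = 0
  · rw [hx, (h m b hb).mp hx, div_zero, div_zero]
  · have hy : b y ≠ 0 := fun hy => hx ((h m b hb).mpr hy)
    have := (h m (a - (a x / b x) • b) (sub_mem ha (Submodule.smul_mem _ _ hb))).mp
      (by simp [hx])
    simp only [Pi.sub_apply, Pi.smul_apply, smul_eq_mul, sub_eq_zero] at this
    rw [this, mul_div_assoc, div_self hy, mul_one]

/-- The projective morphism `ρ̄ : M̄^θ(n,ℓ) → M̄(n,ℓ)`, induced by `μ⁻¹(0)^{θ-ss} ⊂ μ⁻¹(0)`. -/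
def rho : QuiverVariety n ℓ → AffineQuiverVariety n ℓ :=
  Quotient.lift (fun x : semistable n ℓ => affineQuotientMap x.1) (by
    intro x y h
    ext f
    have := div_eq_div_of_rel h (semiInvariants_zero.mpr f.2)
      (SetLike.GradedOne.one_mem (A := semiInvariants n ℓ))
    simpa [affineQuotientMap] using this)

/-- The central fibre `ρ̄⁻¹(0)`. -/
def centralFiber (n ℓ : ℕ) : Set (QuiverVariety n ℓ) :=
  rho ⁻¹' {AffineQuiverVariety.zero n ℓ}

theorem rep_mk_rel (x : semistable n ℓ) :
    (gitSetoid n ℓ).r (Quotient.out (Quotient.mk (gitSetoid n ℓ) x)) x :=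
  Quotient.exact (Quotient.out_eq (Quotient.mk (gitSetoid n ℓ) x))

/-- The quotient map `π : μ⁻¹(0)^{θ-ss} → M̄^θ(n,ℓ)`, on topological spaces. -/
def quotientContinuousMap (n ℓ : ℕ) : C(semistable n ℓ, QuiverVariety n ℓ) where
  toFun := Quotient.mk (gitSetoid n ℓ)
  continuous_toFun := by
    refine continuous_generateFrom_iff.mpr ?_
    rintro _ ⟨m, f, hf, rfl⟩
    have : IsOpen {x : MomentZero n ℓ | f x ≠ 0} :=
      TopologicalSpace.isOpen_generateFrom_of_mem ⟨0, f, hf.1, rfl⟩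
    convert this.preimage (continuous_subtype_val (p := fun x => x ∈ semistable n ℓ)) using 1
    ext x
    exact not_congr (rep_mk_rel x m f hf)

/-- The quotient morphism `π : μ⁻¹(0)^{θ-ss} → M̄^θ(n,ℓ)`. -/
def quotientMap (n ℓ : ℕ) : Morphism (semistable n ℓ) (QuiverVariety n ℓ) where
  toMap := quotientContinuousMap n ℓ
  pullback_mem := by
    rintro x _ ⟨m, a, ha, b, hb, hbx, rfl⟩
    refine ⟨((fun y => a y / b y : MomentZero n ℓ → ℂ) : (𝓝 x.1).Germ ℂ),
      ⟨0, a, ha.1, b, hb.1, fun h => hbx ((rep_mk_rel x m b hb).mpr h), rfl⟩, ?_⟩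
    refine Filter.Germ.coe_eq.mpr (Filter.Eventually.of_forall fun y => ?_)
    exact (div_eq_div_of_rel (rep_mk_rel y) ha hb).symm

/-! ### The symplectic form -/

/-- The germs at `x` of the linear coordinate functions, as elements of the local ring. -/
def coordinateGerm (x : semistable n ℓ) :
    Module.Dual ℂ (Rep n ℓ) →ₗ[ℂ] RegularFunctions.stalk x where
  toFun φ := ⟨((fun y => φ y.1.1 : semistable n ℓ → ℂ) : (𝓝 x).Germ ℂ),
    ((fun y => φ y.1 : MomentZero n ℓ → ℂ) : (𝓝 x.1).Germ ℂ),
    ⟨0, fun y => φ y.1, Algebra.subset_adjoin ⟨φ, rfl⟩, 1, (coordinateRing n ℓ).one_mem,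
      one_ne_zero, Filter.Germ.coe_eq.mpr (Filter.Eventually.of_forall fun _ => (div_one _).symm)⟩, rfl⟩
  map_add' _ _ := rfl
  map_smul' _ _ := rfl

/-- The vector of `𝔤𝔩(V)^{2ℓ} ⊕ V^* ⊕ V` underlying a tangent vector `u` at a semistable point: the
vector `v` with `φ(v) = u(φ)` for all linear functions `φ`. -/
def velocity {x : semistable n ℓ} (u : TangentVec x) : Rep n ℓ :=
  (Module.evalEquiv ℂ (Rep n ℓ)).symm (u.1 ∘ₗ coordinateGerm x)

/-- A field of bilinear forms on the tangent spaces of `M̄^θ(n,ℓ)`. -/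
abbrev BilinearField (n ℓ : ℕ) : Type :=
  ∀ p : QuiverVariety n ℓ, TangentVec p →ₗ[ℂ] TangentVec p →ₗ[ℂ] ℂ

/-- `Ω` is the symplectic form of `M̄^θ(n,ℓ)` obtained by Hamiltonian reduction: its pullback under
`π : μ⁻¹(0)^{θ-ss} → M̄^θ(n,ℓ)` is the restriction of the symplectic form of `T^*R̄`. -/
def IsReducedSymplecticForm (Ω : BilinearField n ℓ) : Prop :=
  ∀ (x : semistable n ℓ) (u v : TangentVec x),
    Ω _ ((quotientMap n ℓ).differential x u) ((quotientMap n ℓ).differential x v) =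
      omega (velocity u) (velocity v)

/-- A subvariety is isotropic if the form vanishes on its tangent spaces at all smooth points. -/
def IsIsotropic (Ω : BilinearField n ℓ) (Z : Set (QuiverVariety n ℓ)) : Prop :=
  ∀ z : Z, IsSmoothPoint z → ∀ ξ η : TangentVec z,
    Ω _ ((inclusion Z).differential z ξ) ((inclusion Z).differential z η) = 0

/-- A subvariety is Lagrangian if it is isotropic and each of its irreducible components has half
the dimension of the ambient variety. -/
def IsLagrangian (Ω : BilinearField n ℓ) (Z : Set (QuiverVariety n ℓ)) : Prop :=
  IsIsotropic Ω Z ∧ ∀ C ∈ irreducibleComponents Z,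
    2 * topologicalKrullDim C = topologicalKrullDim (QuiverVariety n ℓ)

end Quiver

end BouquetQuiver

end

/-! A point of `μ⁻¹(0)` is semistable exactly when `j` generates `V` under the `X_k`, `Y_k`: a
proper stable subspace containing `j` yields a one-parameter subgroup along which every
semi-invariant of positive weight is forced to vanish (`isUnit_of_stable_idempotent`). Hence some
`n` words applied to `j` form a basis, a frame. The locus where a given frame is invertible is an
open chart, and each orbit in it has exactly one point with frame `1` (`normalize`). The coordinates
of that point are ratios of semi-invariants (`exists_semiInvariant_normalize`), so local rings and
tangent spaces of the quotient can be computed with matrices.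

In a chart the reduced form is `ω` on the vectors underlying tangent vectors of the slice. Up to the
action of the group, a vector upstairs differs from its image in the slice by an infinitesimal
symmetry, and those are `ω`-orthogonal to the kernel of `dμ` (`chartForm_differential`). Uniqueness
holds because the differential of the quotient map is surjective along the slice
(`exists_differential_eq`).

Over `0`, the invariants `i w j` and the characteristic polynomials of combinations of words give `i
= 0` and nilpotency; Engel's theorem then kills all words of length `n`
(`wordProd_eq_zero_of_centralFiber`). For `n = 2` only multiples of `E_21` and `j = e_1` are left,
determined by the numbers `det (j, X_c j)` up to a common factor, whence the projective space
(`isIsomorphic_projectiveSpace`).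

Isotropy and the dimension bound are both proved at generic points. Over the fraction field `K` of a
quotient of a local ring by a prime, the nilpotent tuple is conjugate to one that is strictly
triangular for its radical filtration, so a derivation of `K` moves it by a strictly triangular
tuple plus a commutator. Strictly triangular tuples pair to zero with each other, and commutators
pair to zero with the kernel of `dμ`: this is isotropy (`tracePairing_derivation_eq_zero`). It
specializes to a smooth point because tangent vectors there are values of derivations
(`exists_derivation_of_finrank_tangent_le`). Counting the same directions modulo conjugation, with a
lower bound for the rank of `dμ` on strictly triangular tuples, bounds the dimension by `(n - 1)((ℓ
- 1)n + 1)` (`finrank_le_of_strictly_triangular`). On the other side, an affine space of dimension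
`2(ℓ - 1)(n² - 1) + 1`, with `X_1` a fixed diagonal matrix, embeds topologically in the quiver
variety (`le_topologicalKrullDim_quiverVariety`). This exceeds twice the bound when `n, ℓ > 1`, so
no component of the nonempty central fibre has half the dimension. -/

open scoped KaehlerDifferential

/-! ### Chains of primes, algebraic independence and differentials. -/

section AlgebraicIndependence

variable {k : Type*} [Field k]

/-- In a relation for `s` over `k[t]`, a power of `s` can be cancelled until the constant
coefficient is nonzero. Applying `f`, which kills `s`, leaves only that coefficient, a polynomial in
`t` whose image vanishes, against the independence of the `f (t a)`. -/
theorem AlgebraicIndependent.option_of_quotient {B C ι : Type*} [CommRing B] [IsDomain B] [CommRing C]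
    [Algebra k B] [Algebra k C] (f : B →ₐ[k] C) {t : ι → B}
    (ht : AlgebraicIndependent k fun a => f (t a)) {s : B} (hs : s ≠ 0) (hfs : f s = 0) :
    AlgebraicIndependent k (fun o : Option ι => o.elim s t) := by
  have htB : AlgebraicIndependent k t := AlgebraicIndependent.of_comp f ht
  rw [htB.option_iff_transcendental]
  intro ⟨p, hp0, hp⟩
  obtain ⟨q, hq, hqd⟩ := Polynomial.exists_eq_pow_rootMultiplicity_mul_and_not_dvd p hp0 0
  rw [map_zero, sub_zero] at hq hqd
  rw [Polynomial.X_dvd_iff] at hqd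
  rw [hq, map_mul, map_pow, Polynomial.aeval_X] at hp
  have hq0 : Polynomial.aeval s q = 0 := (mul_eq_zero.mp hp).resolve_left (pow_ne_zero _ hs)
  have hf0 : f (q.coeff 0 : B) = 0 := by
    rw [← Polynomial.divX_mul_X_add q] at hq0
    rw [map_add, map_mul, Polynomial.aeval_X, Polynomial.aeval_C] at hq0
    have := congrArg f hq0
    rw [map_add, map_mul, hfs, mul_zero, zero_add, map_zero] at this
    exact this
  obtain ⟨P, hP⟩ : ∃ P : MvPolynomial ι k, MvPolynomial.aeval t P = (q.coeff 0 : B) := by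
    have h := (Algebra.adjoin_range_eq_range_aeval k t).le (q.coeff 0).2
    exact h
  rw [← hP] at hf0
  have h2 : MvPolynomial.aeval (fun a => f (t a)) P = 0 := by
    rw [← hf0, ← MvPolynomial.comp_aeval_apply]
  rw [(injective_iff_map_eq_zero _).mp ht P h2, map_zero] at hP
  exact hqd (Subtype.ext hP.symm)

/-- A chain of primes of length `d` yields `d` algebraically independent elements in the quotient
by the smallest prime. -/
theorem exists_algebraicIndependent_of_strictMono {A : Type*} [CommRing A] [Algebra k A] :
    ∀ (d : ℕ) (P : Fin (d + 1) → PrimeSpectrum A), StrictMono P →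
      ∃ t : Fin d → A ⧸ (P 0).asIdeal, AlgebraicIndependent k t
  | 0, P, _ => by
    have : Nontrivial (A ⧸ (P 0).asIdeal) :=
      Ideal.Quotient.nontrivial_iff.mpr (P 0).2.ne_top
    exact ⟨Fin.elim0, algebraicIndependent_empty_type_iff.mpr
      (algebraMap k (A ⧸ (P 0).asIdeal)).injective⟩
  | d + 1, P, hP => by
    obtain ⟨t, ht⟩ := exists_algebraicIndependent_of_strictMono d (fun a => P a.succ)
      (hP.comp Fin.strictMono_succ)
    have hlt : P 0 < P (Fin.succ 0) := hP (Fin.succ_pos 0)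
    -- The new independent element lies in the second prime but not in the first; the old ones are
    -- lifted from the quotient by the second prime.
    obtain ⟨s, hs1, hs0⟩ := Set.exists_of_ssubset (show ((P 0).asIdeal : Set A) ⊂ _ from hlt)
    let f : A ⧸ (P 0).asIdeal →ₐ[k] A ⧸ (P (Fin.succ 0)).asIdeal :=
      Ideal.Quotient.factorₐ k (PrimeSpectrum.asIdeal_le_asIdeal _ _ |>.mpr hlt.le)
    have hf : Function.Surjective f := Ideal.Quotient.factor_surjective hlt.le
    choose t' ht' using fun a => hf (t a)
    have key := AlgebraicIndependent.option_of_quotient (k := k) f (t := t')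
      (by simpa only [ht'] using ht) (s := Ideal.Quotient.mk _ s)
      (by rwa [Ne, Ideal.Quotient.eq_zero_iff_mem])
      (by change Ideal.Quotient.mk _ s = 0; rwa [Ideal.Quotient.eq_zero_iff_mem])
    exact ⟨_, key.comp (finSuccEquiv d) (finSuccEquiv d).injective⟩

/-- In characteristic zero `K` is formally étale over the polynomial ring `k[x]`: localize to
`k(x)`, then pass to a separable algebraic extension. So `Ω[K⁄k]` is the base change of the module
of differentials of the polynomial ring, and the `dx_a` form a basis. -/
theorem IsTranscendenceBasis.linearIndependent_D {K ι : Type*} [Field K] [Algebra k K] [CharZero k]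
    {x : ι → K} (hx : IsTranscendenceBasis k x) :
    LinearIndependent K fun a => KaehlerDifferential.D k K (x a) := by
  let S := MvPolynomial ι k
  let : Algebra S K := (MvPolynomial.aeval x).toAlgebra
  have : IsScalarTower k S K := IsScalarTower.of_algHom _
  let A₀ := Algebra.adjoin k (Set.range x)
  let F := IntermediateField.adjoin k (Set.range x)
  let : Algebra S A₀ := (hx.1.aevalEquiv : S →ₐ[k] A₀).toAlgebra
  have : IsScalarTower k S A₀ := IsScalarTower.of_algHom _
  have : IsScalarTower S A₀ K := IsScalarTower.of_algebraMap_eq fun p => by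
    change MvPolynomial.aeval _ p = ((hx.1.aevalEquiv p : A₀) : K)
    simp
  have : Algebra.FormallyEtale S A₀ := Algebra.FormallyEtale.of_equiv
    (AlgEquiv.ofBijective (Algebra.ofId S A₀) hx.1.aevalEquiv.bijective)
  have h1 : Algebra.FormallyEtale A₀ K := by
    open scoped IntermediateField.algebraAdjoinAdjoin in
    have h2 : Algebra.FormallyEtale A₀ F := .of_isLocalization (nonZeroDivisors _)
    have h3 : Algebra.IsAlgebraic F K := hx.isAlgebraic_field
    have : CharZero F := charZero_of_injective_algebraMap (algebraMap k F).injective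
    have h4 : Algebra.FormallyEtale F K := .of_isSeparable _ _
    exact .comp A₀ F K
  have : Algebra.FormallyEtale S K := .comp S A₀ K
  have hbc := KaehlerDifferential.isBaseChange_of_formallyEtale k S K
  have := ((Algebra.TensorProduct.basis K (KaehlerDifferential.mvPolynomialBasis k ι)).map
    hbc.equiv).linearIndependent
  convert! this using 1
  ext a
  rw [Module.Basis.map_apply, Algebra.TensorProduct.basis_apply,
    KaehlerDifferential.mvPolynomialBasis_apply]
  refine Eq.symm ((hbc.equiv_tmul _ _).trans ?_)
  rw [one_smul, KaehlerDifferential.map_D]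
  congr 1
  change MvPolynomial.aeval _ _ = _
  simp

theorem AlgebraicIndependent.linearIndependent_D {K ι : Type*} [Field K] [Algebra k K] [CharZero k]
    {t : ι → K} (ht : AlgebraicIndependent k t) :
    LinearIndependent K fun a => KaehlerDifferential.D k K (t a) := by
  obtain ⟨b, hb, hbt⟩ := exists_isTranscendenceBasis_superset (R := k)
    (AlgebraicIndependent.coe_range ht)
  have h := IsTranscendenceBasis.linearIndependent_D (k := k) hbt
  exact h.comp (fun a => (⟨t a, hb ⟨a, rfl⟩⟩ : b))
    fun x y hxy => AlgebraicIndependent.injective ht (congrArg Subtype.val hxy)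

end AlgebraicIndependence

open scoped KaehlerDifferential

/-! ### Derivations through algebraically independent elements and through smooth points. -/

section Derivations

variable {k : Type*} [Field k]

/-- These play the role of the partial derivatives `∂/∂t_a`: the functionals dual to the independent
`dt_b`, extended to all of `Ω[K⁄k]`. -/
theorem AlgebraicIndependent.exists_derivation {K ι : Type*} [Field K] [Algebra k K] [CharZero k]
    [DecidableEq ι] {t : ι → K} (ht : AlgebraicIndependent k t) :
    ∃ δ : ι → Derivation k K K, ∀ a b, δ a (t b) = if a = b then 1 else 0 := by
  have h := AlgebraicIndependent.linearIndependent_D ht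
  let B := Module.Basis.span h
  choose f hf using fun a => LinearMap.exists_extend (B.coord a)
  refine ⟨fun a => (f a).compDer (KaehlerDifferential.D k K), fun a b => ?_⟩
  have hb : KaehlerDifferential.D k K (t b) = (B b : Ω[K⁄k]) :=
    congrArg Subtype.val (Module.Basis.span_apply h b).symm
  have := LinearMap.congr_fun (hf a) (B b)
  simp only [LinearMap.coe_comp, Function.comp_apply, Submodule.coe_subtype,
    Module.Basis.coord_apply, Module.Basis.repr_self] at this
  rw [Finsupp.single_apply] at this
  change f a (KaehlerDifferential.D k K (t b)) = _
  rw [hb, this]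
  simp only [eq_comm]

/-- Composition with `D` embeds the dual of `Q` into the space `V` of point derivations, since the
values of `D` span; equal dimensions make the embedding onto. In the application `Q` is the fibre of
the module of differentials at the closed point. -/
theorem exists_dual_of_derivation {R Q : Type*} [CommRing R] [Algebra k R] [AddCommGroup Q] [Module k Q]
    [Module.Finite k Q] (e : R →ₐ[k] k) (D : R →ₗ[k] Q) (hspan : Submodule.span k (Set.range D) = ⊤)
    (hD : ∀ f g, D (f * g) = e f • D g + e g • D f) (V : Submodule k (Module.Dual k R))
    (hV : ∀ D : Module.Dual k R, D ∈ V ↔ ∀ f g, D (f * g) = e f * D g + e g * D f)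
    [Module.Finite k V] :
    Module.finrank k Q ≤ Module.finrank k V ∧ (Module.finrank k V ≤ Module.finrank k Q →
      ∀ ξ ∈ V, ∃ φ : Module.Dual k Q, ∀ r, ξ r = φ (D r)) := by
  let Φ : Module.Dual k Q →ₗ[k] V :=
    { toFun φ := ⟨φ ∘ₗ D, (hV _).mpr fun f g => by simp [hD]⟩
      map_add' _ _ := rfl
      map_smul' _ _ := rfl }
  have hΦ : Function.Injective Φ := by
    refine (injective_iff_map_eq_zero _).mpr fun φ hφ => ?_
    exact LinearMap.ext_on_range hspan fun r => LinearMap.congr_fun (congrArg Subtype.val hφ) r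
  have h1 := LinearMap.finrank_le_finrank_of_injective hΦ
  rw [Subspace.dual_finrank_eq] at h1
  refine ⟨h1, fun h2 ξ hξ => ?_⟩
  have hdim : Module.finrank k (Module.Dual k Q) = Module.finrank k V := by
    rw [Subspace.dual_finrank_eq]
    omega
  have hsurj : Function.Surjective Φ := by
    have := LinearMap.injective_iff_surjective_of_finrank_eq_finrank (K := k) (V := Module.Dual k Q) (V₂ := V) hdim (f := Φ)
    exact this.mp hΦ
  obtain ⟨φ, hφ⟩ := hsurj ⟨ξ, hξ⟩
  exact ⟨φ, fun r => (LinearMap.congr_fun (congrArg Subtype.val hφ) r).symm⟩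

/-- Let `R'` be a local domain essentially of finite type, with `d` algebraically independent
elements, and a quotient of an algebra `R` whose tangent space at the closed point has dimension at
most `d`. Then all tangent vectors of `R` are values of derivations of `R'`. -/
theorem exists_derivation_of_finrank_tangent_le {R R' : Type*} [CommRing R] [CommRing R'] [IsDomain R']
    [IsLocalRing R'] [Algebra k R] [Algebra k R'] [CharZero k] [Algebra.EssFiniteType k R']
    (π : R →ₐ[k] R') (hπ : Function.Surjective π) (ev : R' →ₐ[k] k) {d : ℕ} {t : Fin d → R'}
    (ht : AlgebraicIndependent k t) (V : Submodule k (Module.Dual k R))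
    (hV : ∀ D : Module.Dual k R,
      D ∈ V ↔ ∀ f g, D (f * g) = ev (π f) * D g + ev (π g) * D f)
    [Module.Finite k V] (hd : Module.finrank k V ≤ d) {ξ : Module.Dual k R} (hξ : ξ ∈ V) :
    ∃ δ : Derivation k R' R', ∀ r, ξ r = ev (δ (π r)) := by
  let K := FractionRing R'
  let Q := Ω[R'⁄k] ⧸ (IsLocalRing.maximalIdeal R' • ⊤ : Submodule R' Ω[R'⁄k])
  let q : Ω[R'⁄k] →ₗ[R'] Q := Submodule.mkQ _
  -- An element of the local ring acts on the fibre `Q` through its value, because `r - ev r` is not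
  -- a unit.
  have hact : ∀ (r : R') (x : Q), r • x = ev r • x := by
    intro r x
    obtain ⟨x, rfl⟩ := Submodule.mkQ_surjective _ x
    rw [← algebraMap_smul R' (ev r), ← sub_eq_zero, ← sub_smul, ← map_smul]
    refine (Submodule.Quotient.mk_eq_zero _).mpr (Submodule.smul_mem_smul ?_ trivial)
    refine (IsLocalRing.mem_maximalIdeal _).mpr fun hu => ?_
    have := hu.map ev
    simp at this
  have hspan : ∀ s : Set Q, Submodule.span R' s = ⊤ → Submodule.span k s = ⊤ := by
    intro s hs
    refine top_unique fun x _ => ?_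
    have hx : x ∈ Submodule.span R' s := hs ▸ trivial
    induction hx using Submodule.span_induction with
    | mem x hx => exact Submodule.subset_span hx
    | zero => exact zero_mem _
    | add x y _ _ hx hy => exact add_mem (hx trivial) (hy trivial)
    | smul r x _ hx => rw [hact]; exact Submodule.smul_mem _ _ (hx trivial)
  have hfin : Module.Finite k Q := by
    obtain ⟨s, hs⟩ := (Module.Finite.fg_top : (⊤ : Submodule R' Q).FG)
    exact ⟨⟨s, hspan _ hs⟩⟩
  have hDspan : Submodule.span k (Set.range fun r : R' => q (KaehlerDifferential.D k R' r)) = ⊤ := by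
    apply hspan
    rw [Set.range_comp' q, ← Submodule.map_span, KaehlerDifferential.span_range_derivation,
      Submodule.map_top, Submodule.range_mkQ]
  let DQ : R →ₗ[k] Q :=
    (q.restrictScalars k) ∘ₗ (KaehlerDifferential.D k R').toLinearMap ∘ₗ π.toLinearMap
  obtain ⟨hed, hdual⟩ := exists_dual_of_derivation (ev.comp π) DQ
    (by
      rw [← hDspan]
      congr 1
      exact hπ.range_comp fun r : R' => q (KaehlerDifferential.D k R' r))
    (fun f g => by simp [DQ, hact]) V hV
  let b := Module.finBasis k Q
  choose m hm using fun a => Submodule.mkQ_surjective _ (b a)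
  -- Nakayama: lifts of a basis of the fibre generate the differentials of `R'`.
  have hmspan : Submodule.span R' (Set.range m) = ⊤ := by
    refine top_unique (Submodule.le_of_le_smul_of_le_jacobson_bot
      (I := IsLocalRing.maximalIdeal R') Module.Finite.fg_top
      (IsLocalRing.maximalIdeal_le_jacobson _) ?_)
    rw [top_le_iff, sup_comm, ← Submodule.map_mkQ_eq_top, Submodule.map_span, ← Set.range_comp]
    refine top_unique fun x _ => ?_
    have hx : x ∈ Submodule.span k (Set.range b) := b.span_eq ▸ trivial
    rw [show _ ∘ m = b from funext hm]
    exact Submodule.span_le_restrictScalars k R' _ hx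
  have htK : AlgebraicIndependent k fun a => algebraMap R' K (t a) :=
    ht.map' (f := IsScalarTower.toAlgHom k R' K) (IsFractionRing.injective R' K)
  have hli := AlgebraicIndependent.linearIndependent_D htK
  let mK := fun a => KaehlerDifferential.map k k R' K (m a)
  have hmK : Submodule.span K (Set.range mK) = ⊤ := by
    have h1 := span_eq_top_of_isLocalizedModule K (nonZeroDivisors R')
      (KaehlerDifferential.map k k R' K) hmspan
    rwa [← Set.range_comp] at h1
  -- The dimension of `Ω[K⁄k]` is at least `d` by independence and at most that of `Q` by
  -- generation. Combined with `hed` and `hd`, the numbers `d`, `dim Ω[K⁄k]`, `dim Q` and `dim V`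
  -- coincide.
  have hde : d ≤ Module.finrank k Q := by
    have : Module.Finite K Ω[K⁄k] := ⟨⟨(Set.finite_range mK).toFinset, by simpa using hmK⟩⟩
    have h1 := hli.fintype_card_le_finrank
    have h2 := finrank_range_le_card (R := K) mK
    rw [Set.finrank, hmK, finrank_top] at h2
    simp only [Fintype.card_fin] at h1 h2
    exact h1.trans h2
  obtain ⟨φ, hφ⟩ := hdual (hd.trans hde) ξ hξ
  have hmKli : LinearIndependent K mK := by
    refine linearIndependent_of_top_le_span_of_card_eq_finrank hmK.ge ?_
    have : Module.Finite K Ω[K⁄k] := ⟨⟨(Set.finite_range mK).toFinset, by simpa using hmK⟩⟩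
    have h1 := hli.fintype_card_le_finrank
    have h2 := finrank_range_le_card (R := K) mK
    rw [Set.finrank, hmK, finrank_top] at h2
    simp only [Fintype.card_fin] at h1 h2 ⊢
    omega
  -- The generators stay independent over `K`, so the differentials of `R'` are free, and any
  -- functional on the fibre lifts to an `R'`-linear map, that is, to a derivation of `R'`.
  have hmli : LinearIndependent R' m := by
    refine LinearIndependent.of_comp (KaehlerDifferential.map k k R' K) ?_
    exact hmKli.restrict_scalars (R := R') (by
      intro x y hxy
      simpa [Algebra.smul_def] using hxy)
  let B := Module.Basis.mk hmli hmspan.ge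
  let L : Ω[R'⁄k] →ₗ[R'] R' := B.constr ℕ fun a => algebraMap k R' (φ (b a))
  refine ⟨L.compDer (KaehlerDifferential.D k R'), fun r => ?_⟩
  have key : ∀ x : Ω[R'⁄k], φ (q x) = ev (L x) := by
    intro x
    have hx : x ∈ Submodule.span R' (Set.range B) := by rw [B.span_eq]; exact Submodule.mem_top
    induction hx using Submodule.span_induction with
    | mem x hx =>
      obtain ⟨a, rfl⟩ := hx
      have h1 : q (B a) = b a := by rw [Module.Basis.mk_apply]; exact hm a
      rw [h1, Module.Basis.constr_basis]
      simp
    | zero => simp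
    | add x y _ _ hx hy => simp [hx, hy]
    | smul r x _ hx => rw [map_smul, hact, map_smul, hx, map_smul, smul_eq_mul, smul_eq_mul, map_mul]
  exact (hφ r).trans (key _)

end Derivations

/-! ### Counting matrix positions by the heights of their row and column. -/

section FlagCounting

open Finset

variable {ι : Type*} [Fintype ι]

theorem card_pairs_eq_sum (ht : ι → ℕ) (N : ℕ) (hN : ∀ a, ht a < N) (s : ℕ) :
    #{p : ι × ι | ht p.2 = ht p.1 + s} =
      ∑ h ∈ range N, #{a | ht a = h} * #{a | ht a = h + s} := by
  rw [card_eq_sum_card_fiberwise (f := fun p => ht p.1) (t := range N)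
    (fun p _ => by simpa using hN p.1)]
  refine sum_congr rfl fun h _ => ?_
  rw [← card_product]
  congr 1
  ext p
  simp only [mem_filter, mem_univ, true_and, mem_product]
  constructor
  · rintro ⟨h1, h2⟩
    exact ⟨h2, by omega⟩
  · rintro ⟨h1, h2⟩
    exact ⟨by omega, h1⟩

/-- With level sizes `D_h` this compares `∑ D_h D_{h+1}` with `∑ D_h²`. Summing `2 D_h D_{h+1} ≤
D_h² + D_{h+1}²` leaves at least half of the top square to spare, and the top level is nonempty. The
gained unit is needed in the final dimension bound. -/
theorem card_pairs_succ_lt [Nonempty ι] (ht : ι → ℕ) :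
    #{p : ι × ι | ht p.2 = ht p.1 + 1} + 1 ≤ #{p : ι × ι | ht p.2 = ht p.1} := by
  obtain ⟨a₀, ha₀⟩ : ∃ a₀, ∀ a, ht a ≤ ht a₀ := Finite.exists_max ht
  have h0 := card_pairs_eq_sum ht (ht a₀ + 1) (fun a => Nat.lt_succ_of_le (ha₀ a)) 0
  have h1 := card_pairs_eq_sum ht (ht a₀ + 1) (fun a => Nat.lt_succ_of_le (ha₀ a)) 1
  simp only [add_zero] at h0
  set D : ℕ → ℕ := fun h => #{a | ht a = h}
  have hpos : 1 ≤ D (ht a₀) := card_pos.mpr ⟨a₀, by simp⟩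
  have hz : D (ht a₀ + 1) = 0 := by
    refine card_eq_zero.mpr (filter_eq_empty_iff.mpr fun a _ h => ?_)
    have := ha₀ a
    omega
  have key : ∀ m, 2 * ∑ h ∈ range m, D h * D (h + 1) ≤
      2 * ∑ h ∈ range m, D h * D h + D m * D m := by
    intro m
    induction m with
    | zero => simp
    | succ m ih =>
      rw [sum_range_succ, sum_range_succ]
      nlinarith [two_mul_le_add_sq (D m) (D (m + 1))]
  have h2 := key (ht a₀)
  rw [sum_range_succ, show #{a | ht a = ht a₀ + 1} = 0 from hz, mul_zero] at h1
  rw [sum_range_succ] at h0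
  have := Nat.mul_le_mul hpos hpos
  rw [h0, h1]
  change ∑ h ∈ range (ht a₀), D h * D (h + 1) + 0 + 1 ≤
    ∑ h ∈ range (ht a₀), D h * D h + D (ht a₀) * D (ht a₀)
  omega

theorem card_pairs_lt (ht : ι → ℕ) :
    2 * #{p : ι × ι | ht p.2 < ht p.1} + #{p : ι × ι | ht p.2 = ht p.1} =
      Fintype.card ι ^ 2 := by
  have hswap : #{p : ι × ι | ht p.1 < ht p.2} = #{p : ι × ι | ht p.2 < ht p.1} :=
    card_equiv (Equiv.prodComm ι ι) (by simp)
  have h1 := card_filter_add_card_filter_not (s := (univ : Finset (ι × ι)))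
    (fun p => ht p.2 < ht p.1)
  have h2 := card_filter_add_card_filter_not (s := ({p : ι × ι | ¬ ht p.2 < ht p.1}))
    (fun p => ht p.2 = ht p.1)
  rw [filter_filter, filter_filter] at h2
  have h3 : #{p : ι × ι | ¬ ht p.2 < ht p.1 ∧ ht p.2 = ht p.1} =
      #{p : ι × ι | ht p.2 = ht p.1} := by
    congr 1; ext p; simp only [mem_filter, mem_univ, true_and]; omega
  have h4 : #{p : ι × ι | ¬ ht p.2 < ht p.1 ∧ ¬ ht p.2 = ht p.1} =
      #{p : ι × ι | ht p.1 < ht p.2} := by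
    congr 1; ext p; simp only [mem_filter, mem_univ, true_and]; omega
  rw [card_univ, Fintype.card_prod] at h1
  rw [sq]
  omega

theorem card_le_card_pairs_eq (ht : ι → ℕ) :
    Fintype.card ι ≤ #{p : ι × ι | ht p.2 = ht p.1} := by
  rw [← card_univ]
  exact card_le_card_of_injOn (fun a => (a, a)) (by intro a; simp)
    (fun a _ b _ h => (Prod.mk.inj h).1)

theorem card_pairs_le_succ (ht : ι → ℕ) :
    #{p : ι × ι | ht p.2 ≤ ht p.1 + 1} =
      #{p : ι × ι | ht p.2 ≤ ht p.1} + #{p : ι × ι | ht p.2 = ht p.1 + 1} := by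
  classical
  rw [← card_union_of_disjoint]
  · congr 1; ext p; simp only [mem_filter, mem_univ, true_and, mem_union]; omega
  · rw [disjoint_filter]; intro p _ h; omega

end FlagCounting

/-! ### Bases adapted to a filtration. -/

section AdaptedBasis

variable {K : Type*} [Field K] {V : Type*} [AddCommGroup V] [Module K V]

/-- A finite decreasing filtration has a basis adapted to it. -/
theorem exists_linearIndepOn_filtration (F : ℕ → Submodule K V) (hF : Antitone F) (N : ℕ)
    (hN : F N = ⊥) : ∀ m, ∃ s : ℕ → Set V, (∀ p, N - m ≤ p → s p ⊆ F p) ∧ Antitone s ∧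
      (∀ p, N - m ≤ p → Submodule.span K (s p) = F p) ∧ LinearIndepOn K id (s (N - m)) := by
  -- The basis is built upwards from the last term `F N = ⊥`, with `m` counting the steps; once `m ≥
  -- N` truncated subtraction leaves nothing more to do.
  intro m
  induction m with
  | zero =>
    refine ⟨fun _ => ∅, by simp, fun _ _ _ => subset_rfl, fun p hp => ?_, by simp⟩
    rw [Submodule.span_empty, eq_comm, ← le_bot_iff, ← hN]
    exact hF (by omega)
  | succ m ih =>
    obtain ⟨s, h1, h2, h3, h4⟩ := ih
    by_cases hm : N ≤ m
    · have : N - (m + 1) = N - m := by omega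
      exact ⟨s, this ▸ h1, h2, this ▸ h3, this ▸ h4⟩
    have hsucc : N - m = N - (m + 1) + 1 := by omega
    obtain ⟨b, hb1, hb2, hb3, hb4⟩ := exists_linearIndepOn_id_extension h4
      (show s (N - m) ⊆ (F (N - (m + 1)) : Set V) from
        (h1 _ le_rfl).trans (hF (by omega)))
    have hspan : Submodule.span K b = F (N - (m + 1)) :=
      le_antisymm (Submodule.span_le.mpr hb1) hb3
    refine ⟨fun p => if p ≤ N - (m + 1) then b else s p, ?_, ?_, ?_, ?_⟩
    · intro p hp
      beta_reduce
      split_ifs with h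
      · rw [le_antisymm h hp]; exact hb1
      · exact h1 p (by omega)
    · intro p q hpq
      beta_reduce
      split_ifs with h h' h'
      · exact subset_rfl
      · omega
      · exact (h2 (show N - m ≤ q by omega)).trans hb2
      · exact h2 hpq
    · intro p hp
      beta_reduce
      split_ifs with h
      · rw [le_antisymm h hp]; exact hspan
      · exact h3 p (by omega)
    · simpa using hb4

theorem exists_basis_adapted_filtration [FiniteDimensional K V] {n : ℕ} (hn : Module.finrank K V = n)
    (F : ℕ → Submodule K V) (hF : Antitone F) (h0 : F 0 = ⊤) (N : ℕ) (hN : F N = ⊥) :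
    ∃ (b : Module.Basis (Fin n) K V) (ht : Fin n → ℕ),
      ∀ p, F p = Submodule.span K (b '' {a | p ≤ ht a}) := by
  classical
  obtain ⟨s, h1, h2, h3, h4⟩ := exists_linearIndepOn_filtration F hF N hN N
  simp only [Nat.sub_self, Nat.zero_le, forall_true_left] at h1 h3 h4
  let B : Module.Basis (s 0) K V := Module.Basis.mk h4 (by
    rw [← h0, ← h3 0]; simp)
  have : Fintype (s 0) := FiniteDimensional.fintypeBasisIndex B
  let e : s 0 ≃ Fin n := Fintype.equivFinOfCardEq
    ((Module.finrank_eq_card_basis B).symm.trans hn)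
  have hsN : ∀ v, v ∈ s 0 → v ∉ s N := by
    intro v hv hvN
    have hb := h1 N hvN
    rw [hN] at hb
    exact h4.ne_zero hv hb
  have hfind : ∀ v : s 0, ∀ p, v.1 ∈ s p ↔ p ≤ Nat.findGreatest (fun q => v.1 ∈ s q) N := by
    intro v p
    constructor
    · intro hv
      refine Nat.le_findGreatest ?_ hv
      by_contra hp
      exact hsN v v.2 (h2 (le_of_not_ge hp) hv)
    · intro hp
      exact h2 hp (Nat.findGreatest_spec (P := fun q => v.1 ∈ s q) (Nat.zero_le N) v.2)
  -- The height of a basis vector is the last index at which it still belongs to the nested family.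
  refine ⟨B.reindex e, fun a => Nat.findGreatest (fun q => (e.symm a).1 ∈ s q) N, fun p => ?_⟩
  rw [← h3 p]
  congr 1
  ext v
  simp only [Set.mem_image, Set.mem_ofPred_eq, ← hfind, Module.Basis.reindex_apply]
  constructor
  · intro hv
    refine ⟨e ⟨v, h2 (Nat.zero_le p) hv⟩, by simpa using hv, by simp [B]⟩
  · rintro ⟨a, ha, rfl⟩
    simpa [B] using ha

end AdaptedBasis

namespace BouquetQuiver

open Matrix

/-! ### Words in a tuple of matrices. -/

section Words

/-- The product of matrices along a word. -/
def wordProd {R Λ m : Type*} [Semiring R] [Fintype m] [DecidableEq m] (x : Λ → Matrix m m R)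
    (w : List Λ) : Matrix m m R :=
  (w.map x).prod

variable {R Λ m : Type*} [Semiring R] [Fintype m] [DecidableEq m] (x : Λ → Matrix m m R)

theorem wordProd_nil : wordProd x [] = 1 := rfl

theorem wordProd_cons (c : Λ) (w : List Λ) : wordProd x (c :: w) = x c * wordProd x w := by
  simp [wordProd]

theorem wordProd_append (v w : List Λ) : wordProd x (v ++ w) = wordProd x v * wordProd x w := by
  simp [wordProd]

theorem wordProd_map {S : Type*} [Semiring S] (f : R →+* S) (w : List Λ) :
    (wordProd x w).map f = wordProd (fun c => (x c).map f) w := by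
  induction w with
  | nil => exact Matrix.map_one f (map_zero f) (map_one f)
  | cons c w ih => rw [wordProd_cons, wordProd_cons, Matrix.map_mul, ih]

theorem wordProd_conj {S : Type*} [CommRing S] (x : Λ → Matrix m m S) (g : GL m S) (w : List Λ) :
    wordProd (fun c => g.1 * x c * g⁻¹.1) w = g.1 * wordProd x w * g⁻¹.1 := by
  have h : g⁻¹.1 * g.1 = 1 := by rw [← Units.val_mul]; simp
  have h' : g.1 * g⁻¹.1 = 1 := by rw [← Units.val_mul]; simp
  induction w with
  | nil => rw [wordProd_nil, wordProd_nil, Matrix.mul_one, h']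
  | cons c w ih =>
    rw [wordProd_cons, wordProd_cons, ih]
    calc g.1 * x c * g⁻¹.1 * (g.1 * wordProd x w * g⁻¹.1)
        = g.1 * x c * (g⁻¹.1 * g.1) * wordProd x w * g⁻¹.1 := by simp only [Matrix.mul_assoc]
      _ = _ := by rw [h]; simp only [Matrix.mul_assoc, Matrix.one_mul]

end Words

/-! ### The radical filtration of a nilpotent tuple. -/

section Filtration

variable {K Λ : Type*} [Field K] {n : ℕ} (x : Λ → Matrix (Fin n) (Fin n) K)

/-- The filtration `V ⊇ 𝔪V ⊇ 𝔪²V ⊇ …`, where `𝔪V = ∑ x_c V`. -/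
def radicalFiltration : ℕ → Submodule K (Fin n → K)
  | 0 => ⊤
  | p + 1 => ⨆ c, (radicalFiltration p).map (x c).mulVecLin

theorem radicalFiltration_antitone : Antitone (radicalFiltration x) := by
  refine antitone_nat_of_succ_le fun p => ?_
  induction p with
  | zero => exact le_top
  | succ p ih => exact iSup_mono fun c => Submodule.map_mono ih

/-- By induction on `p`, the `p`-th term is killed by every word of length `N - p`; at `p = N` the
word is empty. -/
theorem radicalFiltration_eq_bot {N : ℕ} (hx : ∀ w : List Λ, w.length = N → wordProd x w = 0) :
    radicalFiltration x N = ⊥ := by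
  have key : ∀ p (w : List Λ), p + w.length = N →
      (radicalFiltration x p).map (wordProd x w).mulVecLin = ⊥ := by
    intro p
    induction p with
    | zero =>
      intro w hw
      rw [hx w (by omega), Matrix.mulVecLin_zero, Submodule.map_zero]
    | succ p ih =>
      intro w hw
      rw [radicalFiltration, Submodule.map_iSup, iSup_eq_bot]
      intro c
      rw [← Submodule.map_comp, ← Matrix.mulVecLin_mul, ← ih (w ++ [c]) (by simp; omega),
        wordProd_append, wordProd_cons, wordProd_nil, Matrix.mul_one]
  have := key N [] rfl
  rwa [wordProd_nil, Matrix.mulVecLin_one, Submodule.map_id] at this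

theorem mulVec_mem_radicalFiltration (c : Λ) {p : ℕ} {v : Fin n → K}
    (hv : v ∈ radicalFiltration x p) : x c *ᵥ v ∈ radicalFiltration x (p + 1) :=
  Submodule.mem_iSup_of_mem (p := fun c => (radicalFiltration x p).map (x c).mulVecLin) c
    ⟨v, hv, rfl⟩

/-- A nilpotent tuple of matrices is strictly triangular in a basis adapted to the radical
filtration, and the endomorphisms whose commutators with the tuple preserve the filtration lower it
by at most one step. -/
theorem exists_conj_strictly_triangular {N : ℕ} (hx : ∀ w : List Λ, w.length = N → wordProd x w = 0) :
    ∃ (g : GL (Fin n) K) (ht : Fin n → ℕ),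
      (∀ c r q, (g⁻¹.1 * x c * g.1) r q ≠ 0 → ht q < ht r) ∧
      ∀ a : Matrix (Fin n) (Fin n) K,
        (∀ c r q, (a * (g⁻¹.1 * x c * g.1) - (g⁻¹.1 * x c * g.1) * a) r q ≠ 0 → ht q ≤ ht r) →
        ∀ r q, a r q ≠ 0 → ht q ≤ ht r + 1 := by
  obtain ⟨b, ht, hb⟩ := exists_basis_adapted_filtration (K := K) (V := Fin n → K) (n := n) (by simp)
    (radicalFiltration x) (radicalFiltration_antitone x) rfl N (radicalFiltration_eq_bot x hx)
  have hmem : ∀ p v, v ∈ radicalFiltration x p ↔ ∀ r, b.repr v r ≠ 0 → p ≤ ht r := by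
    intro p v
    rw [hb, Module.Basis.mem_span_image]
    constructor
    · intro h r hr
      exact h (by simpa using hr)
    · intro h r hr
      exact h r (by simpa using hr)
  let e := Pi.basisFun K (Fin n)
  -- The columns of `g` are the vectors of the adapted basis, so conjugation by `g` passes to
  -- matrices in that basis.
  let g : GL (Fin n) K := ⟨e.toMatrix b, b.toMatrix e, e.toMatrix_mul_toMatrix_flip b,
    b.toMatrix_mul_toMatrix_flip e⟩
  have hconj : ∀ c, g⁻¹.1 * x c * g.1 = LinearMap.toMatrix b b (x c).mulVecLin := by
    intro c
    have := basis_toMatrix_mul_linearMap_toMatrix_mul_basis_toMatrix b e b e (x c).mulVecLin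
    rw [← this]
    congr 2
    exact (LinearMap.toMatrix'_toLin' (x c)).symm
  refine ⟨g, ht, fun c r q h => ?_, fun a ha => ?_⟩
  · rw [hconj, LinearMap.toMatrix_apply] at h
    have h1 : b q ∈ radicalFiltration x (ht q) := (hmem _ _).mpr fun r hr => by
      rw [b.repr_self, Finsupp.single_apply] at hr
      rw [(ite_ne_right_iff.mp hr).1]
    exact (hmem _ _).mp (mulVec_mem_radicalFiltration x c h1) r h
  · let A := Matrix.toLin b b a
    have hcomm : ∀ c p v, v ∈ radicalFiltration x p →
        A (x c *ᵥ v) - x c *ᵥ A v ∈ radicalFiltration x p := by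
      intro c p v hv
      let C := A ∘ₗ (x c).mulVecLin - (x c).mulVecLin ∘ₗ A
      have hC : LinearMap.toMatrix b b C =
          a * (g⁻¹.1 * x c * g.1) - (g⁻¹.1 * x c * g.1) * a := by
        rw [hconj, map_sub, LinearMap.toMatrix_comp b b b, LinearMap.toMatrix_comp b b b,
          LinearMap.toMatrix_toLin]
      suffices h : radicalFiltration x p ≤ (radicalFiltration x p).comap C from h hv
      conv_lhs => rw [hb]
      rw [Submodule.span_le]
      rintro _ ⟨q, hq, rfl⟩
      refine (hmem _ _).mpr fun r hr => ?_
      rw [← LinearMap.toMatrix_apply, hC] at hr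
      exact le_trans hq (ha c r q hr)
    -- Term `p + 2` is generated by the `x_c u` with `u` in term `p + 1`, and `A x_c u = [A, x_c] u
    -- + x_c A u`; both summands lie in term `p + 1`. Only here is it essential that the filtration
    -- is the radical one and not an arbitrary stable flag.
    have hA : ∀ p v, v ∈ radicalFiltration x (p + 1) → A v ∈ radicalFiltration x p := by
      intro p
      induction p with
      | zero => exact fun _ _ => trivial
      | succ p ih =>
        intro v hv
        suffices h : radicalFiltration x (p + 2) ≤ (radicalFiltration x (p + 1)).comap A from h hv
        refine iSup_le fun c => ?_
        rintro _ ⟨u, hu, rfl⟩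
        have h1 := hcomm c (p + 1) u hu
        have h2 := mulVec_mem_radicalFiltration x c (ih u hu)
        have := add_mem h1 h2
        rwa [sub_add_cancel] at this
    intro r q hrq
    rcases hq : ht q with _ | h
    · omega
    have h1 : b q ∈ radicalFiltration x (h + 1) := (hmem _ _).mpr fun r hr => by
      rw [b.repr_self, Finsupp.single_apply] at hr
      rw [← (ite_ne_right_iff.mp hr).1, hq]
    have h2 := (hmem _ _).mp (hA h _ h1) r (by
      rw [← LinearMap.toMatrix_apply, LinearMap.toMatrix_toLin]
      exact hrq)
    omega

end Filtration

end BouquetQuiver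

namespace BouquetQuiver

open Matrix Module

/-! ### Strictly triangular tuples and the differential of the moment map on them. -/

section Supported

variable {K ι : Type*} [Field K]

/-- The matrices with entries supported on a given set of positions. -/
def supportedMatrix (K : Type*) [Field K] {ι : Type*} (P : ι × ι → Prop) [DecidablePred P] :
    ({p // P p} → K) →ₗ[K] Matrix ι ι K where
  toFun f := of fun r q => if h : P (r, q) then f ⟨(r, q), h⟩ else 0
  map_add' f g := by ext r q; by_cases h : P (r, q) <;> simp [h]
  map_smul' c f := by ext r q; by_cases h : P (r, q) <;> simp [h]

/-- Tuples of strictly triangular matrices, with respect to a height function. -/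
def strictTuples (K Λ : Type*) [Field K] {ι : Type*} (ht : ι → ℕ) :
    (Λ → {p : ι × ι // ht p.2 < ht p.1} → K) →ₗ[K] Λ → Matrix ι ι K :=
  LinearMap.pi fun c => supportedMatrix K (fun p : ι × ι => ht p.2 < ht p.1) ∘ₗ LinearMap.proj c

theorem exists_supportedMatrix_eq (P : ι × ι → Prop) [DecidablePred P] (M : Matrix ι ι K)
    (hM : ∀ r q, M r q ≠ 0 → P (r, q)) : ∃ f, supportedMatrix K P f = M := by
  refine ⟨fun p => M p.1.1 p.1.2, ?_⟩
  ext r q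
  by_cases h : P (r, q)
  · simp [supportedMatrix, h]
  · have : M r q = 0 := by by_contra h'; exact h (hM r q h')
    simp [supportedMatrix, h, this]

end Supported

section LinearizedMoment

variable {R : Type*} [CommRing R] {n ℓ : ℕ}

/-- The differential of `∑ [X_k, Y_k]`. -/
def linearizedMoment (x : Fin ℓ ⊕ Fin ℓ → Matrix (Fin n) (Fin n) R) :
    (Fin ℓ ⊕ Fin ℓ → Matrix (Fin n) (Fin n) R) →ₗ[R] Matrix (Fin n) (Fin n) R where
  toFun t := ∑ k, ((t (.inl k) * x (.inr k) - x (.inr k) * t (.inl k)) +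
    (x (.inl k) * t (.inr k) - t (.inr k) * x (.inl k)))
  map_add' s t := by
    rw [← Finset.sum_add_distrib]
    refine Finset.sum_congr rfl fun k _ => ?_
    simp only [Pi.add_apply, Matrix.add_mul, Matrix.mul_add]
    abel
  map_smul' c t := by
    rw [RingHom.id_apply, Finset.smul_sum]
    refine Finset.sum_congr rfl fun k _ => ?_
    simp only [Pi.smul_apply, Matrix.smul_mul, Matrix.mul_smul, smul_add, smul_sub]

/-- The infinitesimal conjugation action. -/
def commTuple {Λ : Type*} (x : Λ → Matrix (Fin n) (Fin n) R) :
    Matrix (Fin n) (Fin n) R →ₗ[R] Λ → Matrix (Fin n) (Fin n) R where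
  toFun a c := a * x c - x c * a
  map_add' a b := by
    ext1 c
    simp only [Pi.add_apply, Matrix.add_mul, Matrix.mul_add]
    abel
  map_smul' r a := by
    ext1 c
    simp only [Pi.smul_apply, Matrix.smul_mul, Matrix.mul_smul, smul_sub, RingHom.id_apply]

/-- This is the equivariance of `∑ [X_k, Y_k]` under conjugation, differentiated. -/
theorem linearizedMoment_commTuple (x : Fin ℓ ⊕ Fin ℓ → Matrix (Fin n) (Fin n) R)
    (a : Matrix (Fin n) (Fin n) R) :
    linearizedMoment x (commTuple x a) =
      a * (∑ k, (x (.inl k) * x (.inr k) - x (.inr k) * x (.inl k))) -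
        (∑ k, (x (.inl k) * x (.inr k) - x (.inr k) * x (.inl k))) * a := by
  rw [Finset.mul_sum, Finset.sum_mul, ← Finset.sum_sub_distrib]
  change ∑ k, (((a * x (.inl k) - x (.inl k) * a) * x (.inr k) -
      x (.inr k) * (a * x (.inl k) - x (.inl k) * a)) +
    (x (.inl k) * (a * x (.inr k) - x (.inr k) * a) -
      (a * x (.inr k) - x (.inr k) * a) * x (.inl k))) = _
  refine Finset.sum_congr rfl fun k _ => ?_
  noncomm_ring

end LinearizedMoment

/-! ### The linear algebra of the dimension bound. -/

section Bound

variable {K : Type*} [Field K] {n ℓ : ℕ}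

/-- By the trace form, a functional vanishing on the image is a matrix `a`, and testing it on
elementary strictly triangular directions says that all `[a, x_c]` preserve the filtration. Then
`hP` confines `a` to the positions with `ht q ≤ ht r + 1`, which bounds the corank. -/
theorem finrank_range_linearizedMoment_ge (x : Fin ℓ ⊕ Fin ℓ → Matrix (Fin n) (Fin n) K)
    (ht : Fin n → ℕ)
    (hP : ∀ a : Matrix (Fin n) (Fin n) K, (∀ c r q, (a * x c - x c * a) r q ≠ 0 → ht q ≤ ht r) →
      ∀ r q, a r q ≠ 0 → ht q ≤ ht r + 1) :
    n ^ 2 ≤ finrank K (LinearMap.range (linearizedMoment x ∘ₗ strictTuples K _ ht)) +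
      Fintype.card {p : Fin n × Fin n // ht p.2 ≤ ht p.1 + 1} := by
  set L := linearizedMoment x ∘ₗ strictTuples K _ ht
  have h1 := LinearMap.finrank_range_add_finrank_ker L.dualMap
  rw [LinearMap.finrank_range_dualMap_eq_finrank_range, Subspace.dual_finrank_eq,
    finrank_matrix, finrank_self] at h1
  simp only [Fintype.card_fin, mul_one, ← sq] at h1
  rw [← h1]
  gcongr
  let E : Dual K (Matrix (Fin n) (Fin n) K) →ₗ[K] {p : Fin n × Fin n // ht p.2 ≤ ht p.1 + 1} → K :=
    { toFun φ p := φ (Matrix.single p.1.2 p.1.1 1)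
      map_add' _ _ := rfl
      map_smul' _ _ := rfl }
  rw [← finrank_fintype_fun_eq_card K]
  refine LinearMap.finrank_le_finrank_of_injective (f := E ∘ₗ (LinearMap.ker L.dualMap).subtype) ?_
  refine (injective_iff_map_eq_zero _).mpr fun ⟨φ, hφ⟩ hE => ?_
  let a : Matrix (Fin n) (Fin n) K := of fun r q => φ (Matrix.single q r 1)
  have htr : ∀ M, φ M = (a * M).trace := by
    intro M
    conv_lhs => rw [matrix_eq_sum_single M]
    simp only [map_sum, Matrix.trace, Matrix.diag_apply, Matrix.mul_apply, a, of_apply]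
    rw [Finset.sum_comm]
    refine Finset.sum_congr rfl fun r _ => Finset.sum_congr rfl fun q _ => ?_
    rw [show Matrix.single q r (M q r) = M q r • Matrix.single q r 1 by simp, map_smul,
      smul_eq_mul, mul_comm]
  have hentry : ∀ (b : Matrix (Fin n) (Fin n) K) r q,
      (b * Matrix.single q r 1).trace = b r q := by
    intro b r q
    rw [Matrix.trace_mul_single]
    simp
  have hL : ∀ c' r q, ht r < ht q →
      (a * linearizedMoment x (Pi.single c' (Matrix.single q r 1))).trace = 0 := by
    intro c' r q hrq
    obtain ⟨f, hf⟩ := exists_supportedMatrix_eq (K := K)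
      (fun p : Fin n × Fin n => ht p.2 < ht p.1) (Matrix.single q r 1) (by
        intro r' q' h
        rw [Matrix.single_apply] at h
        obtain ⟨⟨rfl, rfl⟩, -⟩ := ite_ne_right_iff.mp h
        exact hrq)
    have h2 := LinearMap.congr_fun (LinearMap.mem_ker.mp hφ) (Pi.single c' f)
    rw [LinearMap.dualMap_apply, LinearMap.zero_apply, htr] at h2
    rw [← h2]
    change _ = (a * linearizedMoment x (strictTuples K _ ht (Pi.single c' f))).trace
    congr 3
    ext1 c
    change _ = supportedMatrix K _ ((Pi.single c' f : Fin ℓ ⊕ Fin ℓ → _) c)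
    rcases eq_or_ne c c' with rfl | hc
    · rw [Pi.single_eq_same, Pi.single_eq_same, hf]
    · rw [Pi.single_eq_of_ne hc, Pi.single_eq_of_ne hc, map_zero]
  have hsupp := hP a fun c r q h => by
    by_contra hlt
    apply h
    push Not at hlt
    rcases c with k | k
    · have h3 := hL (.inr k) r q hlt
      simp only [linearizedMoment, LinearMap.coe_mk, AddHom.coe_mk] at h3
      rw [Finset.sum_eq_single k (fun k' _ hk' => by simp [hk']) (by simp)] at h3
      simp only [Pi.single_eq_same, ne_eq, reduceCtorEq, not_false_eq_true, Pi.single_eq_of_ne,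
        Matrix.zero_mul, Matrix.mul_zero, sub_zero, zero_add] at h3
      rw [Matrix.mul_sub, Matrix.trace_sub, ← Matrix.mul_assoc, hentry, ← Matrix.mul_assoc,
        Matrix.trace_mul_comm, ← Matrix.mul_assoc, hentry] at h3
      exact h3
    · have h3 := hL (.inl k) r q hlt
      simp only [linearizedMoment, LinearMap.coe_mk, AddHom.coe_mk] at h3
      rw [Finset.sum_eq_single k (fun k' _ hk' => by simp [hk']) (by simp)] at h3
      simp only [Pi.single_eq_same, ne_eq, reduceCtorEq, not_false_eq_true, Pi.single_eq_of_ne,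
        Matrix.zero_mul, Matrix.mul_zero, sub_zero, add_zero] at h3
      rw [Matrix.mul_sub, Matrix.trace_sub, ← Matrix.mul_assoc, ← Matrix.mul_assoc, hentry,
        Matrix.trace_mul_comm, ← Matrix.mul_assoc, hentry] at h3
      rw [Matrix.sub_apply, ← neg_sub, h3, neg_zero]
  have ha : a = 0 := by
    ext r q
    by_contra h
    have h4 := congrFun hE ⟨(r, q), hsupp r q h⟩
    exact h h4
  refine Subtype.ext (LinearMap.ext fun M => ?_)
  change φ M = 0
  rw [htr, ha, Matrix.zero_mul, Matrix.trace_zero]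

/-- Here `T` stands for the velocities of a normalized family of nilpotent representations. It is
transverse to the `n²` directions of the group action, and its sum with them lies in the span of
three pieces: strictly triangular solutions of `dμ = 0`, commutators with strictly upper matrices,
and arbitrary changes of `j`. Counting dimensions, with the rank bound for `dμ` and the two counts
of positions, gives the inequality. -/
theorem finrank_le_of_strictly_triangular (hn : 0 < n) (hℓ : 0 < ℓ)
    (x : Fin ℓ ⊕ Fin ℓ → Matrix (Fin n) (Fin n) K) (j : Fin n → K)
    (hμ : ∑ k, (x (.inl k) * x (.inr k) - x (.inr k) * x (.inl k)) = 0) (ht : Fin n → ℕ)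
    (hx : ∀ c r q, x c r q ≠ 0 → ht q < ht r)
    (hP : ∀ a : Matrix (Fin n) (Fin n) K, (∀ c r q, (a * x c - x c * a) r q ≠ 0 → ht q ≤ ht r) →
      ∀ r q, a r q ≠ 0 → ht q ≤ ht r + 1)
    (T : Submodule K ((Fin ℓ ⊕ Fin ℓ → Matrix (Fin n) (Fin n) K) × (Fin n → K)))
    (hL : ∀ t ∈ T, linearizedMoment x t.1 = 0)
    (hT : ∀ t ∈ T, ∃ a, ∀ c r q,
      (t.1 c - (a * x c - x c * a) : Matrix (Fin n) (Fin n) K) r q ≠ 0 → ht q < ht r)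
    (hinj : ∀ a, (commTuple x a, a *ᵥ j) ∈ T → a = 0) :
    finrank K T + n ^ 2 + 1 ≤ ℓ * (n ^ 2 - n) + 2 * n := by
  set emb := strictTuples K (Fin ℓ ⊕ Fin ℓ) ht
  have hrank := finrank_range_linearizedMoment_ge x ht hP
  set L := linearizedMoment x ∘ₗ emb with hLdef
  have hker := LinearMap.finrank_range_add_finrank_ker L
  have hdom : finrank K (Fin ℓ ⊕ Fin ℓ → {p : Fin n × Fin n // ht p.2 < ht p.1} → K) =
      2 * ℓ * Fintype.card {p : Fin n × Fin n // ht p.2 < ht p.1} := by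
    rw [finrank_pi_fintype]
    simp [two_mul]
  let o : Matrix (Fin n) (Fin n) K →ₗ[K]
      (Fin ℓ ⊕ Fin ℓ → Matrix (Fin n) (Fin n) K) × (Fin n → K) :=
    { toFun a := (commTuple x a, a *ᵥ j)
      map_add' a b := by rw [map_add, Matrix.add_mulVec]; rfl
      map_smul' r a := by rw [map_smul, Matrix.smul_mulVec]; rfl }
  have ho : Function.Injective o := (injective_iff_map_eq_zero _).mpr fun a ha =>
    hinj a (by rw [show (commTuple x a, a *ᵥ j) = 0 from ha]; exact zero_mem T)
  have hdisj : T ⊓ LinearMap.range o = ⊥ := by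
    refine eq_bot_iff.mpr ?_
    rintro _ ⟨hz, a, rfl⟩
    rw [hinj a hz, map_zero]
    exact zero_mem _
  have h1 := Submodule.finrank_sup_add_finrank_inf_eq T (LinearMap.range o)
  rw [hdisj, finrank_bot, add_zero, LinearMap.finrank_range_of_inj ho, finrank_matrix,
    finrank_self] at h1
  simp only [Fintype.card_fin, mul_one, ← sq] at h1
  let up := supportedMatrix K (fun p : Fin n × Fin n => ht p.1 < ht p.2)
  let Ψ : (LinearMap.ker L × ({p : Fin n × Fin n // ht p.1 < ht p.2} → K) × (Fin n → K)) →ₗ[K]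
      (Fin ℓ ⊕ Fin ℓ → Matrix (Fin n) (Fin n) K) × (Fin n → K) :=
    ((emb ∘ₗ (LinearMap.ker L).subtype).prod 0).coprod
      (((commTuple x ∘ₗ up).prod 0).coprod (LinearMap.inr K _ _))
  -- Split `a` into a part `a'` preserving the filtration and a strictly upper part. Commutators
  -- with `a'` are strictly triangular and killed by `dμ`, so they are absorbed into the kernel of
  -- `L`.
  have hΨ : ∀ (a : Matrix (Fin n) (Fin n) K) ν v, (∀ c r q, ν c r q ≠ 0 → ht q < ht r) →
      linearizedMoment x ν = 0 → (ν + commTuple x a, v) ∈ LinearMap.range Ψ := by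
    intro a ν v hν hLν
    obtain ⟨u, hu⟩ := exists_supportedMatrix_eq (K := K)
      (fun p : Fin n × Fin n => ht p.1 < ht p.2)
      (of fun r q => if ht r < ht q then a r q else 0) (by
        intro r q h
        rw [of_apply] at h
        exact (ite_ne_right_iff.mp h).1)
    let a' : Matrix (Fin n) (Fin n) K := of fun r q => if ht r < ht q then 0 else a r q
    have haa : a = a' + up u := by
      ext r q
      rw [Matrix.add_apply, hu]
      change a r q = (if ht r < ht q then 0 else a r q) + (if ht r < ht q then a r q else 0)
      split_ifs <;> simp
    have hν' : ∀ c, ∃ f, supportedMatrix K (fun p : Fin n × Fin n => ht p.2 < ht p.1) f =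
        (ν + commTuple x a') c := by
      intro c
      refine exists_supportedMatrix_eq (K := K) _ _ fun r q h => ?_
      by_contra hrq
      replace hrq : ¬ ht q < ht r := hrq
      refine h ?_
      have e1 : ν c r q = 0 := by by_contra h'; exact hrq (hν c r q h')
      have e2 : (a' * x c) r q = 0 := by
        rw [Matrix.mul_apply]
        refine Finset.sum_eq_zero fun s _ => ?_
        by_contra h'
        have h2 := hx c s q (right_ne_zero_of_mul h')
        have h3 := left_ne_zero_of_mul h'
        simp only [a', of_apply] at h3
        have := (ite_ne_left_iff.mp h3).1
        omega
      have e3 : (x c * a') r q = 0 := by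
        rw [Matrix.mul_apply]
        refine Finset.sum_eq_zero fun s _ => ?_
        by_contra h'
        have h2 := hx c r s (left_ne_zero_of_mul h')
        have h3 := right_ne_zero_of_mul h'
        simp only [a', of_apply] at h3
        have := (ite_ne_left_iff.mp h3).1
        omega
      change ν c r q + ((a' * x c) r q - (x c * a') r q) = 0
      rw [e1, e2, e3]
      simp
    choose f hf using hν'
    have hembf : emb f = ν + commTuple x a' := funext hf
    have hfL : L f = 0 := by
      rw [hLdef, LinearMap.comp_apply, hembf, map_add, hLν, linearizedMoment_commTuple, hμ]
      simp
    refine ⟨(⟨f, hfL⟩, u, v), Prod.ext ?_ ?_⟩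
    · change emb f + (commTuple x (up u) + 0) = ν + commTuple x a
      rw [hembf, add_zero, add_assoc, ← map_add, ← haa]
    · change (0 : Fin n → K) + (0 + v) = v
      simp
  have hle : T ⊔ LinearMap.range o ≤ LinearMap.range Ψ := by
    refine sup_le (fun t ht' => ?_) ?_
    · obtain ⟨a, ha⟩ := hT t ht'
      have := hΨ a (t.1 - commTuple x a) t.2 ha (by
        rw [map_sub, hL t ht', linearizedMoment_commTuple, hμ]; simp)
      rwa [sub_add_cancel] at this
    · rintro _ ⟨a, rfl⟩
      have := hΨ a 0 (a *ᵥ j) (fun c r q h => absurd rfl h) (map_zero _)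
      rwa [zero_add] at this
  have h2 := (Submodule.finrank_mono hle).trans (LinearMap.finrank_range_le Ψ)
  rw [h1, finrank_prod, finrank_prod, finrank_fintype_fun_eq_card, finrank_fintype_fun_eq_card,
    Fintype.card_fin] at h2
  rw [hdom] at hker
  have : Nonempty (Fin n) := ⟨⟨0, hn⟩⟩
  have c1 := card_pairs_succ_lt ht
  have c2 := card_pairs_lt ht
  have c3 := card_le_card_pairs_eq ht
  have c4 := card_pairs_le_succ ht
  have c5 : Finset.card {p : Fin n × Fin n | ht p.1 < ht p.2} =
      Finset.card {p : Fin n × Fin n | ht p.2 < ht p.1} :=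
    Finset.card_equiv (Equiv.prodComm _ _) (by simp)
  have c6 : Finset.card {p : Fin n × Fin n | ht p.2 ≤ ht p.1} =
      Finset.card {p : Fin n × Fin n | ht p.2 < ht p.1} +
        Finset.card {p : Fin n × Fin n | ht p.2 = ht p.1} := by
    rw [← Finset.card_union_of_disjoint]
    · congr 1; ext p
      simp only [Finset.mem_filter, Finset.mem_univ, true_and, Finset.mem_union]; omega
    · rw [Finset.disjoint_filter]; intro p _ h; omega
  simp only [Fintype.card_subtype] at hker hrank h2
  rw [Fintype.card_fin] at c2 c3
  set gt := Finset.card {p : Fin n × Fin n | ht p.2 < ht p.1}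
  set eq := Finset.card {p : Fin n × Fin n | ht p.2 = ht p.1}
  set sc := Finset.card {p : Fin n × Fin n | ht p.2 = ht p.1 + 1}
  have hsq : n ≤ n ^ 2 := Nat.le_self_pow (by norm_num) n
  obtain ⟨m, rfl⟩ : ∃ m, ℓ = m + 1 := ⟨ℓ - 1, by omega⟩
  -- The total is `2ℓ·gt + sc + n`; `sc + 1 ≤ eq` and `2·gt + eq = n²` take care of one factor of
  -- `ℓ`, and `2·gt ≤ n² - n` of the remaining `ℓ - 1`.
  have h3 : m * (2 * gt) ≤ m * (n ^ 2 - n) := Nat.mul_le_mul_left _ (by omega)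
  have h4 : 2 * (m + 1) * gt = m * (2 * gt) + 2 * gt := by ring
  have h5 : (m + 1) * (n ^ 2 - n) = m * (n ^ 2 - n) + (n ^ 2 - n) := by ring
  rw [h4] at hker
  rw [h5]
  omega

end Bound

end BouquetQuiver

namespace BouquetQuiver

open Matrix Module

/-! ### Entrywise derivations of matrices. -/

section DerivationMatrix

variable {k R : Type*} [CommRing k] [CommRing R] [Algebra k R] {m m' m'' : Type*} [Fintype m']

theorem map_derivation_mul (δ : Derivation k R R) (A : Matrix m m' R) (B : Matrix m' m'' R) :
    (A * B).map δ = A.map δ * B + A * B.map δ := by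
  ext r q
  simp only [Matrix.map_apply, Matrix.add_apply, Matrix.mul_apply, map_sum, Derivation.leibniz,
    smul_eq_mul, ← Finset.sum_add_distrib]
  refine Finset.sum_congr rfl fun s _ => ?_
  ring

theorem derivation_comp_mulVec (δ : Derivation k R R) (A : Matrix m m' R) (v : m' → R) :
    δ ∘ (A *ᵥ v) = A.map δ *ᵥ v + A *ᵥ (δ ∘ v) := by
  ext r
  simp only [Function.comp_apply, Pi.add_apply, Matrix.mulVec, dotProduct, Matrix.map_apply,
    map_sum, Derivation.leibniz, smul_eq_mul, ← Finset.sum_add_distrib]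
  refine Finset.sum_congr rfl fun s _ => ?_
  ring

theorem map_derivation_one [DecidableEq m] (δ : Derivation k R R) :
    (1 : Matrix m m R).map δ = 0 := by
  ext r q
  rw [Matrix.map_apply, Matrix.one_apply]
  split_ifs <;> simp

theorem map_derivation_sub (δ : Derivation k R R) (A B : Matrix m m'' R) :
    (A - B).map δ = A.map δ - B.map δ := by
  ext r q
  simp

variable {n ℓ : ℕ}

theorem linearizedMoment_apply (x t : Fin ℓ ⊕ Fin ℓ → Matrix (Fin n) (Fin n) R) :
    linearizedMoment x t = ∑ k, ((t (.inl k) * x (.inr k) - x (.inr k) * t (.inl k)) +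
      (x (.inl k) * t (.inr k) - t (.inr k) * x (.inl k))) := rfl

theorem linearizedMoment_map_derivation (δ : Derivation k R R)
    (x : Fin ℓ ⊕ Fin ℓ → Matrix (Fin n) (Fin n) R) :
    linearizedMoment x (fun c => (x c).map δ) =
      (∑ k, (x (.inl k) * x (.inr k) - x (.inr k) * x (.inl k))).map δ := by
  have hsum : ∀ f : Fin ℓ → Matrix (Fin n) (Fin n) R, (∑ k, f k).map δ = ∑ k, (f k).map δ := by
    intro f
    ext r q
    simp [Matrix.sum_apply]
  rw [hsum, linearizedMoment_apply]
  refine Finset.sum_congr rfl fun k _ => ?_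
  rw [map_derivation_sub, map_derivation_mul, map_derivation_mul]
  abel

/-- Write `x g = g y`, where `y` is the conjugate of `x`, and apply `δ`: moving the frame
contributes the commutator with the logarithmic derivative `g⁻¹ δ(g)`. -/
theorem conj_map_derivation (δ : Derivation k R R) (g : GL (Fin n) R)
    (x : Matrix (Fin n) (Fin n) R) :
    g⁻¹.1 * x.map δ * g.1 = (g⁻¹.1 * x * g.1).map δ +
      (g⁻¹.1 * g.1.map δ * (g⁻¹.1 * x * g.1) - (g⁻¹.1 * x * g.1) * (g⁻¹.1 * g.1.map δ)) := by
  have h : g⁻¹.1 * g.1 = 1 := by rw [← Units.val_mul]; simp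
  have h' : g.1 * g⁻¹.1 = 1 := by rw [← Units.val_mul]; simp
  have h1 : x * g.1 = g.1 * (g⁻¹.1 * x * g.1) := by
    simp only [← Matrix.mul_assoc, h', Matrix.one_mul]
  have h2 := congrArg (fun A => A.map δ) h1
  beta_reduce at h2
  rw [map_derivation_mul, map_derivation_mul] at h2
  have h3 := congrArg (fun A => g⁻¹.1 * A) (eq_sub_of_add_eq h2)
  simp only [Matrix.mul_sub, Matrix.mul_add, ← Matrix.mul_assoc, h, Matrix.one_mul] at h3
  simp only [← Matrix.mul_assoc]
  rw [h3]
  have h4 : g⁻¹.1 * x * g.1 * g⁻¹.1 = g⁻¹.1 * x := by rw [Matrix.mul_assoc, h', Matrix.mul_one]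
  rw [h4]
  abel

end DerivationMatrix

/-! ### The trace pairing and the moment map equation. -/

section SymplecticPairing

variable {R : Type*} [CommRing R] {n ℓ : ℕ}

/-- The form `∑ tr (dX_k ∧ dY_k)` on tuples of matrices. -/
def tracePairing (s t : Fin ℓ ⊕ Fin ℓ → Matrix (Fin n) (Fin n) R) : R :=
  ∑ k, ((s (.inl k) * t (.inr k)).trace - (t (.inl k) * s (.inr k)).trace)

theorem tracePairing_add_left (s s' t : Fin ℓ ⊕ Fin ℓ → Matrix (Fin n) (Fin n) R) :
    tracePairing (s + s') t = tracePairing s t + tracePairing s' t := by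
  simp only [tracePairing, ← Finset.sum_add_distrib, Pi.add_apply, Matrix.add_mul, Matrix.mul_add,
    Matrix.trace_add]
  refine Finset.sum_congr rfl fun k _ => ?_
  ring

theorem tracePairing_swap (s t : Fin ℓ ⊕ Fin ℓ → Matrix (Fin n) (Fin n) R) :
    tracePairing s t = -tracePairing t s := by
  simp only [tracePairing, ← Finset.sum_neg_distrib, neg_sub]

theorem tracePairing_add_right (s t t' : Fin ℓ ⊕ Fin ℓ → Matrix (Fin n) (Fin n) R) :
    tracePairing s (t + t') = tracePairing s t + tracePairing s t' := by
  rw [tracePairing_swap, tracePairing_add_left, tracePairing_swap t, tracePairing_swap t']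
  ring

/-- The moment map equation `⟨dμ(s), b⟩ = ω(b · x, s)`. -/
theorem tracePairing_commTuple (x s : Fin ℓ ⊕ Fin ℓ → Matrix (Fin n) (Fin n) R)
    (b : Matrix (Fin n) (Fin n) R) :
    tracePairing s (commTuple x b) = -(b * linearizedMoment x s).trace := by
  have key : ∀ A B N M : Matrix (Fin n) (Fin n) R,
      (A * (b * M - M * b)).trace - ((b * N - N * b) * B).trace =
        -(b * ((A * M - M * A) + (N * B - B * N))).trace := by
    intro A B N M
    have h1 := Matrix.trace_mul_comm A (b * M)
    have h2 := Matrix.trace_mul_comm (A * M) b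
    have h3 := Matrix.trace_mul_comm N (b * B)
    simp only [Matrix.mul_sub, Matrix.sub_mul, Matrix.mul_add, Matrix.trace_sub, Matrix.trace_add,
      ← Matrix.mul_assoc] at h1 h2 h3 ⊢
    rw [h1, h2, h3]
    ring
  rw [linearizedMoment_apply, Finset.mul_sum, Matrix.trace_sum, ← Finset.sum_neg_distrib]
  exact Finset.sum_congr rfl fun k _ => key _ _ _ _

theorem tracePairing_conj (g : GL (Fin n) R) (s t : Fin ℓ ⊕ Fin ℓ → Matrix (Fin n) (Fin n) R) :
    tracePairing (fun c => g⁻¹.1 * s c * g.1) (fun c => g⁻¹.1 * t c * g.1) = tracePairing s t := by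
  have h' : g.1 * g⁻¹.1 = 1 := by rw [← Units.val_mul]; simp
  have key : ∀ A B : Matrix (Fin n) (Fin n) R,
      (g⁻¹.1 * A * g.1 * (g⁻¹.1 * B * g.1)).trace = (A * B).trace := by
    intro A B
    rw [show g⁻¹.1 * A * g.1 * (g⁻¹.1 * B * g.1) = g⁻¹.1 * (A * (g.1 * g⁻¹.1) * B * g.1) by
      simp only [Matrix.mul_assoc], h', Matrix.mul_one, Matrix.trace_mul_comm, Matrix.mul_assoc,
      h', Matrix.mul_one]
  simp only [tracePairing, key]

theorem trace_mul_eq_zero_of_strict {ht : Fin n → ℕ} {A B : Matrix (Fin n) (Fin n) R}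
    (hA : ∀ r q, A r q ≠ 0 → ht q < ht r) (hB : ∀ r q, B r q ≠ 0 → ht q < ht r) :
    (A * B).trace = 0 := by
  refine Finset.sum_eq_zero fun r _ => ?_
  rw [Matrix.diag_apply, Matrix.mul_apply]
  refine Finset.sum_eq_zero fun q _ => ?_
  by_contra h
  have h1 := hA r q (left_ne_zero_of_mul h)
  have h2 := hB q r (right_ne_zero_of_mul h)
  omega

end SymplecticPairing

/-! ### Isotropy and the dimension bound over a field with derivations. -/

section GenericPoint

variable {k K : Type*} [Field k] [Field K] [Algebra k K] {n ℓ : ℕ}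

theorem map_derivation_strict {ht : Fin n → ℕ} {A : Matrix (Fin n) (Fin n) K} (δ : Derivation k K K)
    (hA : ∀ r q, A r q ≠ 0 → ht q < ht r) (r q : Fin n) (h : A.map δ r q ≠ 0) : ht q < ht r := by
  refine hA r q fun h' => h ?_
  rw [Matrix.map_apply, h', map_zero]

theorem conj_moment (g : GL (Fin n) K) (x : Fin ℓ ⊕ Fin ℓ → Matrix (Fin n) (Fin n) K)
    (hμ : ∑ k, (x (.inl k) * x (.inr k) - x (.inr k) * x (.inl k)) = 0) :
    ∑ k, ((g⁻¹.1 * x (.inl k) * g.1) * (g⁻¹.1 * x (.inr k) * g.1) -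
      (g⁻¹.1 * x (.inr k) * g.1) * (g⁻¹.1 * x (.inl k) * g.1)) = 0 := by
  have h' : g.1 * g⁻¹.1 = 1 := by rw [← Units.val_mul]; simp
  have key : ∀ A B : Matrix (Fin n) (Fin n) K,
      g⁻¹.1 * A * g.1 * (g⁻¹.1 * B * g.1) = g⁻¹.1 * (A * B) * g.1 := by
    intro A B
    rw [show g⁻¹.1 * A * g.1 * (g⁻¹.1 * B * g.1) = g⁻¹.1 * (A * (g.1 * g⁻¹.1) * B) * g.1 by
      simp only [Matrix.mul_assoc], h', Matrix.mul_one]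
  simp only [key, ← Matrix.sub_mul, ← Matrix.mul_sub, ← Finset.mul_sum, ← Finset.sum_mul, hμ,
    Matrix.mul_zero, Matrix.zero_mul]

/-- The nilpotent locus in the zero fibre of the moment map is isotropic. -/
theorem tracePairing_derivation_eq_zero (x : Fin ℓ ⊕ Fin ℓ → Matrix (Fin n) (Fin n) K) {N : ℕ}
    (hx : ∀ w : List (Fin ℓ ⊕ Fin ℓ), w.length = N → wordProd x w = 0)
    (hμ : ∑ k, (x (.inl k) * x (.inr k) - x (.inr k) * x (.inl k)) = 0) (δ δ' : Derivation k K K) :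
    tracePairing (fun c => (x c).map δ) (fun c => (x c).map δ') = 0 := by
  obtain ⟨g, ht, hy, -⟩ := exists_conj_strictly_triangular x hx
  rw [← tracePairing_conj g]
  set y := fun c => g⁻¹.1 * x c * g.1 with hydef
  have hμy : ∑ k, (y (.inl k) * y (.inr k) - y (.inr k) * y (.inl k)) = 0 := conj_moment g x hμ
  have hconj : ∀ δ : Derivation k K K, (fun c => g⁻¹.1 * (x c).map δ * g.1) =
      (fun c => (y c).map δ) + commTuple y (g⁻¹.1 * g.1.map δ) := fun δ =>
    funext fun c => conj_map_derivation δ g (x c)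
  have hL : ∀ δ : Derivation k K K, linearizedMoment y (fun c => (y c).map δ) = 0 := by
    intro δ
    rw [linearizedMoment_map_derivation, hμy]
    ext r q
    simp
  have hL' : ∀ a, linearizedMoment y (commTuple y a) = 0 := by
    intro a
    rw [linearizedMoment_commTuple, hμy, Matrix.mul_zero, Matrix.zero_mul, sub_zero]
  -- All terms containing a commutator vanish, because the other argument lies in the kernel of
  -- `dμ`; only the pairing of two strictly triangular tuples remains.
  rw [hconj, hconj, tracePairing_add_right, tracePairing_commTuple, map_add, hL, hL',
    tracePairing_add_left, tracePairing_swap (commTuple y _), tracePairing_commTuple, hL]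
  simp only [add_zero, Matrix.mul_zero, Matrix.trace_zero, neg_zero]
  refine Finset.sum_eq_zero fun k _ => ?_
  rw [trace_mul_eq_zero_of_strict (map_derivation_strict δ (hy _)) (map_derivation_strict δ' (hy _)),
    trace_mul_eq_zero_of_strict (map_derivation_strict δ' (hy _)) (map_derivation_strict δ (hy _)),
    sub_zero]

/-- The dimension bound at the generic point of a family of nilpotent cyclic representations in
the zero fibre of the moment map, normalized by a frame of words. -/
theorem algebraicIndependent_card_le [CharZero k] (hn : 0 < n) (hℓ : 0 < ℓ)
    (x : Fin ℓ ⊕ Fin ℓ → Matrix (Fin n) (Fin n) K) (j : Fin n → K) {N : ℕ}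
    (hx : ∀ w : List (Fin ℓ ⊕ Fin ℓ), w.length = N → wordProd x w = 0)
    (hμ : ∑ k, (x (.inl k) * x (.inr k) - x (.inr k) * x (.inl k)) = 0)
    (ws : Fin n → List (Fin ℓ ⊕ Fin ℓ))
    (hws : (of fun r a => (wordProd x (ws a) *ᵥ j) r : Matrix (Fin n) (Fin n) K) = 1)
    (hgen : ∀ δ : Derivation k K K, (∀ c r q, δ (x c r q) = 0) → (∀ r, δ (j r) = 0) → δ = 0)
    {d : ℕ} {t : Fin d → K} (htr : AlgebraicIndependent k t) :
    d + n ^ 2 + 1 ≤ ℓ * (n ^ 2 - n) + 2 * n := by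
  classical
  obtain ⟨δ, hδ⟩ := AlgebraicIndependent.exists_derivation htr
  obtain ⟨g, ht, hy, hP⟩ := exists_conj_strictly_triangular x hx
  have h : g⁻¹.1 * g.1 = 1 := by rw [← Units.val_mul]; simp
  have h' : g.1 * g⁻¹.1 = 1 := by rw [← Units.val_mul]; simp
  set y := fun c => g⁻¹.1 * x c * g.1 with hydef
  have hμy : ∑ k, (y (.inl k) * y (.inr k) - y (.inr k) * y (.inl k)) = 0 := conj_moment g x hμ
  let der : (Fin d → K) →ₗ[K] Derivation k K K := Fintype.linearCombination K δ
  let tup : Derivation k K K →ₗ[K] (Fin ℓ ⊕ Fin ℓ → Matrix (Fin n) (Fin n) K) × (Fin n → K) :=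
    { toFun D := (fun c => g⁻¹.1 * (x c).map D * g.1, g⁻¹.1 *ᵥ (D ∘ j))
      map_add' D D' := by
        refine Prod.ext (funext fun c => ?_) ?_
        · change g⁻¹.1 * (x c).map (D + D') * g.1 =
            g⁻¹.1 * (x c).map D * g.1 + g⁻¹.1 * (x c).map D' * g.1
          rw [← Matrix.add_mul, ← Matrix.mul_add]
          rfl
        · exact Matrix.mulVec_add _ (D ∘ j) (D' ∘ j)
      map_smul' r D := by
        refine Prod.ext (funext fun c => ?_) ?_
        · change g⁻¹.1 * (x c).map (r • D) * g.1 = r • (g⁻¹.1 * (x c).map D * g.1)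
          rw [← Matrix.smul_mul, ← Matrix.mul_smul]
          rfl
        · exact Matrix.mulVec_smul _ r (D ∘ j) }
  have htup : ∀ D : Derivation k K K,
      (tup D).1 = (fun c => (y c).map D) + commTuple y (g⁻¹.1 * g.1.map D) := fun D =>
    funext fun c => conj_map_derivation D g (x c)
  -- A combination of the partial derivatives that kills all entries is zero by `hgen`; evaluating
  -- it on the `t b` recovers its coefficients.
  have hinj : Function.Injective (tup ∘ₗ der) := by
    refine (injective_iff_map_eq_zero _).mpr fun c hc => ?_
    have h1 : der c = 0 := by
      refine hgen _ (fun l r q => ?_) fun r => ?_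
      · have h2 : g⁻¹.1 * (x l).map (der c) * g.1 = 0 := congrFun (congrArg Prod.fst hc) l
        have h3 : (x l).map (der c) = 0 := by
          calc (x l).map (der c) = (g.1 * g⁻¹.1) * (x l).map (der c) * (g.1 * g⁻¹.1) := by
                rw [h', Matrix.one_mul, Matrix.mul_one]
            _ = g.1 * (g⁻¹.1 * (x l).map (der c) * g.1) * g⁻¹.1 := by
                simp only [Matrix.mul_assoc]
            _ = 0 := by rw [h2, Matrix.mul_zero, Matrix.zero_mul]
        exact congrFun (congrFun h3 r) q
      · have h2 : g⁻¹.1 *ᵥ (der c ∘ j) = 0 := congrArg Prod.snd hc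
        have h3 : der c ∘ j = 0 := by
          rw [← Matrix.one_mulVec (der c ∘ j), ← h', ← Matrix.mulVec_mulVec, h2, Matrix.mulVec_zero]
        exact congrFun h3 r
    ext b
    have h2 : der c (t b) = 0 := by rw [h1]; rfl
    let ev : Derivation k K K →ₗ[K] K :=
      { toFun D := D (t b), map_add' _ _ := rfl, map_smul' _ _ := rfl }
    have h3 : ev (∑ a, c a • δ a) = 0 := h2
    rw [map_sum] at h3
    simp only [map_smul] at h3
    simpa [ev, hδ] using h3
  have hrange : finrank K (LinearMap.range (tup ∘ₗ der)) = d := by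
    rw [LinearMap.finrank_range_of_inj hinj]
    simp
  have hL : ∀ D : Derivation k K K, linearizedMoment y (tup D).1 = 0 := by
    intro D
    rw [htup, map_add, linearizedMoment_map_derivation, linearizedMoment_commTuple, hμy]
    ext r q
    simp
  have key := finrank_le_of_strictly_triangular hn hℓ y (g⁻¹.1 *ᵥ j) hμy ht hy hP
    (LinearMap.range (tup ∘ₗ der)) ?_ ?_ ?_
  · rwa [hrange] at key
  · rintro _ ⟨c, rfl⟩
    exact hL _
  · rintro _ ⟨c, rfl⟩
    refine ⟨g⁻¹.1 * g.1.map (der c), fun l r q hne => ?_⟩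
    refine map_derivation_strict (der c) (hy l) r q ?_
    convert hne using 1
    have := congrFun (htup (der c)) l
    rw [LinearMap.comp_apply, this]
    change _ = ((y l).map (der c) + (_ - _) - (_ - _) : Matrix (Fin n) (Fin n) K) r q
    rw [add_sub_cancel_right]
  · rintro a ⟨c, hc⟩
    set D := der c
    set A := g.1 * a * g⁻¹.1
    have h1 : ∀ l, (x l).map D = A * x l - x l * A := by
      intro l
      have h2 : g⁻¹.1 * (x l).map D * g.1 = a * (g⁻¹.1 * x l * g.1) - (g⁻¹.1 * x l * g.1) * a :=
        congrFun (congrArg Prod.fst hc) l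
      calc (x l).map D = (g.1 * g⁻¹.1) * (x l).map D * (g.1 * g⁻¹.1) := by
            rw [h', Matrix.one_mul, Matrix.mul_one]
        _ = g.1 * (g⁻¹.1 * (x l).map D * g.1) * g⁻¹.1 := by simp only [Matrix.mul_assoc]
        _ = g.1 * a * g⁻¹.1 * x l * (g.1 * g⁻¹.1) - (g.1 * g⁻¹.1) * x l * (g.1 * a * g⁻¹.1) := by
            rw [h2]; simp only [Matrix.mul_sub, Matrix.sub_mul, Matrix.mul_assoc]
        _ = A * x l - x l * A := by rw [h', Matrix.one_mul, Matrix.mul_one]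
    have h2 : D ∘ j = A *ᵥ j := by
      have h3 : g⁻¹.1 *ᵥ (D ∘ j) = a *ᵥ (g⁻¹.1 *ᵥ j) := congrArg Prod.snd hc
      rw [← Matrix.one_mulVec (D ∘ j), ← h', ← Matrix.mulVec_mulVec, h3, Matrix.mulVec_mulVec,
        Matrix.mulVec_mulVec]
    have hw : ∀ w, (wordProd x w).map D = A * wordProd x w - wordProd x w * A := by
      intro w
      induction w with
      | nil => rw [wordProd_nil, map_derivation_one, Matrix.mul_one, Matrix.one_mul, sub_self]
      | cons l w ih =>
        rw [wordProd_cons, map_derivation_mul, ih, h1]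
        noncomm_ring
    -- If a derivation acts on `x` and `j` as the infinitesimal symmetry `A`, then it acts as `A` on
    -- every frame vector; but the frame is the constant matrix `1`, so `A = 0`. Normalized families
    -- are thus transverse to the orbits.
    have hA : A = 0 := by
      have h3 : ∀ w, D ∘ (wordProd x w *ᵥ j) = A *ᵥ (wordProd x w *ᵥ j) := by
        intro w
        rw [derivation_comp_mulVec, hw, h2, Matrix.sub_mulVec, Matrix.mulVec_mulVec,
          Matrix.mulVec_mulVec, sub_add_cancel]
      have h4 : (of fun r a => (wordProd x (ws a) *ᵥ j) r : Matrix (Fin n) (Fin n) K).map D =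
          A * (of fun r a => (wordProd x (ws a) *ᵥ j) r : Matrix (Fin n) (Fin n) K) := by
        ext r a
        exact congrFun (h3 (ws a)) r
      rw [hws, map_derivation_one, Matrix.mul_one] at h4
      exact h4.symm
    calc a = (g⁻¹.1 * g.1) * a * (g⁻¹.1 * g.1) := by rw [h, Matrix.one_mul, Matrix.mul_one]
      _ = g⁻¹.1 * (g.1 * a * g⁻¹.1) * g.1 := by simp only [Matrix.mul_assoc]
      _ = 0 := by rw [show g.1 * a * g⁻¹.1 = 0 from hA, Matrix.mul_zero, Matrix.zero_mul]

end GenericPoint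

end BouquetQuiver

namespace BouquetQuiver

open Matrix Module

/-! ### From the fraction field down to the local ring. -/

section LocalRing

variable {k R : Type*} [Field k] [CommRing R] [Algebra k R] {n ℓ : ℕ}

/-- The differentials of the fraction field are the localization of those of `R`, so the linear map
attached to `δ` extends. -/
theorem exists_derivation_fractionRing [IsDomain R] (δ : Derivation k R R) :
    ∃ δ' : Derivation k (FractionRing R) (FractionRing R),
      ∀ r, δ' (algebraMap R (FractionRing R) r) = algebraMap R (FractionRing R) (δ r) := by
  let K := FractionRing R
  let D := KaehlerDifferential.D k R
  let f := KaehlerDifferential.map k k R K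
  let L : Ω[R⁄k] →ₗ[R] K := Algebra.linearMap R K ∘ₗ δ.liftKaehlerDifferential
  have hu : ∀ x : nonZeroDivisors R, IsUnit (algebraMap R (Module.End R K) x) := by
    intro x
    have hx : IsUnit (algebraMap R K x) := IsLocalization.map_units K x
    refine (Module.End.isUnit_iff _).mpr ⟨fun a b hab => ?_, fun b => ?_⟩
    · simp only [Module.algebraMap_end_apply, Algebra.smul_def] at hab
      exact hx.mul_left_cancel hab
    · obtain ⟨u, hu⟩ := hx
      refine ⟨(u⁻¹ : Kˣ) * b, ?_⟩
      simp only [Module.algebraMap_end_apply, Algebra.smul_def, ← hu, Units.mul_inv_cancel_left]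
  let L' : Ω[K⁄k] →ₗ[K] K :=
    (IsLocalizedModule.lift (nonZeroDivisors R) f L hu).extendScalarsOfIsLocalization
      (nonZeroDivisors R) K
  refine ⟨L'.compDer (KaehlerDifferential.D k K), fun r => ?_⟩
  change IsLocalizedModule.lift (nonZeroDivisors R) f L hu
    (KaehlerDifferential.D k K (algebraMap R K r)) = _
  rw [← KaehlerDifferential.map_D k k R K r, IsLocalizedModule.lift_apply]
  change algebraMap R K (δ.liftKaehlerDifferential (KaehlerDifferential.D k R r)) = _
  rw [Derivation.liftKaehlerDifferential_comp_D]

/-- The set of all entries of a tuple of matrices and a vector. -/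
def entrySet {R : Type*} (x : Fin ℓ ⊕ Fin ℓ → Matrix (Fin n) (Fin n) R) (j : Fin n → R) : Set R :=
  (Set.range fun p : (Fin ℓ ⊕ Fin ℓ) × Fin n × Fin n => x p.1 p.2.1 p.2.2) ∪ Set.range j

theorem entrySet_finite {R : Type*} (x : Fin ℓ ⊕ Fin ℓ → Matrix (Fin n) (Fin n) R) (j : Fin n → R) :
    (entrySet x j).Finite :=
  (Set.finite_range _).union (Set.finite_range _)

theorem moment_map {S : Type*} [CommRing S] (f : R →+* S)
    {x : Fin ℓ ⊕ Fin ℓ → Matrix (Fin n) (Fin n) R}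
    (hμ : ∑ k, (x (.inl k) * x (.inr k) - x (.inr k) * x (.inl k)) = 0) :
    ∑ k, ((x (.inl k)).map f * (x (.inr k)).map f - (x (.inr k)).map f * (x (.inl k)).map f) = 0 := by
  have := congrArg f.mapMatrix hμ
  simpa only [map_sum, map_sub, map_mul, map_zero, RingHom.mapMatrix_apply] using this

theorem isEssFiniteType_of_entrySet {x : Fin ℓ ⊕ Fin ℓ → Matrix (Fin n) (Fin n) R} {j : Fin n → R}
    (hgen : ∀ s : R, ∃ t ∈ Algebra.adjoin k (entrySet x j), IsUnit t ∧
      s * t ∈ Algebra.adjoin k (entrySet x j)) : Algebra.EssFiniteType k R := by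
  rw [Algebra.essFiniteType_iff]
  exact ⟨(entrySet_finite x j).toFinset, by simpa using hgen⟩

/-- Krull dimension bound for a local ring of the space of nilpotent cyclic representations in the
zero fibre of the moment map, normalized by a frame of words. -/
theorem length_primes_le [CharZero k] (hn : 0 < n) (hℓ : 0 < ℓ)
    (x : Fin ℓ ⊕ Fin ℓ → Matrix (Fin n) (Fin n) R) (j : Fin n → R) {N : ℕ}
    (hx : ∀ w : List (Fin ℓ ⊕ Fin ℓ), w.length = N → wordProd x w = 0)
    (hμ : ∑ k, (x (.inl k) * x (.inr k) - x (.inr k) * x (.inl k)) = 0)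
    (ws : Fin n → List (Fin ℓ ⊕ Fin ℓ))
    (hws : (of fun r a => (wordProd x (ws a) *ᵥ j) r : Matrix (Fin n) (Fin n) R) = 1)
    (hgen : ∀ s : R, ∃ t ∈ Algebra.adjoin k (entrySet x j), IsUnit t ∧
      s * t ∈ Algebra.adjoin k (entrySet x j))
    {d : ℕ} (P : Fin (d + 1) → PrimeSpectrum R) (hP : StrictMono P) :
    d + n ^ 2 + 1 ≤ ℓ * (n ^ 2 - n) + 2 * n := by
  obtain ⟨t, ht⟩ := exists_algebraicIndependent_of_strictMono (k := k) d P hP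
  let R' := R ⧸ (P 0).asIdeal
  let K := FractionRing R'
  let f : R →ₐ[k] K := (IsScalarTower.toAlgHom k R' K).comp (Ideal.Quotient.mkₐ k _)
  have htK : AlgebraicIndependent k fun a => algebraMap R' K (t a) :=
    ht.map' (f := IsScalarTower.toAlgHom k R' K) (IsFractionRing.injective R' K)
  refine algebraicIndependent_card_le hn hℓ (fun c => (x c).map f) (f ∘ j) (N := N) (fun w hw => ?_)
    (moment_map (f : R →+* K) hμ) ws ?_ ?_ htK
  · have := wordProd_map x (f : R →+* K) w
    rw [hx w hw] at this
    exact this.symm.trans (Matrix.map_zero _ (map_zero f))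
  · have := congrArg (fun M : Matrix (Fin n) (Fin n) R => M.map (f : R →+* K)) hws
    beta_reduce at this
    rw [Matrix.map_one _ (map_zero _) (map_one _)] at this
    rw [← this]
    ext r a
    have h1 := wordProd_map x (f : R →+* K) (ws a)
    change ((wordProd (fun c => (x c).map (f : R →+* K)) (ws a)) *ᵥ ((f : R →+* K) ∘ j)) r =
      (f : R →+* K) ((wordProd x (ws a) *ᵥ j) r)
    rw [← h1, RingHom.map_mulVec]
  · intro δ h1 h2
    have h3 : ∀ r ∈ Algebra.adjoin k (entrySet x j), δ (f r) = 0 := by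
      intro r hr
      induction hr using Algebra.adjoin_induction with
      | mem r hr =>
        rcases hr with ⟨p, rfl⟩ | ⟨a, rfl⟩
        · exact h1 _ _ _
        · exact h2 _
      | algebraMap r => rw [f.commutes, Derivation.map_algebraMap]
      | add r s _ _ hr hs => rw [map_add, map_add, hr, hs, add_zero]
      | mul r s _ _ hr hs => rw [map_mul, Derivation.leibniz, hr, hs, smul_zero, smul_zero, add_zero]
    -- Every element is a quotient of polynomials in the entries with unit denominator, so the
    -- Leibniz rule suffices; the same argument then handles fractions.
    have h4 : ∀ r, δ (f r) = 0 := by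
      intro r
      obtain ⟨t, ht, htu, hrt⟩ := hgen r
      have h5 := h3 _ hrt
      rw [map_mul, Derivation.leibniz, h3 t ht, smul_zero, zero_add, smul_eq_mul] at h5
      exact (mul_eq_zero.mp h5).resolve_left (htu.map f).ne_zero
    ext z
    obtain ⟨a, b, hb, rfl⟩ := IsFractionRing.div_surjective (A := R') z
    obtain ⟨a, rfl⟩ := Ideal.Quotient.mk_surjective a
    obtain ⟨b, rfl⟩ := Ideal.Quotient.mk_surjective b
    change δ (f a / f b) = 0
    have hb0 : f b ≠ 0 := by
      have := IsLocalization.to_map_ne_zero_of_mem_nonZeroDivisors K le_rfl hb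
      exact this
    have h5 := h4 a
    rw [← div_mul_cancel₀ (f a) hb0, Derivation.leibniz, h4 b, smul_zero, zero_add,
      smul_eq_mul] at h5
    exact (mul_eq_zero.mp h5).resolve_left hb0

theorem map_tracePairing {S : Type*} [CommRing S] (f : R →+* S)
    (s t : Fin ℓ ⊕ Fin ℓ → Matrix (Fin n) (Fin n) R) :
    f (tracePairing s t) = tracePairing (fun c => (s c).map f) (fun c => (t c).map f) := by
  simp only [tracePairing, map_sum, map_sub, Matrix.trace, Matrix.diag_apply, Matrix.mul_apply,
    Matrix.map_apply, map_mul]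

theorem tracePairing_derivation_eq_zero_of_isDomain [IsDomain R]
    (x : Fin ℓ ⊕ Fin ℓ → Matrix (Fin n) (Fin n) R) {N : ℕ}
    (hx : ∀ w : List (Fin ℓ ⊕ Fin ℓ), w.length = N → wordProd x w = 0)
    (hμ : ∑ k, (x (.inl k) * x (.inr k) - x (.inr k) * x (.inl k)) = 0) (δ δ' : Derivation k R R) :
    tracePairing (fun c => (x c).map δ) (fun c => (x c).map δ') = 0 := by
  obtain ⟨D, hD⟩ := exists_derivation_fractionRing δ
  obtain ⟨D', hD'⟩ := exists_derivation_fractionRing δ'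
  let f := algebraMap R (FractionRing R)
  have h1 := tracePairing_derivation_eq_zero (fun c => (x c).map f) (N := N) (fun w hw => by
    rw [← wordProd_map x f w, hx w hw]
    exact Matrix.map_zero _ (map_zero f)) (moment_map f hμ) D D'
  apply IsFractionRing.injective R (FractionRing R)
  rw [map_zero, map_tracePairing, ← h1]
  congr 1
  · ext c r q
    exact (hD _).symm
  · ext c r q
    exact (hD' _).symm

/-- The tangent space at a smooth point of the space of nilpotent normalized representations in the
zero fibre of the moment map is isotropic. -/
theorem tracePairing_tangent_eq_zero [CharZero k] [IsLocalRing R]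
    (x : Fin ℓ ⊕ Fin ℓ → Matrix (Fin n) (Fin n) R) (j : Fin n → R) {N : ℕ}
    (hx : ∀ w : List (Fin ℓ ⊕ Fin ℓ), w.length = N → wordProd x w = 0)
    (hμ : ∑ k, (x (.inl k) * x (.inr k) - x (.inr k) * x (.inl k)) = 0)
    (hgen : ∀ s : R, ∃ t ∈ Algebra.adjoin k (entrySet x j), IsUnit t ∧
      s * t ∈ Algebra.adjoin k (entrySet x j)) (ev : R →ₐ[k] k) (V : Submodule k (Module.Dual k R))
    (hV : ∀ D : Module.Dual k R, D ∈ V ↔ ∀ f g, D (f * g) = ev f * D g + ev g * D f)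
    [Module.Finite k V] (hd : ((Module.finrank k V : ℕ) : WithBot ℕ∞) = ringKrullDim R)
    {ξ η : Module.Dual k R} (hξ : ξ ∈ V) (hη : η ∈ V) :
    tracePairing (fun c => (x c).map ξ) (fun c => (x c).map η) = 0 := by
  -- Smoothness enters only here: there is a chain of primes as long as the dimension of the tangent
  -- space. The argument works modulo its smallest prime.
  obtain ⟨p, hp⟩ := Order.le_krullDim_iff.mp hd.le
  let P : Fin (finrank k V + 1) → PrimeSpectrum R := fun a => p (Fin.cast (by rw [hp]) a)
  have hP : StrictMono P := fun a b hab => p.strictMono hab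
  obtain ⟨t, ht⟩ := exists_algebraicIndependent_of_strictMono (k := k) _ P hP
  let R' := R ⧸ (P 0).asIdeal
  have hess : Algebra.EssFiniteType k R := isEssFiniteType_of_entrySet hgen
  have : Nontrivial R' := Ideal.Quotient.nontrivial_iff.mpr (P 0).2.ne_top
  have hloc : IsLocalRing R' := IsLocalRing.of_surjective' (Ideal.Quotient.mk _)
    Ideal.Quotient.mk_surjective
  -- In a local ring an element with nonzero value is a unit, so evaluation descends to the
  -- quotient.
  have hker : ∀ r ∈ (P 0).asIdeal, ev r = 0 := by
    intro r hr
    by_contra h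
    have hu : IsUnit r := by
      by_contra hnu
      have h1 : IsUnit (r - algebraMap k R (ev r)) := by
        by_contra h1
        have h2 := (IsLocalRing.mem_maximalIdeal _).mpr hnu
        have h3 := sub_mem h2 ((IsLocalRing.mem_maximalIdeal _).mpr h1)
        rw [sub_sub_cancel] at h3
        exact (IsLocalRing.mem_maximalIdeal _).mp h3 ((isUnit_iff_ne_zero.mpr h).map (algebraMap k R))
      have h2 := h1.map ev
      simp at h2
    exact (P 0).2.ne_top (Ideal.eq_top_of_isUnit_mem _ hr hu)
  let π : R →ₐ[k] R' := Ideal.Quotient.mkₐ k _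
  let ev' : R' →ₐ[k] k := Ideal.Quotient.liftₐ _ ev hker
  have hlift : ∀ ζ ∈ V, ∃ δ : Derivation k R' R', ∀ r, ζ r = ev' (δ (π r)) := fun ζ hζ =>
    exists_derivation_of_finrank_tangent_le π (Ideal.Quotient.mkₐ_surjective k _) ev' ht V hV le_rfl hζ
  obtain ⟨δ, hδ⟩ := hlift ξ hξ
  obtain ⟨δ', hδ'⟩ := hlift η hη
  have h1 := tracePairing_derivation_eq_zero_of_isDomain (fun c => (x c).map (π : R →+* R')) (N := N)
    (fun w hw => by
      rw [← wordProd_map x (π : R →+* R') w, hx w hw]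
      exact Matrix.map_zero _ (map_zero π)) (moment_map (π : R →+* R') hμ) δ δ'
  have h2 := congrArg (ev' : R' →+* k) h1
  rw [map_zero, map_tracePairing] at h2
  rw [← h2]
  congr 1
  · ext c r q
    exact hδ _
  · ext c r q
    exact hδ' _

end LocalRing

end BouquetQuiver

namespace BouquetQuiver

open Matrix Filter Topology

/-! ### Matrices of functions -/

section FunctionMatrices

variable {W : Type*} (S : Subalgebra ℂ (W → ℂ)) {m m' m'' : Type*}

/-- The entries of a matrix-valued function lie in a given algebra of functions. -/
def EntriesIn (F : W → Matrix m m' ℂ) : Prop := ∀ r c, (fun x => F x r c) ∈ S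

/-- The entries of a vector-valued function lie in a given algebra of functions. -/
def CoordsIn (v : W → m → ℂ) : Prop := ∀ r, (fun x => v x r) ∈ S

variable {S}

theorem sum_fun_mem {ι : Type*} (s : Finset ι) {f : ι → W → ℂ} (hf : ∀ a ∈ s, f a ∈ S) :
    (fun x => ∑ a ∈ s, f a x) ∈ S := by
  convert S.sum_mem hf using 1
  ext x
  simp

theorem prod_fun_mem {ι : Type*} (s : Finset ι) {f : ι → W → ℂ} (hf : ∀ a ∈ s, f a ∈ S) :
    (fun x => ∏ a ∈ s, f a x) ∈ S := by
  convert S.prod_mem hf using 1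
  ext x
  simp

theorem EntriesIn.const (A : Matrix m m' ℂ) : EntriesIn S (fun _ => A) :=
  fun r c => S.algebraMap_mem (A r c)

theorem EntriesIn.add {F G : W → Matrix m m' ℂ} (hF : EntriesIn S F) (hG : EntriesIn S G) :
    EntriesIn S (fun x => F x + G x) :=
  fun r c => S.add_mem (hF r c) (hG r c)

theorem EntriesIn.sub {F G : W → Matrix m m' ℂ} (hF : EntriesIn S F) (hG : EntriesIn S G) :
    EntriesIn S (fun x => F x - G x) :=
  fun r c => S.sub_mem (hF r c) (hG r c)

theorem EntriesIn.smul {f : W → ℂ} {F : W → Matrix m m' ℂ} (hf : f ∈ S) (hF : EntriesIn S F) :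
    EntriesIn S (fun x => f x • F x) :=
  fun r c => S.mul_mem hf (hF r c)

theorem EntriesIn.sum {ι : Type*} (s : Finset ι) {F : ι → W → Matrix m m' ℂ}
    (hF : ∀ a ∈ s, EntriesIn S (F a)) : EntriesIn S (fun x => ∑ a ∈ s, F a x) := by
  intro r c
  simp only [Matrix.sum_apply]
  exact sum_fun_mem s fun a ha => hF a ha r c

theorem EntriesIn.mul [Fintype m'] {F : W → Matrix m m' ℂ} {G : W → Matrix m' m'' ℂ}
    (hF : EntriesIn S F) (hG : EntriesIn S G) : EntriesIn S (fun x => F x * G x) := by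
  intro r c
  simp only [Matrix.mul_apply]
  exact sum_fun_mem _ fun a _ => S.mul_mem (hF r a) (hG a c)

theorem EntriesIn.mulVec [Fintype m'] {F : W → Matrix m m' ℂ} {v : W → m' → ℂ}
    (hF : EntriesIn S F) (hv : CoordsIn S v) : CoordsIn S (fun x => F x *ᵥ v x) := by
  intro r
  simp only [Matrix.mulVec, dotProduct]
  exact sum_fun_mem _ fun a _ => S.mul_mem (hF r a) (hv a)

theorem CoordsIn.vecMul [Fintype m] {F : W → Matrix m m' ℂ} {v : W → m → ℂ}
    (hv : CoordsIn S v) (hF : EntriesIn S F) : CoordsIn S (fun x => v x ᵥ* F x) := by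
  intro r
  simp only [Matrix.vecMul, dotProduct]
  exact sum_fun_mem _ fun a _ => S.mul_mem (hv a) (hF a r)

theorem CoordsIn.dotProduct [Fintype m] {u v : W → m → ℂ} (hu : CoordsIn S u) (hv : CoordsIn S v) :
    (fun x => u x ⬝ᵥ v x) ∈ S :=
  sum_fun_mem _ fun a _ => S.mul_mem (hu a) (hv a)

theorem CoordsIn.smul {f : W → ℂ} {v : W → m → ℂ} (hf : f ∈ S) (hv : CoordsIn S v) :
    CoordsIn S (fun x => f x • v x) :=
  fun r => S.mul_mem hf (hv r)

variable [Fintype m] [DecidableEq m]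

theorem EntriesIn.det {F : W → Matrix m m ℂ} (hF : EntriesIn S F) : (fun x => (F x).det) ∈ S := by
  simp only [Matrix.det_apply]
  refine sum_fun_mem _ fun σ _ => ?_
  exact S.toSubmodule.smul_of_tower_mem (Equiv.Perm.sign σ : ℤˣ)
    (prod_fun_mem _ fun a _ => hF (σ a) a)

theorem EntriesIn.adjugate {F : W → Matrix m m ℂ} (hF : EntriesIn S F) :
    EntriesIn S (fun x => (F x).adjugate) := by
  intro r c
  simp only [Matrix.adjugate_apply]
  refine EntriesIn.det fun a b => ?_
  simp only [Matrix.updateRow_apply]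
  split_ifs
  · exact S.algebraMap_mem _
  · exact hF a b

theorem EntriesIn.wordProd {Λ : Type*} {F : Λ → W → Matrix m m ℂ} (hF : ∀ c, EntriesIn S (F c))
    (w : List Λ) : EntriesIn S (fun x => BouquetQuiver.wordProd (fun c => F c x) w) := by
  induction w with
  | nil => exact EntriesIn.const 1
  | cons c w ih =>
    simp only [wordProd_cons]
    exact (hF c).mul ih

end FunctionMatrices

/-! ### Algebras of functions and linear functionals -/

section LinearFunctionals

variable {W : Type*} {S : Subalgebra ℂ (W → ℂ)}

theorem dual_pi_comp_mem {ι V : Type*} [Fintype ι] [DecidableEq ι] [AddCommGroup V] [Module ℂ V]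
    {F : W → ι → V} (hF : ∀ (a : ι) (ψ : Module.Dual ℂ V), (fun x => ψ (F x a)) ∈ S)
    (φ : Module.Dual ℂ (ι → V)) : (fun x => φ (F x)) ∈ S := by
  have : (fun x => φ (F x)) = fun x => ∑ a, (φ ∘ₗ LinearMap.single ℂ (fun _ => V) a) (F x a) := by
    ext x
    simp only [LinearMap.comp_apply, ← map_sum]
    congr 1
    exact (LinearMap.sum_single_apply (φ := fun _ : ι => V) (F x)).symm
  rw [this]
  exact sum_fun_mem _ fun a _ => hF a _

theorem dual_prod_comp_mem {V V' : Type*} [AddCommGroup V] [Module ℂ V] [AddCommGroup V']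
    [Module ℂ V'] {F : W → V} {G : W → V'} (hF : ∀ ψ : Module.Dual ℂ V, (fun x => ψ (F x)) ∈ S)
    (hG : ∀ ψ : Module.Dual ℂ V', (fun x => ψ (G x)) ∈ S) (φ : Module.Dual ℂ (V × V')) :
    (fun x => φ (F x, G x)) ∈ S := by
  have : (fun x => φ (F x, G x)) = (fun x => (φ ∘ₗ LinearMap.inl ℂ V V') (F x)) +
      fun x => (φ ∘ₗ LinearMap.inr ℂ V V') (G x) := by
    ext x
    simp [← map_add]
  rw [this]
  exact S.add_mem (hF _) (hG _)

theorem dual_complex_comp_mem {f : W → ℂ} (hf : f ∈ S) (φ : Module.Dual ℂ ℂ) :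
    (fun x => φ (f x)) ∈ S := by
  have : (fun x => φ (f x)) = φ 1 • f := by
    ext x
    rw [Pi.smul_apply, smul_eq_mul, mul_comm, ← smul_eq_mul, ← map_smul, smul_eq_mul, mul_one]
  rw [this]
  exact S.smul_mem hf _

theorem CoordsIn.dual_comp_mem {m : Type*} [Fintype m] [DecidableEq m] {v : W → m → ℂ}
    (hv : CoordsIn S v) (φ : Module.Dual ℂ (m → ℂ)) : (fun x => φ (v x)) ∈ S :=
  dual_pi_comp_mem (fun a => dual_complex_comp_mem (hv a)) φ

theorem EntriesIn.dual_comp_mem {m m' : Type*} [Fintype m] [DecidableEq m] [Fintype m']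
    [DecidableEq m'] {F : W → Matrix m m' ℂ} (hF : EntriesIn S F)
    (φ : Module.Dual ℂ (Matrix m m' ℂ)) : (fun x => φ (F x)) ∈ S :=
  dual_pi_comp_mem (V := m' → ℂ) (F := F) (fun a => CoordsIn.dual_comp_mem (hF a)) φ

variable {n ℓ : ℕ}

/-- Linear functions of a family of quadruples lie in the algebra generated by the entries. -/
theorem dual_rep_comp_mem {F : W → Rep n ℓ} (hX : ∀ k, EntriesIn S fun x => (F x).X k)
    (hY : ∀ k, EntriesIn S fun x => (F x).Y k) (hi : CoordsIn S fun x => (F x).i)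
    (hj : CoordsIn S fun x => (F x).j) (φ : Module.Dual ℂ (Rep n ℓ)) : (fun x => φ (F x)) ∈ S :=
  dual_prod_comp_mem (dual_pi_comp_mem fun k => (hX k).dual_comp_mem)
    (dual_prod_comp_mem (dual_pi_comp_mem fun k => (hY k).dual_comp_mem)
      (dual_prod_comp_mem hi.dual_comp_mem hj.dual_comp_mem)) φ

/-- Polynomial functions pull back along a family of representations to polynomials in its entries.
This is used for the affine family, for the projective coordinates and for germs. -/
theorem comp_mem_of_mem_coordinateRing {F : W → MomentZero n ℓ}
    (hX : ∀ k, EntriesIn S fun x => (F x).1.X k)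
    (hY : ∀ k, EntriesIn S fun x => (F x).1.Y k) (hi : CoordsIn S fun x => (F x).1.i)
    (hj : CoordsIn S fun x => (F x).1.j) {f : MomentZero n ℓ → ℂ} (hf : f ∈ coordinateRing n ℓ) :
    (fun x => f (F x)) ∈ S := by
  induction hf using Algebra.adjoin_induction with
  | mem f hf =>
    obtain ⟨φ, rfl⟩ := hf
    exact dual_rep_comp_mem (F := fun x => (F x).1) hX hY hi hj φ
  | algebraMap r => exact S.algebraMap_mem r
  | add f g _ _ hf hg => exact S.add_mem hf hg
  | mul f g _ _ hf hg => exact S.mul_mem hf hg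

/-- Continuity in the classical topology justifies passing to the limit `t → 0` along one-parameter
subgroups, even when the limit is approached outside `μ⁻¹(0)` formally. -/
theorem exists_continuous_of_mem_coordinateRing {f : MomentZero n ℓ → ℂ}
    (hf : f ∈ coordinateRing n ℓ) : ∃ F : Rep n ℓ → ℂ, Continuous F ∧ ∀ x, f x = F x.1 := by
  induction hf using Algebra.adjoin_induction with
  | mem f hf =>
    obtain ⟨φ, rfl⟩ := hf
    exact ⟨φ, LinearMap.continuous_of_finiteDimensional φ, fun _ => rfl⟩
  | algebraMap r => exact ⟨fun _ => r, continuous_const, fun _ => rfl⟩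
  | add f g _ _ hf hg =>
    obtain ⟨F, hF, hF'⟩ := hf
    obtain ⟨G, hG, hG'⟩ := hg
    exact ⟨F + G, hF.add hG, fun x => by simp [hF', hG']⟩
  | mul f g _ _ hf hg =>
    obtain ⟨F, hF, hF'⟩ := hf
    obtain ⟨G, hG, hG'⟩ := hg
    exact ⟨F * G, hF.mul hG, fun x => by simp [hF', hG']⟩

theorem coordinateRing_linear (φ : Module.Dual ℂ (Rep n ℓ)) :
    (fun x : MomentZero n ℓ => φ x.1) ∈ coordinateRing n ℓ :=
  Algebra.subset_adjoin ⟨φ, rfl⟩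

end LinearFunctionals

/-! ### Frames -/

section Frames

variable {n ℓ : ℕ}

/-- All the matrices of a quadruple, as one family. -/
def letters (x : Rep n ℓ) : Fin ℓ ⊕ Fin ℓ → Matrix (Fin n) (Fin n) ℂ := Sum.elim x.X x.Y

/-- The matrix with columns `w_a(X, Y) j`. -/
def frame (ws : Fin n → List (Fin ℓ ⊕ Fin ℓ)) (x : Rep n ℓ) : Matrix (Fin n) (Fin n) ℂ :=
  of fun r a => (wordProd (letters x) (ws a) *ᵥ x.j) r

theorem entriesIn_letters (c : Fin ℓ ⊕ Fin ℓ) :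
    EntriesIn (coordinateRing n ℓ) fun x => letters x.1 c := by
  intro r s
  rcases c with k | k
  · exact coordinateRing_linear
      ⟨⟨fun x : Rep n ℓ => x.X k r s, fun _ _ => rfl⟩, fun _ _ => rfl⟩
  · exact coordinateRing_linear
      ⟨⟨fun x : Rep n ℓ => x.Y k r s, fun _ _ => rfl⟩, fun _ _ => rfl⟩

theorem coordsIn_i : CoordsIn (coordinateRing n ℓ) fun x => x.1.i := fun r =>
  coordinateRing_linear ⟨⟨fun x : Rep n ℓ => x.i r, fun _ _ => rfl⟩, fun _ _ => rfl⟩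

theorem coordsIn_j : CoordsIn (coordinateRing n ℓ) fun x => x.1.j := fun r =>
  coordinateRing_linear ⟨⟨fun x : Rep n ℓ => x.j r, fun _ _ => rfl⟩, fun _ _ => rfl⟩

theorem entriesIn_wordProd (w : List (Fin ℓ ⊕ Fin ℓ)) :
    EntriesIn (coordinateRing n ℓ) fun x => wordProd (letters x.1) w :=
  EntriesIn.wordProd entriesIn_letters w

theorem entriesIn_frame (ws : Fin n → List (Fin ℓ ⊕ Fin ℓ)) :
    EntriesIn (coordinateRing n ℓ) fun x => frame ws x.1 :=
  fun r a => ((entriesIn_wordProd (ws a)).mulVec coordsIn_j) r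

theorem letters_act (g : GL (Fin n) ℂ) (x : Rep n ℓ) :
    letters (act g x) = fun c => g.1 * letters x c * g⁻¹.1 := by
  ext1 c
  rcases c with k | k <;> rfl

theorem inv_val_mul_val (g : GL (Fin n) ℂ) : g⁻¹.1 * g.1 = 1 := by
  rw [← Units.val_mul]; simp

theorem val_mul_inv_val (g : GL (Fin n) ℂ) : g.1 * g⁻¹.1 = 1 := by
  rw [← Units.val_mul]; simp

theorem wordProd_mulVec_act (g : GL (Fin n) ℂ) (x : Rep n ℓ) (w : List (Fin ℓ ⊕ Fin ℓ)) :
    wordProd (letters (act g x)) w *ᵥ (act g x).j = g.1 *ᵥ (wordProd (letters x) w *ᵥ x.j) := by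
  rw [letters_act, wordProd_conj]
  change _ *ᵥ (g.1 *ᵥ x.j) = _
  rw [mulVec_mulVec, Matrix.mul_assoc, inv_val_mul_val, Matrix.mul_one, mulVec_mulVec]

theorem frame_act (ws : Fin n → List (Fin ℓ ⊕ Fin ℓ)) (g : GL (Fin n) ℂ) (x : Rep n ℓ) :
    frame ws (act g x) = g.1 * frame ws x := by
  ext r a
  exact congrFun (wordProd_mulVec_act g x (ws a)) r

theorem act_one (x : Rep n ℓ) : act 1 x = x := by
  simp [act]

theorem act_mul (g h : GL (Fin n) ℂ) (x : Rep n ℓ) : act (g * h) x = act g (act h x) := by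
  simp only [act, Rep.X, Rep.Y, Rep.i, Rep.j, _root_.mul_inv_rev, Units.val_mul, Matrix.mul_assoc,
    vecMul_vecMul, mulVec_mulVec]

theorem MomentZero.act_one (x : MomentZero n ℓ) : MomentZero.act 1 x = x :=
  Subtype.ext (BouquetQuiver.act_one x.1)

theorem MomentZero.act_mul (g h : GL (Fin n) ℂ) (x : MomentZero n ℓ) :
    MomentZero.act (g * h) x = MomentZero.act g (MomentZero.act h x) :=
  Subtype.ext (BouquetQuiver.act_mul g h x.1)

/-- The inverse in `f (g⁻¹ x)` cancels the one in `θ = det⁻¹`, so weight `θ^m` means scaling by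
`det^m`. -/
theorem mem_semiInvariants_iff {m : ℕ} {f : MomentZero n ℓ → ℂ} :
    f ∈ semiInvariants n ℓ m ↔ f ∈ coordinateRing n ℓ ∧
      ∀ g x, f (MomentZero.act g x) = g.1.det ^ m * f x := by
  have key : ∀ g : GL (Fin n) ℂ, ((theta n g⁻¹ : ℂˣ) : ℂ) = g.1.det := by
    intro g
    rw [map_inv]
    simp [theta, ← map_inv]
  refine and_congr_right fun _ => ⟨fun h g x => ?_, fun h g x => ?_⟩
  · rw [← key, ← h g⁻¹ x, inv_inv]
  · rw [h, ← key, inv_inv]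

theorem semiInvariant_act {m : ℕ} {f : MomentZero n ℓ → ℂ} (hf : f ∈ semiInvariants n ℓ m)
    (g : GL (Fin n) ℂ) (x : MomentZero n ℓ) : f (MomentZero.act g x) = g.1.det ^ m * f x :=
  (mem_semiInvariants_iff.mp hf).2 g x

theorem semiInvariant_act_eq_zero {m : ℕ} {f : MomentZero n ℓ → ℂ} (hf : f ∈ semiInvariants n ℓ m)
    (g : GL (Fin n) ℂ) (x : MomentZero n ℓ) : f (MomentZero.act g x) = 0 ↔ f x = 0 := by
  have : g.1.det ≠ 0 := (Matrix.isUnits_det_units g).ne_zero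
  rw [semiInvariant_act hf]
  simp [this]

/-- The determinant of a frame is a semi-invariant of weight `θ`. -/
theorem det_frame_mem (ws : Fin n → List (Fin ℓ ⊕ Fin ℓ)) :
    (fun x => (frame ws x.1).det) ∈ semiInvariants n ℓ 1 := by
  refine mem_semiInvariants_iff.mpr ⟨(entriesIn_frame ws).det, fun g x => ?_⟩
  change (frame ws (act g x.1)).det = _
  rw [frame_act, det_mul, pow_one]

theorem mem_semistable_of_det_frame_ne_zero {ws : Fin n → List (Fin ℓ ⊕ Fin ℓ)}
    {x : MomentZero n ℓ} (h : (frame ws x.1).det ≠ 0) : x ∈ semistable n ℓ :=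
  ⟨1, le_rfl, _, det_frame_mem ws, h⟩

end Frames

end BouquetQuiver

namespace BouquetQuiver

open Matrix Filter Topology

/-! ### Semistability, frames and normal forms. -/

section Slices

variable {n ℓ : ℕ}

/-- A subspace which contains `j` and is preserved by all `X_k`, `Y_k`, seen as the range of an
idempotent matrix `e`, is contracted to by a one-parameter subgroup, so that a semistable point has
no such proper subspace. -/
theorem isUnit_of_stable_idempotent {x : MomentZero n ℓ} (hx : x ∈ semistable n ℓ)
    {e : Matrix (Fin n) (Fin n) ℂ} (he : e * e = e) (hc : ∀ c, e * letters x.1 c * e = letters x.1 c * e)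
    (hj : e *ᵥ x.1.j = x.1.j) : e.det ≠ 0 := by
  intro hdet
  obtain ⟨m, hm, f, hf, hfx⟩ := hx
  obtain ⟨F, hF, hfF⟩ := exists_continuous_of_mem_coordinateRing hf.1
  let L : ℂ → Matrix (Fin n) (Fin n) ℂ := fun t => e + t • (1 - e)
  have he' : e * (1 - e) = 0 := by rw [Matrix.mul_sub, he, Matrix.mul_one, sub_self]
  have he'' : (1 - e) * e = 0 := by rw [Matrix.sub_mul, he, Matrix.one_mul, sub_self]
  have he3 : (1 - e) * (1 - e) = 1 - e := by rw [Matrix.mul_sub, he'', Matrix.mul_one, sub_zero]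
  have hL : ∀ s t, L s * L t = L (s * t) := by
    intro s t
    simp only [L, Matrix.add_mul, Matrix.mul_add, Matrix.smul_mul, Matrix.mul_smul, he, he', he'',
      he3, smul_zero, add_zero, zero_add, smul_smul, mul_comm t s]
  have hL1 : L 1 = 1 := by simp [L]
  -- This element is `L t⁻¹`, so that conjugation multiplies the off-diagonal block by `t` and has a
  -- limit at `t = 0`; the opposite block is zero by stability.
  let g : ∀ t : ℂ, t ≠ 0 → GL (Fin n) ℂ := fun t ht =>
    ⟨L t⁻¹, L t, by rw [hL, inv_mul_cancel₀ ht, hL1], by rw [hL, mul_inv_cancel₀ ht, hL1]⟩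
  let A : ℂ → Matrix (Fin n) (Fin n) ℂ → Matrix (Fin n) (Fin n) ℂ := fun t X =>
    e * X * e + t • (e * X * (1 - e)) + (1 - e) * X * (1 - e)
  have hA : ∀ t (ht : t ≠ 0) c, (g t ht).1 * letters x.1 c * (g t ht)⁻¹.1 = A t (letters x.1 c) := by
    intro t ht c
    have h0 : (1 - e) * letters x.1 c * e = 0 := by
      rw [Matrix.mul_assoc, ← hc c, ← Matrix.mul_assoc, ← Matrix.mul_assoc, he'', Matrix.zero_mul,
        Matrix.zero_mul]
    change L t⁻¹ * letters x.1 c * L t = _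
    simp only [L, A, Matrix.add_mul, Matrix.mul_add, Matrix.smul_mul, Matrix.mul_smul, h0, smul_zero,
      add_zero, smul_add, smul_smul, mul_inv_cancel₀ ht, one_smul, add_assoc]
  let y : ℂ → Rep n ℓ := fun t =>
    (fun k => A t (x.1.X k), fun k => A t (x.1.Y k), x.1.i ᵥ* L t, L t *ᵥ x.1.j)
  have hLc : Continuous L := by fun_prop
  have hAc : ∀ X, Continuous fun t => A t X := by
    intro X
    fun_prop
  have hLj : ∀ t, L t *ᵥ x.1.j = x.1.j := by
    intro t
    rw [show L t = e + t • (1 - e) from rfl, add_mulVec, smul_mulVec, sub_mulVec, one_mulVec, hj,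
      sub_self, smul_zero, add_zero]
  have hy : Continuous y := by
    refine (continuous_pi fun k => hAc _).prodMk ((continuous_pi fun k => hAc _).prodMk
      (Continuous.prodMk ?_ ?_))
    · exact Continuous.matrix_vecMul continuous_const hLc
    · exact Continuous.matrix_mulVec hLc continuous_const
  have hyg : ∀ t (ht : t ≠ 0), (MomentZero.act (g t ht) x).1 = y t := by
    intro t ht
    refine Prod.ext (funext fun k => hA t ht (.inl k)) (Prod.ext (funext fun k => hA t ht (.inr k))
      (Prod.ext rfl ?_))
    exact (hLj t⁻¹).trans (hLj t).symm
  have hval : ∀ t : ℂ, t ≠ 0 → (L t).det ^ m * F (y t) = f x := by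
    intro t ht
    rw [← hyg t ht, ← hfF, semiInvariant_act hf, ← mul_assoc, ← mul_pow, ← det_mul]
    change (L t * L t⁻¹).det ^ m * _ = _
    rw [hL, mul_inv_cancel₀ ht, hL1, det_one, one_pow, one_mul]
  have hcont : Continuous fun t => (L t).det ^ m * F (y t) :=
    (hLc.matrix_det.pow m).mul (hF.comp hy)
  -- By density the identity persists at `t = 0`, where `L 0 = e` is singular and `m ≥ 1`, so `f x`
  -- would vanish.
  have hconst : (fun t => (L t).det ^ m * F (y t)) = fun _ => f x :=
    hcont.ext_on (dense_compl_singleton (0 : ℂ)) continuous_const fun t ht => hval t ht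
  have h0 := congrFun hconst 0
  have hL0 : L 0 = e := by simp [L]
  beta_reduce at h0
  rw [hL0, hdet, zero_pow (by omega), zero_mul] at h0
  exact hfx h0.symm

/-- A point is semistable iff `j` is a cyclic vector, i.e. some frame is a basis. -/
theorem exists_det_frame_ne_zero {x : MomentZero n ℓ} (hx : x ∈ semistable n ℓ) :
    ∃ ws, (frame ws x.1).det ≠ 0 := by
  let v : List (Fin ℓ ⊕ Fin ℓ) → Fin n → ℂ := fun w => wordProd (letters x.1) w *ᵥ x.1.j
  let U : Submodule ℂ (Fin n → ℂ) := Submodule.span ℂ (Set.range v)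
  have hU : U = ⊤ := by
    obtain ⟨C, hC⟩ := U.exists_isCompl
    let E := U.subtype ∘ₗ U.projectionOnto C hC
    let e := LinearMap.toMatrix' E
    have hE : ∀ u ∈ U, E u = u := by
      intro u hu
      simp only [E, LinearMap.comp_apply]
      rw [show u = ((⟨u, hu⟩ : U) : Fin n → ℂ) from rfl, Submodule.projectionOnto_apply_left]
      rfl
    have hEm : ∀ u, E u ∈ U := fun u => (U.projectionOnto C hC u).2
    have hev : ∀ u, e *ᵥ u = E u := fun u => LinearMap.toMatrix'_mulVec E u
    have hstab : ∀ c u, u ∈ U → letters x.1 c *ᵥ u ∈ U := by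
      intro c u hu
      suffices h : U ≤ U.comap (letters x.1 c).mulVecLin from h hu
      refine Submodule.span_le.mpr ?_
      rintro _ ⟨w, rfl⟩
      refine Submodule.subset_span ⟨c :: w, ?_⟩
      simp only [v, wordProd_cons, mulVecLin_apply, mulVec_mulVec]
    -- The matrix `e` is a projection onto the span `U` of all `w j`; if it is invertible, then `U`
    -- is everything.
    have hdet : e.det ≠ 0 := by
      refine isUnit_of_stable_idempotent hx ?_ ?_ ?_
      · refine Matrix.toLin'.injective (LinearMap.ext fun u => ?_)
        rw [toLin'_apply, toLin'_apply, ← mulVec_mulVec, hev, hev, hE _ (hEm u)]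
      · intro c
        refine Matrix.toLin'.injective (LinearMap.ext fun u => ?_)
        rw [toLin'_apply, toLin'_apply, ← mulVec_mulVec, ← mulVec_mulVec, ← mulVec_mulVec,
          hev, hev, hE _ (hstab c _ (hEm u))]
      · rw [hev, hE]
        refine Submodule.subset_span ⟨[], ?_⟩
        simp only [v, wordProd_nil, one_mulVec]
    rw [eq_top_iff]
    intro u _
    have := congrArg (fun M => M *ᵥ u) (Matrix.mul_nonsing_inv e (isUnit_iff_ne_zero.mpr hdet))
    simp only [one_mulVec, ← mulVec_mulVec] at this
    rw [← this, hev]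
    exact hEm _
  obtain ⟨s, hs, hspan, hli⟩ := exists_linearIndependent ℂ (Set.range v)
  have hb : Submodule.span ℂ s = ⊤ := hspan.trans hU
  let b : Module.Basis s ℂ (Fin n → ℂ) := Module.Basis.mk hli (by rw [Subtype.range_coe, hb])
  have : Finite s := Module.Finite.finite_basis b
  have : Fintype s := Fintype.ofFinite s
  have hcard : Fintype.card s = n := by
    rw [← Module.finrank_eq_card_basis b, Module.finrank_fin_fun]
  let σ := (Fintype.equivFinOfCardEq hcard).symm
  choose w hw using fun a : s => hs a.2
  refine ⟨fun a => w (σ a), ?_⟩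
  have hframe : frame (fun a => w (σ a)) x.1 =
      (Pi.basisFun ℂ (Fin n)).toMatrix (b.reindex σ.symm) := by
    ext r a
    rw [Module.Basis.toMatrix_apply, Pi.basisFun_repr, Module.Basis.reindex_apply, Equiv.symm_symm,
      Module.Basis.mk_apply]
    exact congrFun (hw (σ a)) r
  rw [hframe]
  intro h
  have h1 := congrArg det ((Pi.basisFun ℂ (Fin n)).toMatrix_mul_toMatrix_flip (b.reindex σ.symm))
  rw [det_mul, h, zero_mul, det_one] at h1
  exact zero_ne_one h1

/-- The unique point of the orbit of `x` with frame `1`, if the frame of `x` is a basis. -/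
noncomputable def normalize (ws : Fin n → List (Fin ℓ ⊕ Fin ℓ)) (x : MomentZero n ℓ) : MomentZero n ℓ :=
  open Classical in
  if h : (frame ws x.1).det ≠ 0 then
    MomentZero.act (GeneralLinearGroup.mkOfDetNeZero _ h)⁻¹ x else x

variable {ws : Fin n → List (Fin ℓ ⊕ Fin ℓ)}

theorem normalize_eq_act {x : MomentZero n ℓ} (h : (frame ws x.1).det ≠ 0) :
    ∃ g : GL (Fin n) ℂ, g.1 = frame ws x.1 ∧ normalize ws x = MomentZero.act g⁻¹ x :=
  ⟨GeneralLinearGroup.mkOfDetNeZero _ h, rfl, dif_pos h⟩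

theorem exists_normalize_eq_act (ws : Fin n → List (Fin ℓ ⊕ Fin ℓ)) (x : MomentZero n ℓ) :
    ∃ g : GL (Fin n) ℂ, normalize ws x = MomentZero.act g x := by
  by_cases h : (frame ws x.1).det ≠ 0
  · obtain ⟨g, -, hg⟩ := normalize_eq_act h
    exact ⟨_, hg⟩
  · exact ⟨1, by rw [MomentZero.act_one, normalize, dif_neg h]⟩

theorem frame_normalize {x : MomentZero n ℓ} (h : (frame ws x.1).det ≠ 0) :
    frame ws (normalize ws x).1 = 1 := by
  obtain ⟨g, hg, h⟩ := normalize_eq_act h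
  rw [h]
  change frame ws (act g⁻¹ x.1) = 1
  rw [frame_act, ← hg, inv_val_mul_val]

theorem normalize_eq_self {x : MomentZero n ℓ} (h : frame ws x.1 = 1) : normalize ws x = x := by
  have h1 : (frame ws x.1).det ≠ 0 := by rw [h, det_one]; exact one_ne_zero
  obtain ⟨g, hg, h2⟩ := normalize_eq_act h1
  have : g = 1 := Units.ext (hg.trans h)
  rw [h2, this, inv_one, MomentZero.act_one]

/-- Functions on the slice are ratios of semi-invariants. -/
theorem exists_semiInvariant_normalize (ws : Fin n → List (Fin ℓ ⊕ Fin ℓ)) {φ : MomentZero n ℓ → ℂ}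
    (hφ : φ ∈ coordinateRing n ℓ) : ∃ m, ∃ A ∈ semiInvariants n ℓ m,
      ∀ x : MomentZero n ℓ, (frame ws x.1).det ≠ 0 →
        φ (normalize ws x) * (frame ws x.1).det ^ m = A x := by
  have hf : (fun x => (frame ws x.1).det) ∈ semiInvariants n ℓ 1 := det_frame_mem ws
  have hfp : ∀ k, (fun x => (frame ws x.1).det ^ k) ∈ semiInvariants n ℓ k := by
    intro k
    have := SetLike.pow_mem_graded k hf
    rw [smul_eq_mul, mul_one] at this
    exact this
  induction hφ using Algebra.adjoin_induction with
  | mem φ hφ =>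
    obtain ⟨φ, rfl⟩ := hφ
    -- This is the normal form multiplied by the determinant of the frame, with adjugates in place
    -- of inverses. The extra determinant on `i` gives all components the same weight `1`.
    let Q : Rep n ℓ → Rep n ℓ := fun x =>
      (fun k => (frame ws x).adjugate * x.X k * frame ws x,
        fun k => (frame ws x).adjugate * x.Y k * frame ws x,
        (frame ws x).det • (x.i ᵥ* frame ws x), (frame ws x).adjugate *ᵥ x.j)
    have hQ : ∀ (g : GL (Fin n) ℂ) x, Q (act g x) = g.1.det • Q x := by
      intro g x
      have h1 : g.1.adjugate * g.1 = g.1.det • 1 := adjugate_mul _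
      have h2 : ∀ X : Matrix (Fin n) (Fin n) ℂ, (g.1 * frame ws x).adjugate * (g.1 * X * g⁻¹.1) *
          (g.1 * frame ws x) = g.1.det • ((frame ws x).adjugate * X * frame ws x) := by
        intro X
        calc _ = (frame ws x).adjugate * (g.1.adjugate * g.1) * X * (g⁻¹.1 * g.1) * frame ws x := by
              rw [adjugate_mul_distrib]; simp only [Matrix.mul_assoc]
          _ = _ := by
              rw [h1, inv_val_mul_val]
              simp only [Matrix.mul_smul, Matrix.smul_mul, Matrix.mul_one]
      have h3 : (act g x).i ᵥ* (g.1 * frame ws x) = x.i ᵥ* frame ws x := by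
        change (x.i ᵥ* g⁻¹.1) ᵥ* _ = _
        rw [vecMul_vecMul, ← Matrix.mul_assoc, inv_val_mul_val, Matrix.one_mul]
      have h4 : (g.1 * frame ws x).adjugate *ᵥ (act g x).j =
          g.1.det • ((frame ws x).adjugate *ᵥ x.j) := by
        change _ *ᵥ (g.1 *ᵥ x.j) = _
        rw [adjugate_mul_distrib, mulVec_mulVec, Matrix.mul_assoc, h1, Matrix.mul_smul,
          Matrix.mul_one, smul_mulVec]
      refine Prod.ext (funext fun k => ?_) (Prod.ext (funext fun k => ?_) (Prod.ext ?_ ?_))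
      · change (frame ws (act g x)).adjugate * (act g x).X k * frame ws (act g x) = _
        rw [frame_act]
        exact h2 _
      · change (frame ws (act g x)).adjugate * (act g x).Y k * frame ws (act g x) = _
        rw [frame_act]
        exact h2 _
      · change (frame ws (act g x)).det • ((act g x).i ᵥ* frame ws (act g x)) = _
        rw [frame_act, h3, det_mul, mul_smul]
        rfl
      · change (frame ws (act g x)).adjugate *ᵥ (act g x).j = _
        rw [frame_act, h4]
        rfl
    refine ⟨1, fun x => φ (Q x.1), mem_semiInvariants_iff.mpr ⟨?_, fun g x => ?_⟩, fun x hx => ?_⟩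
    · refine dual_rep_comp_mem (F := fun x : MomentZero n ℓ => Q x.1) (fun k => ?_) (fun k => ?_)
        ?_ ?_ φ
      · exact ((entriesIn_frame ws).adjugate.mul (entriesIn_letters (.inl k))).mul (entriesIn_frame ws)
      · exact ((entriesIn_frame ws).adjugate.mul (entriesIn_letters (.inr k))).mul (entriesIn_frame ws)
      · exact (coordsIn_i.vecMul (entriesIn_frame ws)).smul (entriesIn_frame ws).det
      · exact (entriesIn_frame ws).adjugate.mulVec coordsIn_j
    · change φ (Q (act g x.1)) = _
      rw [hQ, map_smul, pow_one, smul_eq_mul]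
    · obtain ⟨g, hg, h⟩ := normalize_eq_act hx
      have h1 : Q (normalize ws x).1 = (normalize ws x).1 := by
        simp only [Q, frame_normalize hx, adjugate_one, Matrix.one_mul, Matrix.mul_one, det_one,
          vecMul_one, one_smul, one_mulVec]
      have h2 : Q x.1 = g.1.det • Q (normalize ws x).1 := by
        rw [← hQ]
        congr 1
        have := congrArg (fun y => (MomentZero.act g y).1) h
        beta_reduce at this
        rw [← MomentZero.act_mul, mul_inv_cancel, MomentZero.act_one] at this
        exact this.symm
      beta_reduce
      rw [h2, h1, map_smul, smul_eq_mul, mul_comm, pow_one, hg]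
  | algebraMap r =>
    exact ⟨0, r • 1, Submodule.smul_mem _ _ SetLike.GradedOne.one_mem,
      fun x _ => by simp⟩
  | add φ ψ _ _ hφ hψ =>
    obtain ⟨m, A, hA, hA'⟩ := hφ
    obtain ⟨m', B, hB, hB'⟩ := hψ
    have h1 := SetLike.mul_mem_graded (A := semiInvariants n ℓ) hA (hfp m')
    have h2 := SetLike.mul_mem_graded (A := semiInvariants n ℓ) (hfp m) hB
    refine ⟨m + m', _, add_mem h1 h2, fun x hx => ?_⟩
    simp only [Pi.add_apply, Pi.mul_apply, ← hA' x hx, ← hB' x hx]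
    ring
  | mul φ ψ _ _ hφ hψ =>
    obtain ⟨m, A, hA, hA'⟩ := hφ
    obtain ⟨m', B, hB, hB'⟩ := hψ
    have h1 := SetLike.mul_mem_graded (A := semiInvariants n ℓ) hA hB
    refine ⟨m + m', _, h1, fun x hx => ?_⟩
    simp only [Pi.mul_apply, ← hA' x hx, ← hB' x hx]
    ring

end Slices

end BouquetQuiver

namespace BouquetQuiver

open Matrix Filter Topology

/-! ### The moment map and the symplectic form -/

section Symplectic

variable {n ℓ : ℕ}

theorem omega_eq_tracePairing (u v : Rep n ℓ) :
    omega u v = tracePairing (letters u) (letters v) + (u.i ⬝ᵥ v.j - v.i ⬝ᵥ u.j) := rfl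

theorem letters_add (u v : Rep n ℓ) : letters (u + v) = letters u + letters v := by
  ext1 c
  rcases c with k | k <;> rfl

theorem letters_smul (a : ℂ) (v : Rep n ℓ) : letters (a • v) = a • letters v := by
  ext1 c
  rcases c with k | k <;> rfl

theorem omega_swap (u v : Rep n ℓ) : omega u v = -omega v u := by
  rw [omega_eq_tracePairing, omega_eq_tracePairing, tracePairing_swap]
  ring

theorem omega_add_left (u u' v : Rep n ℓ) : omega (u + u') v = omega u v + omega u' v := by
  have h1 : (u + u').i = u.i + u'.i := rfl
  have h2 : (u + u').j = u.j + u'.j := rfl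
  rw [omega_eq_tracePairing, omega_eq_tracePairing, omega_eq_tracePairing, letters_add,
    tracePairing_add_left, h1, h2, add_dotProduct, dotProduct_add]
  ring

theorem omega_smul_left (a : ℂ) (u v : Rep n ℓ) : omega (a • u) v = a * omega u v := by
  have h1 : (a • u).i = a • u.i := rfl
  have h2 : (a • u).j = a • u.j := rfl
  have h3 : tracePairing (a • letters u) (letters v) = a * tracePairing (letters u) (letters v) := by
    simp only [tracePairing, Finset.mul_sum, Pi.smul_apply, Matrix.smul_mul, Matrix.mul_smul,
      Matrix.trace_smul, smul_eq_mul, mul_sub]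
  rw [omega_eq_tracePairing, omega_eq_tracePairing, letters_smul, h1, h2, h3, smul_dotProduct,
    dotProduct_smul, smul_eq_mul, smul_eq_mul]
  ring

theorem omega_add_right (u v v' : Rep n ℓ) : omega u (v + v') = omega u v + omega u v' := by
  rw [omega_swap, omega_add_left, omega_swap v, omega_swap v']
  ring

theorem omega_smul_right (a : ℂ) (u v : Rep n ℓ) : omega u (a • v) = a * omega u v := by
  rw [omega_swap, omega_smul_left, omega_swap v]
  ring

/-- The symplectic form as a bilinear map. -/
def omegaForm (n ℓ : ℕ) : Rep n ℓ →ₗ[ℂ] Rep n ℓ →ₗ[ℂ] ℂ :=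
  LinearMap.mk₂ ℂ omega omega_add_left omega_smul_left omega_add_right omega_smul_right

/-- The differential of the moment map. -/
def dMoment (x s : Rep n ℓ) : Matrix (Fin n) (Fin n) ℂ :=
  linearizedMoment (letters x) (letters s) - (vecMulVec s.j x.i + vecMulVec x.j s.i)

/-- The infinitesimal action of `𝔤𝔩(V)`. -/
def infinitesimalAct (b : Matrix (Fin n) (Fin n) ℂ) (x : Rep n ℓ) : Rep n ℓ :=
  (fun k => b * x.X k - x.X k * b, fun k => b * x.Y k - x.Y k * b, -(x.i ᵥ* b), b *ᵥ x.j)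

theorem letters_infinitesimalAct (b : Matrix (Fin n) (Fin n) ℂ) (x : Rep n ℓ) :
    letters (infinitesimalAct b x) = commTuple (letters x) b := by
  ext1 c
  rcases c with k | k <;> rfl

theorem moment_eq_letters (x : Rep n ℓ) : moment x = ∑ k, (letters x (.inl k) * letters x (.inr k) -
    letters x (.inr k) * letters x (.inl k)) - vecMulVec x.j x.i := rfl

theorem dMoment_add (x s t : Rep n ℓ) : dMoment x (s + t) = dMoment x s + dMoment x t := by
  have h1 : (s + t).i = s.i + t.i := rfl
  have h2 : (s + t).j = s.j + t.j := rfl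
  rw [dMoment, dMoment, dMoment, letters_add, map_add, h1, h2, add_vecMulVec, vecMulVec_add]
  abel

/-- The zero fibre is stable under the group, so infinitesimal symmetries are tangent to it. -/
theorem dMoment_infinitesimalAct (b : Matrix (Fin n) (Fin n) ℂ) {x : Rep n ℓ} (hx : moment x = 0) :
    dMoment x (infinitesimalAct b x) = 0 := by
  rw [moment_eq_letters, sub_eq_zero] at hx
  rw [dMoment, letters_infinitesimalAct, linearizedMoment_commTuple, hx]
  change _ - (vecMulVec (b *ᵥ x.j) x.i + vecMulVec x.j (-(x.i ᵥ* b))) = 0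
  rw [mul_vecMulVec, vecMulVec_mul, vecMulVec_neg]
  abel

theorem trace_mul_vecMulVec (b : Matrix (Fin n) (Fin n) ℂ) (u v : Fin n → ℂ) :
    (b * vecMulVec u v).trace = v ⬝ᵥ (b *ᵥ u) := by
  rw [mul_vecMulVec, trace_vecMulVec, dotProduct_comm]

/-- The infinitesimal action is dual to the differential of the moment map. -/
theorem omega_infinitesimalAct (b : Matrix (Fin n) (Fin n) ℂ) (x s : Rep n ℓ) :
    omega s (infinitesimalAct b x) = -(b * dMoment x s).trace := by
  rw [omega_eq_tracePairing, letters_infinitesimalAct, tracePairing_commTuple, dMoment,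
    Matrix.mul_sub, Matrix.trace_sub, Matrix.mul_add, Matrix.trace_add, trace_mul_vecMulVec,
    trace_mul_vecMulVec]
  change _ + (s.i ⬝ᵥ (b *ᵥ x.j) - (-(x.i ᵥ* b)) ⬝ᵥ s.j) = _
  rw [neg_dotProduct, dotProduct_mulVec x.i]
  ring

/-- Adding infinitesimal symmetries to vectors tangent to the zero fibre of the moment map does not
change the symplectic form. -/
theorem omega_add_infinitesimalAct {x s t : Rep n ℓ} (hx : moment x = 0) (hs : dMoment x s = 0)
    (ht : dMoment x t = 0) (a b : Matrix (Fin n) (Fin n) ℂ) :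
    omega (s + infinitesimalAct a x) (t + infinitesimalAct b x) = omega s t := by
  rw [omega_add_right, omega_infinitesimalAct, dMoment_add, hs, dMoment_infinitesimalAct a hx,
    omega_swap, omega_add_right, omega_infinitesimalAct, ht, omega_swap t]
  simp

theorem omega_act (g : GL (Fin n) ℂ) (u v : Rep n ℓ) : omega (act g u) (act g v) = omega u v := by
  rw [omega_eq_tracePairing, omega_eq_tracePairing, letters_act, letters_act]
  have h1 := tracePairing_conj g⁻¹ (letters u) (letters v)
  rw [inv_inv] at h1
  have h2 : ∀ i j : Fin n → ℂ, (i ᵥ* g⁻¹.1) ⬝ᵥ (g.1 *ᵥ j) = i ⬝ᵥ j := by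
    intro i j
    rw [dotProduct_mulVec, vecMul_vecMul, inv_val_mul_val, vecMul_one]
  rw [h1]
  exact congrArg₂ _ rfl (congrArg₂ _ (h2 _ _) (h2 _ _))

end Symplectic

/-! ### Point derivations -/

section PointDerivations

variable {R : Type*} [CommRing R] [Algebra ℂ R] {ev : R →ₐ[ℂ] ℂ} {D : Module.Dual ℂ R}
  (hD : ∀ f g, D (f * g) = ev f * D g + ev g * D f) {m m' m'' : Type*} [Fintype m']

include hD

theorem map_pointDerivation_mul (A : Matrix m m' R) (B : Matrix m' m'' R) :
    (A * B).map D = A.map D * B.map ev + A.map ev * B.map D := by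
  ext r q
  simp only [Matrix.map_apply, Matrix.add_apply, Matrix.mul_apply, map_sum, hD,
    ← Finset.sum_add_distrib]
  refine Finset.sum_congr rfl fun s _ => ?_
  ring

theorem pointDerivation_comp_mulVec (A : Matrix m m' R) (v : m' → R) :
    D ∘ (A *ᵥ v) = A.map D *ᵥ (ev ∘ v) + A.map ev *ᵥ (D ∘ v) := by
  ext r
  simp only [Function.comp_apply, Pi.add_apply, Matrix.mulVec, dotProduct, Matrix.map_apply,
    map_sum, hD, ← Finset.sum_add_distrib]
  refine Finset.sum_congr rfl fun s _ => ?_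
  ring

theorem pointDerivation_comp_vecMul (A : Matrix m' m R) (v : m' → R) :
    D ∘ (v ᵥ* A) = (D ∘ v) ᵥ* A.map ev + (ev ∘ v) ᵥ* A.map D := by
  ext r
  simp only [Function.comp_apply, Pi.add_apply, Matrix.vecMul, dotProduct, Matrix.map_apply,
    map_sum, hD, ← Finset.sum_add_distrib]
  refine Finset.sum_congr rfl fun s _ => ?_
  ring

end PointDerivations

/-! ### The generic representation -/

section GenericRepresentation

variable (n ℓ : ℕ)

/-- The matrices of coordinate functions. -/
def genericLetters (c : Fin ℓ ⊕ Fin ℓ) : Matrix (Fin n) (Fin n) (coordinateRing n ℓ) :=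
  of fun r s => ⟨fun x => letters x.1 c r s, entriesIn_letters c r s⟩

def genericI (r : Fin n) : coordinateRing n ℓ := ⟨fun x => x.1.i r, coordsIn_i r⟩

def genericJ (r : Fin n) : coordinateRing n ℓ := ⟨fun x => x.1.j r, coordsIn_j r⟩

/-- The linear coordinate functions. -/
def linearFunction : Module.Dual ℂ (Rep n ℓ) →ₗ[ℂ] coordinateRing n ℓ where
  toFun φ := ⟨fun x => φ x.1, coordinateRing_linear φ⟩
  map_add' _ _ := rfl
  map_smul' _ _ := rfl

/-- Evaluation at a point. -/
def evalPoint {n ℓ : ℕ} (x : MomentZero n ℓ) : coordinateRing n ℓ →ₐ[ℂ] ℂ :=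
  (Pi.evalAlgHom ℂ (fun _ : MomentZero n ℓ => ℂ) x).comp (coordinateRing n ℓ).val

variable {n ℓ}

theorem matrix_ext_of_evalPoint {m m' : Type*} {A B : Matrix m m' (coordinateRing n ℓ)}
    (h : ∀ x, A.map (evalPoint x) = B.map (evalPoint x)) : A = B := by
  ext r s x
  exact congrFun (congrFun (h x) r) s

theorem genericLetters_eval (x : MomentZero n ℓ) (c : Fin ℓ ⊕ Fin ℓ) :
    (genericLetters n ℓ c).map (evalPoint x) = letters x.1 c := rfl

theorem generic_moment : ∑ k, (genericLetters n ℓ (.inl k) * genericLetters n ℓ (.inr k) -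
    genericLetters n ℓ (.inr k) * genericLetters n ℓ (.inl k)) =
      vecMulVec (genericJ n ℓ) (genericI n ℓ) := by
  refine matrix_ext_of_evalPoint fun x => ?_
  have h1 := sub_eq_zero.mp x.2.2
  rw [show vecMulVec x.1.j x.1.i =
    (vecMulVec (genericJ n ℓ) (genericI n ℓ)).map (evalPoint x) by ext r s; rfl] at h1
  rw [← h1]
  ext r s
  simp only [Matrix.map_apply, Matrix.sum_apply, map_sum, Matrix.sub_apply, map_sub, Matrix.mul_apply,
    map_mul]
  rfl

theorem generic_wordProd_eval (x : MomentZero n ℓ) (w : List (Fin ℓ ⊕ Fin ℓ)) :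
    (wordProd (genericLetters n ℓ) w).map (evalPoint x) = wordProd (letters x.1) w :=
  wordProd_map (genericLetters n ℓ) (evalPoint x : coordinateRing n ℓ →+* ℂ) w

/-- The vector underlying a tangent vector, given as a linear form on the coordinate ring. -/
noncomputable def underlyingVector : Module.Dual ℂ (coordinateRing n ℓ) →ₗ[ℂ] Rep n ℓ where
  toFun D := (Module.evalEquiv ℂ (Rep n ℓ)).symm (D ∘ₗ linearFunction n ℓ)
  map_add' D D' := by rw [LinearMap.add_comp, map_add]
  map_smul' a D := by rw [LinearMap.smul_comp, map_smul, RingHom.id_apply]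

theorem apply_underlyingVector (D : Module.Dual ℂ (coordinateRing n ℓ))
    (φ : Module.Dual ℂ (Rep n ℓ)) : φ (underlyingVector D) = D (linearFunction n ℓ φ) :=
  Module.apply_evalEquiv_symm_apply ℂ (Rep n ℓ) φ _

theorem letters_underlyingVector (D : Module.Dual ℂ (coordinateRing n ℓ)) (c : Fin ℓ ⊕ Fin ℓ) :
    letters (underlyingVector D) c = (genericLetters n ℓ c).map D := by
  ext r s
  rcases c with k | k
  · exact apply_underlyingVector D
      ⟨⟨fun x : Rep n ℓ => x.X k r s, fun _ _ => rfl⟩, fun _ _ => rfl⟩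
  · exact apply_underlyingVector D
      ⟨⟨fun x : Rep n ℓ => x.Y k r s, fun _ _ => rfl⟩, fun _ _ => rfl⟩

theorem underlyingVector_i (D : Module.Dual ℂ (coordinateRing n ℓ)) :
    (underlyingVector D).i = D ∘ genericI n ℓ :=
  funext fun r => apply_underlyingVector D
    ⟨⟨fun x : Rep n ℓ => x.i r, fun _ _ => rfl⟩, fun _ _ => rfl⟩

theorem underlyingVector_j (D : Module.Dual ℂ (coordinateRing n ℓ)) :
    (underlyingVector D).j = D ∘ genericJ n ℓ :=
  funext fun r => apply_underlyingVector D
    ⟨⟨fun x : Rep n ℓ => x.j r, fun _ _ => rfl⟩, fun _ _ => rfl⟩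

/-- Tangent vectors are killed by the differential of the moment map. -/
theorem dMoment_underlyingVector {x : MomentZero n ℓ} {D : Module.Dual ℂ (coordinateRing n ℓ)}
    (hD : ∀ f g, D (f * g) = evalPoint x f * D g + evalPoint x g * D f) :
    dMoment x.1 (underlyingVector D) = 0 := by
  have h := congrArg (fun A => A.map D) (generic_moment (n := n) (ℓ := ℓ))
  beta_reduce at h
  have hsum : ∀ f : Fin ℓ → Matrix (Fin n) (Fin n) (coordinateRing n ℓ),
      (∑ k, f k).map D = ∑ k, (f k).map D := by
    intro f
    ext r q
    simp [Matrix.sum_apply]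
  have hsub : ∀ A B : Matrix (Fin n) (Fin n) (coordinateRing n ℓ),
      (A - B).map D = A.map D - B.map D := by
    intro A B
    ext r q
    simp
  rw [dMoment, sub_eq_zero, linearizedMoment_apply, underlyingVector_i, underlyingVector_j]
  simp only [letters_underlyingVector]
  rw [hsum] at h
  simp only [hsub, map_pointDerivation_mul hD, genericLetters_eval] at h
  rw [show vecMulVec (D ∘ genericJ n ℓ) x.1.i + vecMulVec x.1.j (D ∘ genericI n ℓ) =
    (vecMulVec (genericJ n ℓ) (genericI n ℓ)).map D by
      ext r s
      simp only [Matrix.map_apply, vecMulVec_apply, Matrix.add_apply, Function.comp_apply, hD]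
      exact (add_comm _ _).trans (congrArg₂ _ rfl (mul_comm _ _)), ← h]
  refine Finset.sum_congr rfl fun k _ => ?_
  abel

end GenericRepresentation

end BouquetQuiver

namespace BouquetQuiver

open Matrix Filter Topology

/-! ### Charts of the quiver variety given by frames. -/

section Charts

variable {n ℓ : ℕ} {ws : Fin n → List (Fin ℓ ⊕ Fin ℓ)}

theorem QuiverVariety.rep_mem (p : QuiverVariety n ℓ) : p.rep ∈ semistable n ℓ :=
  (Quotient.out p).2

/-- The set of classes of points whose given frame is a basis. -/
def chartSet (ws : Fin n → List (Fin ℓ ⊕ Fin ℓ)) : Set (QuiverVariety n ℓ) :=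
  {p | (frame ws p.rep.1).det ≠ 0}

theorem isOpen_chartSet : IsOpen (chartSet (ℓ := ℓ) ws) :=
  TopologicalSpace.isOpen_generateFrom_of_mem ⟨1, _, det_frame_mem ws, rfl⟩

theorem exists_mem_chartSet (p : QuiverVariety n ℓ) : ∃ ws, p ∈ chartSet ws :=
  exists_det_frame_ne_zero p.rep_mem

/-- The representative with frame `1`. -/
noncomputable def slicePoint (ws : Fin n → List (Fin ℓ ⊕ Fin ℓ)) (p : QuiverVariety n ℓ) :
    MomentZero n ℓ :=
  normalize ws p.rep

/-- Each linear coordinate of the normal form is a ratio of semi-invariants of equal weight, and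
such ratios agree on equivalent points. Hence GIT classes have well-defined normal forms. -/
theorem normalize_eq_of_rel {x y : semistable n ℓ} (h : (gitSetoid n ℓ).r x y)
    (hx : (frame ws x.1.1).det ≠ 0) : normalize ws x.1 = normalize ws y.1 := by
  have hy : (frame ws y.1.1).det ≠ 0 := (not_congr (h 1 _ (det_frame_mem ws))).mp hx
  refine Subtype.ext (sub_eq_zero.mp ((Module.forall_dual_apply_eq_zero_iff ℂ _).mp fun φ => ?_))
  rw [map_sub, sub_eq_zero]
  obtain ⟨m, A, hA, hA'⟩ := exists_semiInvariant_normalize ws (coordinateRing_linear φ)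
  have hm : (fun x : MomentZero n ℓ => (frame ws x.1).det ^ m) ∈ semiInvariants n ℓ m := by
    have := SetLike.pow_mem_graded m (det_frame_mem (ℓ := ℓ) ws)
    rw [smul_eq_mul, mul_one] at this
    exact this
  have h1 := div_eq_div_of_rel h hA hm
  rw [← hA' _ hx, ← hA' _ hy] at h1
  rwa [mul_div_cancel_right₀ _ (pow_ne_zero m hx), mul_div_cancel_right₀ _ (pow_ne_zero m hy)] at h1

theorem mk_mem_chartSet {x : semistable n ℓ} :
    (Quotient.mk (gitSetoid n ℓ) x : QuiverVariety n ℓ) ∈ chartSet ws ↔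
      (frame ws x.1.1).det ≠ 0 :=
  not_congr (rep_mk_rel x 1 _ (det_frame_mem ws))

theorem slicePoint_mk {x : semistable n ℓ} (hx : (frame ws x.1.1).det ≠ 0) :
    slicePoint ws (Quotient.mk (gitSetoid n ℓ) x : QuiverVariety n ℓ) = normalize ws x.1 :=
  normalize_eq_of_rel (rep_mk_rel x) (mk_mem_chartSet.mpr hx)

theorem frame_slicePoint {p : QuiverVariety n ℓ} (hp : p ∈ chartSet ws) :
    frame ws (slicePoint ws p).1 = 1 :=
  frame_normalize hp

theorem slicePoint_mem (p : QuiverVariety n ℓ) : slicePoint ws p ∈ semistable n ℓ := by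
  obtain ⟨m, hm, f, hf, hfx⟩ := p.rep_mem
  obtain ⟨g, hg⟩ := exists_normalize_eq_act ws p.rep
  refine ⟨m, hm, f, hf, ?_⟩
  rw [slicePoint, hg]
  exact (semiInvariant_act_eq_zero hf g _).not.mpr hfx

theorem semiInvariant_slicePoint_eq_zero {m : ℕ} {f : MomentZero n ℓ → ℂ}
    (hf : f ∈ semiInvariants n ℓ m) (p : QuiverVariety n ℓ) :
    f (slicePoint ws p) = 0 ↔ f p.rep = 0 := by
  obtain ⟨g, hg⟩ := exists_normalize_eq_act ws p.rep
  rw [slicePoint, hg]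
  exact semiInvariant_act_eq_zero hf g _

theorem mk_slicePoint (p : QuiverVariety n ℓ) :
    (Quotient.mk (gitSetoid n ℓ) ⟨slicePoint ws p, slicePoint_mem p⟩ : QuiverVariety n ℓ) = p := by
  conv_rhs => rw [← Quotient.out_eq p]
  exact Quotient.sound fun m f hf => semiInvariant_slicePoint_eq_zero hf p

/-- Fractions of semi-invariants may be computed on the slice. -/
theorem semiInvariant_div_slicePoint {m : ℕ} {a b : MomentZero n ℓ → ℂ}
    (ha : a ∈ semiInvariants n ℓ m) (hb : b ∈ semiInvariants n ℓ m) (p : QuiverVariety n ℓ) :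
    a p.rep / b p.rep = a (slicePoint ws p) / b (slicePoint ws p) := by
  obtain ⟨g, hg⟩ := exists_normalize_eq_act ws p.rep
  have : g.1.det ^ m ≠ 0 := pow_ne_zero m (Matrix.isUnits_det_units g).ne_zero
  rw [slicePoint, hg, semiInvariant_act ha, semiInvariant_act hb, mul_div_mul_left _ _ this]

theorem germ_slicePoint_mem {p : QuiverVariety n ℓ} (hp : p ∈ chartSet ws)
    {φ : MomentZero n ℓ → ℂ} (hφ : φ ∈ coordinateRing n ℓ) :
    ((fun q => φ (slicePoint ws q) : QuiverVariety n ℓ → ℂ) : (𝓝 p).Germ ℂ) ∈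
      RegularFunctions.stalk p := by
  obtain ⟨m, A, hA, hA'⟩ := exists_semiInvariant_normalize ws hφ
  have hm : (fun x : MomentZero n ℓ => (frame ws x.1).det ^ m) ∈ semiInvariants n ℓ m := by
    have := SetLike.pow_mem_graded m (det_frame_mem (ℓ := ℓ) ws)
    rw [smul_eq_mul, mul_one] at this
    exact this
  refine ⟨m, A, hA, _, hm, pow_ne_zero m hp, Filter.Germ.coe_eq.mpr ?_⟩
  filter_upwards [isOpen_chartSet.mem_nhds hp] with q hq
  rw [← hA' _ hq, mul_div_cancel_right₀ _ (pow_ne_zero m hq)]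
  rfl

theorem germ_algebraMap {X : Type*} (l : Filter X) (r : ℂ) :
    algebraMap ℂ (l.Germ ℂ) r = ((fun _ => r : X → ℂ) : l.Germ ℂ) := by
  rw [Algebra.algebraMap_eq_smul_one, ← Filter.Germ.coe_one, ← Filter.Germ.coe_smul]
  exact Filter.Germ.coe_eq.mpr (Filter.Eventually.of_forall fun q => by simp)

/-- The functions on the slice as germs of regular functions on the quiver variety. -/
noncomputable def chartGerm {p : QuiverVariety n ℓ} (hp : p ∈ chartSet ws) :
    coordinateRing n ℓ →ₐ[ℂ] RegularFunctions.stalk p where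
  toFun φ := ⟨_, germ_slicePoint_mem hp φ.2⟩
  map_one' := rfl
  map_mul' _ _ := rfl
  map_zero' := rfl
  map_add' _ _ := rfl
  commutes' r := Subtype.ext (germ_algebraMap (𝓝 p) r).symm

/-- The value of a germ in the local ring at a point. -/
def stalkValue {X : Type*} [TopologicalSpace X] [RegularFunctions X] (x : X) :
    RegularFunctions.stalk x →ₐ[ℂ] ℂ where
  toFun f := f.1.value
  map_one' := rfl
  map_mul' f g := by
    obtain ⟨f, hf⟩ := f
    obtain ⟨g, hg⟩ := g
    induction f using Filter.Germ.inductionOn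
    induction g using Filter.Germ.inductionOn
    rfl
  map_zero' := rfl
  map_add' f g := by
    obtain ⟨f, hf⟩ := f
    obtain ⟨g, hg⟩ := g
    induction f using Filter.Germ.inductionOn
    induction g using Filter.Germ.inductionOn
    rfl
  commutes' r := congrArg Filter.Germ.value (germ_algebraMap (𝓝 x) r)

theorem tangentVec_leibniz {X : Type*} [TopologicalSpace X] [RegularFunctions X] {x : X}
    (ξ : TangentVec x) (f g : RegularFunctions.stalk x) :
    ξ.1 (f * g) = stalkValue x f * ξ.1 g + stalkValue x g * ξ.1 f := ξ.2 f g

/-- The vector underlying a tangent vector of the quiver variety, transported to the slice. -/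
noncomputable def chartVelocity {p : QuiverVariety n ℓ} (hp : p ∈ chartSet ws) :
    TangentVec p →ₗ[ℂ] Rep n ℓ where
  toFun ξ := underlyingVector (ξ.1 ∘ₗ (chartGerm hp).toLinearMap)
  map_add' ξ η := by
    rw [Submodule.coe_add, LinearMap.add_comp, map_add]
  map_smul' a ξ := by
    rw [Submodule.coe_smul, LinearMap.smul_comp, map_smul, RingHom.id_apply]

/-- The reduced symplectic form in a chart. -/
noncomputable def chartForm {p : QuiverVariety n ℓ} (hp : p ∈ chartSet ws) :
    TangentVec p →ₗ[ℂ] TangentVec p →ₗ[ℂ] ℂ :=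
  (omegaForm n ℓ).compl₁₂ (chartVelocity hp) (chartVelocity hp)

theorem chartForm_apply {p : QuiverVariety n ℓ} (hp : p ∈ chartSet ws) (ξ η : TangentVec p) :
    chartForm hp ξ η = omega (chartVelocity hp ξ) (chartVelocity hp η) := rfl

end Charts

/-! ### The pullback of the form -/

section Pullback

variable {n ℓ : ℕ} {ws : Fin n → List (Fin ℓ ⊕ Fin ℓ)}

/-- The germs of the coordinate functions at a semistable point. -/
def localGerm (x : semistable n ℓ) : coordinateRing n ℓ →ₐ[ℂ] RegularFunctions.stalk x where
  toFun φ := ⟨((fun y => φ.1 y.1 : semistable n ℓ → ℂ) : (𝓝 x).Germ ℂ),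
    ((φ.1 : MomentZero n ℓ → ℂ) : (𝓝 x.1).Germ ℂ),
    ⟨0, φ.1, φ.2, 1, (coordinateRing n ℓ).one_mem,
      one_ne_zero, Filter.Germ.coe_eq.mpr (Filter.Eventually.of_forall fun _ => (div_one _).symm)⟩,
    rfl⟩
  map_one' := rfl
  map_mul' _ _ := rfl
  map_zero' := rfl
  map_add' _ _ := rfl
  commutes' r := Subtype.ext (germ_algebraMap (𝓝 x) r).symm

theorem velocity_eq (x : semistable n ℓ) (u : TangentVec x) :
    velocity u = underlyingVector (u.1 ∘ₗ (localGerm x).toLinearMap) := rfl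

theorem quotientMap_mem_chartSet {x : semistable n ℓ} :
    (quotientMap n ℓ).toMap x ∈ chartSet ws ↔ (frame ws x.1.1).det ≠ 0 :=
  mk_mem_chartSet

theorem eventually_frame_ne_zero {x : semistable n ℓ} (hx : (frame ws x.1.1).det ≠ 0) :
    ∀ᶠ y in 𝓝 x, (frame ws y.1.1).det ≠ 0 := by
  have h1 : ∀ᶠ q in 𝓝 ((quotientMap n ℓ).toMap x), q ∈ chartSet ws :=
    isOpen_chartSet.mem_nhds (quotientMap_mem_chartSet.mpr hx)
  have h2 := (quotientMap n ℓ).toMap.continuous.continuousAt.eventually h1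
  filter_upwards [h2] with y hy
  exact quotientMap_mem_chartSet.mp hy

/-- The functions on the slice, pulled back along the quotient map. -/
noncomputable def normalizedGerm {x : semistable n ℓ} (hx : (frame ws x.1.1).det ≠ 0) :
    coordinateRing n ℓ →ₐ[ℂ] RegularFunctions.stalk x :=
  ((quotientMap n ℓ).stalkMap x).comp (chartGerm (quotientMap_mem_chartSet.mpr hx))

theorem stalk_ext {X : Type*} [TopologicalSpace X] [RegularFunctions X] {x : X}
    {f g : RegularFunctions.stalk x} {F G : X → ℂ} (hf : f.1 = F) (hg : g.1 = G)
    (h : ∀ᶠ y in 𝓝 x, F y = G y) : f = g :=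
  Subtype.ext (hf.trans ((Filter.Germ.coe_eq.mpr h).trans hg.symm))

theorem normalizedGerm_val {x : semistable n ℓ} (hx : (frame ws x.1.1).det ≠ 0)
    (φ : coordinateRing n ℓ) : (normalizedGerm hx φ).1 =
      ((fun y => φ.1 (normalize ws y.1) : semistable n ℓ → ℂ) : (𝓝 x).Germ ℂ) := by
  refine Filter.Germ.coe_eq.mpr ?_
  filter_upwards [eventually_frame_ne_zero hx] with y hy
  exact congrArg φ.1 (slicePoint_mk hy)

theorem germ_sum {X ι : Type*} {l : Filter X} (s : Finset ι) (f : ι → X → ℂ) :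
    ∑ a ∈ s, ((f a : X → ℂ) : l.Germ ℂ) = ((fun x => ∑ a ∈ s, f a x : X → ℂ) : l.Germ ℂ) := by
  rw [show (fun x => ∑ a ∈ s, f a x) = ∑ a ∈ s, f a by ext x; simp]
  exact (map_sum (Filter.Germ.coeRingHom l) f s).symm

theorem sum_mul_val {X ι : Type*} [TopologicalSpace X] [RegularFunctions X] {x : X} [Fintype ι]
    {a b : ι → RegularFunctions.stalk x} {F G : ι → X → ℂ} (ha : ∀ s, (a s).1 = F s)
    (hb : ∀ s, (b s).1 = G s) :
    (∑ s, a s * b s).1 = ((fun y => ∑ s, F s y * G s y : X → ℂ) : (𝓝 x).Germ ℂ) := by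
  rw [← germ_sum, AddSubmonoidClass.coe_finsetSum]
  refine Finset.sum_congr rfl fun s _ => ?_
  rw [MulMemClass.coe_mul, ha, hb]
  rfl

/-- The frame as a matrix of functions. -/
def genericFrame (ws : Fin n → List (Fin ℓ ⊕ Fin ℓ)) :
    Matrix (Fin n) (Fin n) (coordinateRing n ℓ) :=
  of fun r a => ⟨fun x => frame ws x.1 r a, entriesIn_frame ws r a⟩

theorem frame_mul_letters_normalize {x : MomentZero n ℓ} (hx : (frame ws x.1).det ≠ 0)
    (c : Fin ℓ ⊕ Fin ℓ) :
    frame ws x.1 * letters (normalize ws x).1 c = letters x.1 c * frame ws x.1 := by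
  obtain ⟨g, hg, h⟩ := normalize_eq_act hx
  rw [h]
  change _ * letters (act g⁻¹ x.1) c = _
  rw [letters_act, ← hg]
  beta_reduce
  rw [← Matrix.mul_assoc, ← Matrix.mul_assoc, val_mul_inv_val, Matrix.one_mul, inv_inv]

theorem frame_mulVec_normalize {x : MomentZero n ℓ} (hx : (frame ws x.1).det ≠ 0) :
    frame ws x.1 *ᵥ (normalize ws x).1.j = x.1.j := by
  obtain ⟨g, hg, h⟩ := normalize_eq_act hx
  rw [h, ← hg]
  change g.1 *ᵥ (g⁻¹.1 *ᵥ x.1.j) = _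
  rw [mulVec_mulVec, val_mul_inv_val, one_mulVec]

theorem normalize_i {x : MomentZero n ℓ} (hx : (frame ws x.1).det ≠ 0) :
    (normalize ws x).1.i = x.1.i ᵥ* frame ws x.1 := by
  obtain ⟨g, hg, h⟩ := normalize_eq_act hx
  rw [h, ← hg]
  change x.1.i ᵥ* (g⁻¹)⁻¹.1 = _
  rw [inv_inv]

/-- The differential of the quotient map in the slice: up to the action of `g⁻¹` the underlying
vectors differ by an infinitesimal symmetry. -/
theorem exists_chartVelocity_differential {x : semistable n ℓ} (hx : (frame ws x.1.1).det ≠ 0)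
    (g : GL (Fin n) ℂ) (hg : g.1 = frame ws x.1.1) (u : TangentVec x) :
    ∃ a, act g⁻¹ (velocity u) =
      chartVelocity (quotientMap_mem_chartSet.mpr hx) ((quotientMap n ℓ).differential x u) +
        infinitesimalAct a (normalize ws x.1).1 := by
  have hD : ∀ f h, u.1 (f * h) = stalkValue x f * u.1 h + stalkValue x h * u.1 f := tangentVec_leibniz u
  let h1 := localGerm x
  let h2 := normalizedGerm hx
  let v := chartVelocity (quotientMap_mem_chartSet.mpr hx) ((quotientMap n ℓ).differential x u)
  have hv : v = underlyingVector (u.1 ∘ₗ h2.toLinearMap) := rfl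
  let N := (normalize ws x.1).1
  have hev1 : ∀ φ, stalkValue x (h1 φ) = evalPoint x.1 φ := fun _ => rfl
  have hev2 : ∀ φ, stalkValue x (h2 φ) = evalPoint (normalize ws x.1) φ := by
    intro φ
    change (h2 φ).1.value = _
    rw [normalizedGerm_val hx φ]
    rfl
  let G := (genericFrame (ℓ := ℓ) ws).map h1
  let G' := G.map u.1
  have hG : G.map (stalkValue x) = g.1 := hg.symm
  have hlet : ∀ c, g.1 * letters v c + G' * letters N c =
      letters (velocity u) c * g.1 + letters x.1.1 c * G' := by
    intro c
    have e1 : G * (genericLetters n ℓ c).map h2 = (genericLetters n ℓ c).map h1 * G := by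
      ext1 r s
      rw [Matrix.mul_apply, Matrix.mul_apply]
      refine stalk_ext (sum_mul_val (fun _ => rfl) fun _ => normalizedGerm_val hx _)
        (sum_mul_val (fun _ => rfl) fun _ => rfl) ?_
      filter_upwards [eventually_frame_ne_zero hx] with y hy
      exact congrFun (congrFun (frame_mul_letters_normalize hy c) r) s
    have e2 := congrArg (fun A => A.map u.1) e1
    beta_reduce at e2
    rw [map_pointDerivation_mul hD, map_pointDerivation_mul hD, hG] at e2
    have e3 : ((genericLetters n ℓ c).map h2).map (stalkValue x) = letters N c := by
      ext r s
      exact hev2 (genericLetters n ℓ c r s)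
    rw [e3] at e2
    have e4 : ((genericLetters n ℓ c).map h2).map u.1 = letters v c := by
      rw [hv, letters_underlyingVector]
      rfl
    have e5 : ((genericLetters n ℓ c).map h1).map u.1 = letters (velocity u) c := by
      rw [velocity_eq, letters_underlyingVector]
      rfl
    rw [e4, e5] at e2
    rw [add_comm]
    exact e2
  have hvecj : g.1 *ᵥ v.j + G' *ᵥ N.j = (velocity u).j := by
    have e1 : G *ᵥ (h2 ∘ genericJ n ℓ) = h1 ∘ genericJ n ℓ := by
      ext1 r
      refine stalk_ext (sum_mul_val (fun _ => rfl) fun _ => normalizedGerm_val hx _) rfl ?_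
      filter_upwards [eventually_frame_ne_zero hx] with y hy
      exact congrFun (frame_mulVec_normalize hy) r
    have e2 := congrArg (fun A => u.1 ∘ A) e1
    beta_reduce at e2
    rw [pointDerivation_comp_mulVec hD, hG] at e2
    have e3 : stalkValue x ∘ (h2 ∘ genericJ n ℓ) = N.j := by
      ext r
      exact hev2 (genericJ n ℓ r)
    rw [e3] at e2
    rw [hv, underlyingVector_j, velocity_eq, underlyingVector_j, add_comm]
    exact e2
  have hveci : v.i = (velocity u).i ᵥ* g.1 + x.1.1.i ᵥ* G' := by
    have e1 : h2 ∘ genericI n ℓ = (h1 ∘ genericI n ℓ) ᵥ* G := by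
      ext1 r
      refine stalk_ext (normalizedGerm_val hx _) (sum_mul_val (fun _ => rfl) fun _ => rfl) ?_
      filter_upwards [eventually_frame_ne_zero hx] with y hy
      exact congrFun (normalize_i hy) r
    have e2 := congrArg (fun A => u.1 ∘ A) e1
    beta_reduce at e2
    rw [pointDerivation_comp_vecMul hD, hG] at e2
    rw [hv, underlyingVector_i, velocity_eq, underlyingVector_i]
    exact e2
  have hgN : ∀ c, letters x.1.1 c * g.1 = g.1 * letters N c := by
    intro c
    rw [hg]
    exact (frame_mul_letters_normalize hx c).symm
  have hNi : x.1.1.i = N.i ᵥ* g⁻¹.1 := by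
    rw [normalize_i hx, ← hg, vecMul_vecMul, val_mul_inv_val, vecMul_one]
  have hlet' : ∀ c, g⁻¹.1 * letters (velocity u) c * g.1 =
      letters v c + (g⁻¹.1 * G' * letters N c - letters N c * (g⁻¹.1 * G')) := by
    intro c
    have e1 : letters (velocity u) c * g.1 =
        g.1 * letters v c + G' * letters N c - letters x.1.1 c * G' :=
      eq_sub_of_add_eq (hlet c).symm
    have e2 : g⁻¹.1 * letters x.1.1 c = letters N c * g⁻¹.1 := by
      calc g⁻¹.1 * letters x.1.1 c = g⁻¹.1 * (letters x.1.1 c * g.1) * g⁻¹.1 := by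
            rw [Matrix.mul_assoc, Matrix.mul_assoc, val_mul_inv_val, Matrix.mul_one]
        _ = _ := by rw [hgN, ← Matrix.mul_assoc, inv_val_mul_val, Matrix.one_mul]
    rw [Matrix.mul_assoc, e1, Matrix.mul_sub, Matrix.mul_add, ← Matrix.mul_assoc, inv_val_mul_val,
      Matrix.one_mul, ← Matrix.mul_assoc, ← Matrix.mul_assoc, e2, Matrix.mul_assoc (letters N c)]
    abel
  -- The infinitesimal symmetry is the logarithmic derivative of the frame.
  refine ⟨g⁻¹.1 * G', Prod.ext (funext fun k => ?_) (Prod.ext (funext fun k => ?_)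
    (Prod.ext ?_ ?_))⟩
  · change g⁻¹.1 * letters (velocity u) (.inl k) * (g⁻¹)⁻¹.1 = _
    rw [inv_inv]
    exact hlet' (.inl k)
  · change g⁻¹.1 * letters (velocity u) (.inr k) * (g⁻¹)⁻¹.1 = _
    rw [inv_inv]
    exact hlet' (.inr k)
  · change (velocity u).i ᵥ* (g⁻¹)⁻¹.1 = v.i + -(N.i ᵥ* (g⁻¹.1 * G'))
    rw [inv_inv, hveci, hNi, vecMul_vecMul]
    abel
  · change g⁻¹.1 *ᵥ (velocity u).j = v.j + (g⁻¹.1 * G') *ᵥ N.j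
    rw [← hvecj, mulVec_add, mulVec_mulVec, mulVec_mulVec, inv_val_mul_val, one_mulVec]

theorem dMoment_chartVelocity {p : QuiverVariety n ℓ} (hp : p ∈ chartSet ws) (ξ : TangentVec p) :
    dMoment (slicePoint ws p).1 (chartVelocity hp ξ) = 0 := by
  refine dMoment_underlyingVector fun f g => ?_
  change ξ.1 (chartGerm hp (f * g)) = _
  rw [map_mul, tangentVec_leibniz ξ]
  rfl

/-- Translate both vectors to the slice, using the invariance of `ω` under the group; the
discrepancies are infinitesimal symmetries and do not contribute, as both chart velocities are in
the kernel of `dμ`. -/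
theorem chartForm_differential {x : semistable n ℓ}
    (hp : (quotientMap n ℓ).toMap x ∈ chartSet ws) (u v : TangentVec x) :
    chartForm hp ((quotientMap n ℓ).differential x u) ((quotientMap n ℓ).differential x v) =
      omega (velocity u) (velocity v) := by
  have hx := quotientMap_mem_chartSet.mp hp
  obtain ⟨g, hg, -⟩ := normalize_eq_act hx
  obtain ⟨a, ha⟩ := exists_chartVelocity_differential hx g hg u
  obtain ⟨b, hb⟩ := exists_chartVelocity_differential hx g hg v
  rw [← omega_act g⁻¹, ha, hb, chartForm_apply]
  have h : slicePoint ws ((quotientMap n ℓ).toMap x) = normalize ws x.1 := slicePoint_mk hx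
  have h1 := dMoment_chartVelocity hp ((quotientMap n ℓ).differential x u)
  have h2 := dMoment_chartVelocity hp ((quotientMap n ℓ).differential x v)
  rw [h] at h1 h2
  rw [omega_add_infinitesimalAct (normalize ws x.1).2.2 h1 h2]

/-- After multiplication by a power of the frame determinant, a function of the normal form is a
semi-invariant, so its nonvanishing is an open condition on the chart. -/
theorem tendsto_slicePoint {x : semistable n ℓ} (hx : frame ws x.1.1 = 1) :
    Tendsto (fun q : QuiverVariety n ℓ => (⟨slicePoint ws q, slicePoint_mem q⟩ : semistable n ℓ))
      (𝓝 ((quotientMap n ℓ).toMap x)) (𝓝 x) := by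
  have hdet : (frame ws x.1.1).det ≠ 0 := by rw [hx, det_one]; exact one_ne_zero
  have hp := quotientMap_mem_chartSet.mpr hdet
  have hσ : slicePoint ws ((quotientMap n ℓ).toMap x) = x.1 :=
    (slicePoint_mk hdet).trans (normalize_eq_self hx)
  rw [tendsto_subtype_rng, TopologicalSpace.tendsto_nhds_generateFrom_iff]
  rintro _ ⟨_, f, hf, rfl⟩ hfx
  obtain ⟨m, A, hA, hA'⟩ := exists_semiInvariant_normalize ws hf
  have hAp : A ((quotientMap n ℓ).toMap x).rep ≠ 0 := by
    rw [← hA' _ hp]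
    refine mul_ne_zero ?_ (pow_ne_zero m hp)
    change f (slicePoint ws _) ≠ 0
    rwa [hσ]
  filter_upwards [eventually_ne QuiverVariety.rep (semiInvariants n ℓ) hA _ hAp,
    isOpen_chartSet.mem_nhds hp] with q hq hq'
  rw [← hA' _ hq'] at hq
  exact left_ne_zero_of_mul hq

/-- Pullback of germs along the slice. -/
noncomputable def sliceGerm {x : semistable n ℓ} (hx : frame ws x.1.1 = 1) :
    (𝓝 x).Germ ℂ →ₐ[ℂ] (𝓝 ((quotientMap n ℓ).toMap x)).Germ ℂ where
  toFun g := g.compTendsto _ (tendsto_slicePoint hx)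
  map_one' := rfl
  map_mul' a b := Quotient.inductionOn₂' a b fun _ _ => rfl
  map_zero' := rfl
  map_add' a b := Quotient.inductionOn₂' a b fun _ _ => rfl
  commutes' _ := rfl

theorem sliceGerm_mem {x : semistable n ℓ} (hx : frame ws x.1.1 = 1) {g : (𝓝 x).Germ ℂ}
    (hg : g ∈ RegularFunctions.stalk x) :
    sliceGerm hx g ∈ RegularFunctions.stalk ((quotientMap n ℓ).toMap x) := by
  have hdet : (frame ws x.1.1).det ≠ 0 := by rw [hx, det_one]; exact one_ne_zero
  have hp := quotientMap_mem_chartSet.mpr hdet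
  have hσ : slicePoint ws ((quotientMap n ℓ).toMap x) = x.1 :=
    (slicePoint_mk hdet).trans (normalize_eq_self hx)
  have hpow : ∀ m, (fun x : MomentZero n ℓ => (frame ws x.1).det ^ m) ∈ semiInvariants n ℓ m := by
    intro m
    have := SetLike.pow_mem_graded m (det_frame_mem (ℓ := ℓ) ws)
    rw [smul_eq_mul, mul_one] at this
    exact this
  obtain ⟨_, ⟨_, a, ha, b, hb, hbx, rfl⟩, rfl⟩ := hg
  obtain ⟨m, A, hA, hA'⟩ := exists_semiInvariant_normalize ws ha
  obtain ⟨m', B, hB, hB'⟩ := exists_semiInvariant_normalize ws hb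
  -- Numerator and denominator acquire different weights `m` and `m'`; powers of the frame
  -- determinant bring both to `m + m'`.
  have h1 := SetLike.mul_mem_graded (A := semiInvariants n ℓ) hA (hpow m')
  have h2 := SetLike.mul_mem_graded (A := semiInvariants n ℓ) hB (hpow m)
  rw [add_comm] at h2
  refine ⟨m + m', _, h1, _, h2, ?_, Filter.Germ.coe_eq.mpr ?_⟩
  · rw [Pi.mul_apply, ← hB' _ hp]
    refine mul_ne_zero (mul_ne_zero ?_ (pow_ne_zero _ hp)) (pow_ne_zero _ hp)
    change b (slicePoint ws _) ≠ 0
    rwa [hσ]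
  · filter_upwards [isOpen_chartSet.mem_nhds hp] with q hq
    rw [Pi.mul_apply, Pi.mul_apply, ← hA' _ hq, ← hB' _ hq, mul_assoc, mul_assoc,
      mul_comm ((frame ws q.rep.1).det ^ m'),
      mul_div_mul_right _ _ (mul_ne_zero (pow_ne_zero _ hq) (pow_ne_zero _ hq))]
    rfl

/-- The differential of the quotient map is surjective at points of the slice. -/
theorem exists_differential_eq {x : semistable n ℓ} (hx : frame ws x.1.1 = 1)
    (ξ : TangentVec ((quotientMap n ℓ).toMap x)) : ∃ u, (quotientMap n ℓ).differential x u = ξ := by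
  have hdet : (frame ws x.1.1).det ≠ 0 := by rw [hx, det_one]; exact one_ne_zero
  have hσ : slicePoint ws ((quotientMap n ℓ).toMap x) = x.1 :=
    (slicePoint_mk hdet).trans (normalize_eq_self hx)
  let s : RegularFunctions.stalk x →ₐ[ℂ] RegularFunctions.stalk ((quotientMap n ℓ).toMap x) :=
    ((sliceGerm hx).comp (RegularFunctions.stalk x).val).codRestrict _
      fun g => sliceGerm_mem hx g.2
  have hs : ∀ f, (s f).1.value = f.1.value := by
    rintro ⟨f, hf⟩
    induction f using Filter.Germ.inductionOn with
    | _ F => exact congrArg F (Subtype.ext hσ)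
  refine ⟨⟨ξ.1 ∘ₗ s.toLinearMap, fun f g => ?_⟩, ?_⟩
  · have := ξ.2 (s f) (s g)
    rw [hs, hs, ← map_mul] at this
    exact this
  · refine Subtype.ext (LinearMap.ext fun g => congrArg ξ.1 (Subtype.ext ?_))
    obtain ⟨g, hg⟩ := g
    induction g using Filter.Germ.inductionOn with
    | _ G => exact Filter.Germ.coe_eq.mpr (Filter.Eventually.of_forall fun q =>
        congrArg G (mk_slicePoint q))

/-- The existence and uniqueness of the reduced symplectic form. -/
theorem existsUnique_isReducedSymplecticForm (n ℓ : ℕ) :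
    ∃! Ω : BilinearField n ℓ, IsReducedSymplecticForm Ω := by
  -- The chart is chosen separately at every point; this is harmless, since the pullback computed in
  -- any chart is `ω`.
  refine ⟨fun p => chartForm (exists_mem_chartSet p).choose_spec,
    fun x u v => chartForm_differential _ u v, fun Ω hΩ => ?_⟩
  funext p
  obtain ⟨ws, hp⟩ := exists_mem_chartSet p
  obtain ⟨x, hx, rfl⟩ : ∃ x : semistable n ℓ, frame ws x.1.1 = 1 ∧ (quotientMap n ℓ).toMap x = p :=
    ⟨⟨slicePoint ws p, slicePoint_mem p⟩, frame_slicePoint hp, mk_slicePoint p⟩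
  refine LinearMap.ext fun ξ => LinearMap.ext fun η => ?_
  obtain ⟨u, rfl⟩ := exists_differential_eq hx ξ
  obtain ⟨v, rfl⟩ := exists_differential_eq hx η
  rw [hΩ]
  exact (chartForm_differential _ u v).symm

/-- The reduced symplectic form can be computed in any chart. -/
theorem IsReducedSymplecticForm.eq_chartForm {Ω : BilinearField n ℓ}
    (hΩ : IsReducedSymplecticForm Ω) {p : QuiverVariety n ℓ} (hp : p ∈ chartSet ws) :
    Ω p = chartForm hp := by
  obtain ⟨x, hx, rfl⟩ : ∃ x : semistable n ℓ, frame ws x.1.1 = 1 ∧ (quotientMap n ℓ).toMap x = p :=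
    ⟨⟨slicePoint ws p, slicePoint_mem p⟩, frame_slicePoint hp, mk_slicePoint p⟩
  refine LinearMap.ext fun ξ => LinearMap.ext fun η => ?_
  obtain ⟨u, rfl⟩ := exists_differential_eq hx ξ
  obtain ⟨v, rfl⟩ := exists_differential_eq hx η
  rw [hΩ]
  exact (chartForm_differential hp u v).symm

end Pullback

end BouquetQuiver

namespace BouquetQuiver

open Matrix Filter Topology

/-! ### Associative algebras of nilpotent matrices -/

section NilMatrices

variable {K Λ : Type*} [Field K] {n : ℕ} (x : Λ → Matrix (Fin n) (Fin n) K)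

/-- Once two successive terms agree the filtration is constant, so until it reaches zero it loses at
least one dimension per step. -/
theorem radicalFiltration_eq_bot_of_card {N : ℕ} (hN : radicalFiltration x N = ⊥) :
    radicalFiltration x n = ⊥ := by
  have hstab : ∀ p, radicalFiltration x (p + 1) = radicalFiltration x p →
      ∀ q, radicalFiltration x (p + q) = radicalFiltration x p := by
    intro p hp q
    induction q with
    | zero => rfl
    | succ q ih =>
      rw [← add_assoc, radicalFiltration, ih]
      exact hp
  have hdim : ∀ p, radicalFiltration x p = ⊥ ∨
      Module.finrank K (radicalFiltration x p) + p ≤ n := by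
    intro p
    induction p with
    | zero => exact .inr ((Submodule.finrank_le _).trans (by simp))
    | succ p ih =>
      have hle := radicalFiltration_antitone x (Nat.le_add_right p 1)
      rcases ih with h | h
      · exact .inl (le_bot_iff.mp (h ▸ hle))
      · by_cases heq : radicalFiltration x (p + 1) = radicalFiltration x p
        · left
          have h1 := hstab p heq N
          rw [heq, ← h1]
          exact le_bot_iff.mp (hN ▸ radicalFiltration_antitone x (Nat.le_add_left N p))
        · right
          have := Submodule.finrank_lt_finrank_of_lt (lt_of_le_of_ne hle heq)
          omega
  rcases hdim n with h | h
  · exact h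
  · exact Submodule.finrank_eq_zero.mp (by omega)

theorem wordProd_mulVec_mem (w : List Λ) (v : Fin n → K) :
    wordProd x w *ᵥ v ∈ radicalFiltration x w.length := by
  induction w with
  | nil => exact trivial
  | cons c w ih =>
    rw [wordProd_cons, ← mulVec_mulVec]
    exact mulVec_mem_radicalFiltration x c ih

attribute [local instance] LieRing.ofAssociativeRing in
/-- If all linear combinations of nonempty words in given matrices are nilpotent, then all words of
length `n` vanish. -/
theorem wordProd_eq_zero_of_isNilpotent
    (hx : ∀ a ∈ Submodule.span K {a | ∃ w : List Λ, w ≠ [] ∧ a = wordProd x w}, IsNilpotent a)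
    {w : List Λ} (hw : w.length = n) : wordProd x w = 0 := by
  let U := Submodule.span K {a | ∃ w : List Λ, w ≠ [] ∧ a = wordProd x w}
  have hmul : ∀ a ∈ U, ∀ b ∈ U, a * b ∈ U := by
    intro a ha b hb
    induction ha using Submodule.span_induction with
    | zero => rw [Matrix.zero_mul]; exact U.zero_mem
    | add a a' _ _ h h' => rw [Matrix.add_mul]; exact U.add_mem h h'
    | smul r a _ h => rw [Matrix.smul_mul]; exact U.smul_mem r h
    | mem a ha =>
      obtain ⟨v, hv, rfl⟩ := ha
      induction hb using Submodule.span_induction with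
      | zero => rw [Matrix.mul_zero]; exact U.zero_mem
      | add a a' _ _ h h' => rw [Matrix.mul_add]; exact U.add_mem h h'
      | smul r a _ h => rw [Matrix.mul_smul]; exact U.smul_mem r h
      | mem b hb =>
        obtain ⟨w, hw, rfl⟩ := hb
        exact Submodule.subset_span ⟨v ++ w, by simp [hv], (wordProd_append x v w).symm⟩
  -- The span of nonempty words is closed under products, hence under brackets.
  let L : LieSubalgebra K (Module.End K (Fin n → K)) :=
    { U.map (Matrix.toLinAlgEquiv' (R := K) (n := Fin n)).toLinearMap with
      lie_mem' := by
        rintro _ _ ⟨a, ha, rfl⟩ ⟨b, hb, rfl⟩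
        refine ⟨a * b - b * a, U.sub_mem (hmul a ha b hb) (hmul b hb a ha), ?_⟩
        rw [Ring.lie_def]
        simp only [AlgEquiv.toLinearMap_apply, map_sub, map_mul] }
  -- Engel's theorem. The lower central series it controls contains the radical filtration term by
  -- term, so the latter reaches zero as well.
  have hnil : LieModule.IsNilpotent L (Fin n → K) := by
    rw [LieModule.isNilpotent_iff_forall' (R := K)]
    rintro ⟨_, a, ha, rfl⟩
    have h := (hx a ha).map (Matrix.toLinAlgEquiv' (R := K) (n := Fin n))
    exact h
  obtain ⟨N, hN⟩ := (LieModule.isNilpotent_iff K L (Fin n → K)).mp hnil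
  have hle : ∀ p, radicalFiltration x p ≤
      (LieModule.lowerCentralSeries K L (Fin n → K) p).toSubmodule := by
    intro p
    induction p with
    | zero => exact fun _ _ => trivial
    | succ p ih =>
      refine iSup_le fun c => ?_
      rintro _ ⟨v, hv, rfl⟩
      rw [LieModule.lowerCentralSeries_succ]
      let c' : L := ⟨Matrix.toLinAlgEquiv' (x c), x c,
        Submodule.subset_span ⟨[c], by simp, by rw [wordProd_cons, wordProd_nil, Matrix.mul_one]⟩,
        rfl⟩
      exact LieSubmodule.lie_mem_lie (x := c') (LieSubmodule.mem_top c') (ih hv)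
  have hbot : radicalFiltration x N = ⊥ := by
    refine le_bot_iff.mp ((hle N).trans ?_)
    rw [hN]
    exact le_rfl
  have h0 := radicalFiltration_eq_bot_of_card x hbot
  refine Matrix.toLin'.injective (LinearMap.ext fun v => ?_)
  have := wordProd_mulVec_mem x w v
  rw [hw, h0, Submodule.mem_bot] at this
  rw [toLin'_apply, this, map_zero, LinearMap.zero_apply]

end NilMatrices

/-! ### Points of the central fibre -/

section CentralFiberPoints

variable {n ℓ : ℕ} {ws : Fin n → List (Fin ℓ ⊕ Fin ℓ)}

theorem letters_zero : letters (0 : Rep n ℓ) = 0 := by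
  ext1 c
  rcases c with k | k <;> rfl

theorem rho_eq_affineQuotientMap (ws : Fin n → List (Fin ℓ ⊕ Fin ℓ)) (p : QuiverVariety n ℓ) :
    rho p = affineQuotientMap (slicePoint ws p) := by
  conv_lhs => rw [← mk_slicePoint (ws := ws) p]
  rfl

theorem invariant_eq_of_affineQuotientMap {x y : MomentZero n ℓ}
    (h : affineQuotientMap x = affineQuotientMap y) {f : MomentZero n ℓ → ℂ}
    (hf : f ∈ coordinateRing n ℓ) (hinv : ∀ g x, f (MomentZero.act g x) = f x) : f x = f y :=
  DFunLike.congr_fun h (⟨f, hf, hinv⟩ : invariants n ℓ)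

/-- The functions `i w_a j` are invariant and vanish at the zero representation, and the vectors
`w_a j` form the standard basis. -/
theorem i_eq_zero_of_centralFiber {x : MomentZero n ℓ} (hx : frame ws x.1 = 1)
    (h0 : affineQuotientMap x = AffineQuiverVariety.zero n ℓ) : x.1.i = 0 := by
  funext a
  have h := invariant_eq_of_affineQuotientMap h0
    (f := fun x => x.1.i ⬝ᵥ (wordProd (letters x.1) (ws a) *ᵥ x.1.j))
    (coordsIn_i.dotProduct ((entriesIn_wordProd (ws a)).mulVec coordsIn_j)) (fun g x => by
      change (x.1.i ᵥ* g⁻¹.1) ⬝ᵥ (wordProd (letters (act g x.1)) (ws a) *ᵥ (act g x.1).j) = _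
      rw [wordProd_mulVec_act, ← dotProduct_mulVec, mulVec_mulVec, inv_val_mul_val, one_mulVec])
  have h1 : wordProd (letters x.1) (ws a) *ᵥ x.1.j = Pi.single a 1 := by
    funext r
    have := congrFun (congrFun hx r) a
    rw [Matrix.one_apply] at this
    rw [Pi.single_apply]
    exact this
  rw [h1, dotProduct_single, mul_one] at h
  rw [h]
  exact zero_dotProduct _

/-- The characteristic polynomial of an equivariant matrix function is invariant. On the central
fibre it therefore equals its value `X^n` at zero, and the Cayley–Hamilton theorem gives the
nilpotency that the Engel argument requires. -/
theorem wordProd_eq_zero_of_centralFiber {x : MomentZero n ℓ}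
    (h0 : affineQuotientMap x = AffineQuiverVariety.zero n ℓ) {w : List (Fin ℓ ⊕ Fin ℓ)}
    (hw : w.length = n) : wordProd (letters x.1) w = 0 := by
  refine wordProd_eq_zero_of_isNilpotent (letters x.1) (fun a ha => ?_) hw
  -- Any combination of words is the value of an equivariant polynomial map; this map vanishes at
  -- the zero representation because the words are nonempty.
  have key : ∃ F : MomentZero n ℓ → Matrix (Fin n) (Fin n) ℂ, EntriesIn (coordinateRing n ℓ) F ∧
      (∀ g y, F (MomentZero.act g y) = g.1 * F y * g⁻¹.1) ∧ F (MomentZero.zero n ℓ) = 0 ∧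
      F x = a := by
    induction ha using Submodule.span_induction with
    | mem a ha =>
      obtain ⟨w, hw, rfl⟩ := ha
      refine ⟨fun y => wordProd (letters y.1) w, entriesIn_wordProd w, fun g y => ?_, ?_, rfl⟩
      · change wordProd (letters (act g y.1)) w = _
        rw [letters_act, wordProd_conj]
      · change wordProd (letters (0 : Rep n ℓ)) w = 0
        obtain ⟨c, w, rfl⟩ := List.exists_cons_of_ne_nil hw
        rw [wordProd_cons, letters_zero, Pi.zero_apply, Matrix.zero_mul]
    | zero => exact ⟨fun _ => 0, EntriesIn.const 0, fun g y => by simp, rfl, rfl⟩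
    | add a b _ _ ha hb =>
      obtain ⟨F, h1, h2, h3, h4⟩ := ha
      obtain ⟨G, k1, k2, k3, k4⟩ := hb
      exact ⟨fun y => F y + G y, h1.add k1,
        fun g y => by beta_reduce; rw [h2, k2, Matrix.mul_add, Matrix.add_mul], by beta_reduce; rw [h3, k3, add_zero],
        by beta_reduce; rw [h4, k4]⟩
    | smul r a _ ha =>
      obtain ⟨F, h1, h2, h3, h4⟩ := ha
      exact ⟨fun y => r • F y, EntriesIn.smul ((coordinateRing n ℓ).algebraMap_mem r) h1,
        fun g y => by beta_reduce; rw [h2, Matrix.mul_smul, Matrix.smul_mul],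
        by beta_reduce; rw [h3, smul_zero], by beta_reduce; rw [h4]⟩
  obtain ⟨F, h1, h2, h3, rfl⟩ := key
  have hchar : (F x).charpoly = Polynomial.X ^ n := by
    refine Polynomial.funext fun t => ?_
    have h := invariant_eq_of_affineQuotientMap h0 (f := fun y => (scalar (Fin n) t - F y).det)
      ((EntriesIn.const _).sub h1).det (fun g y => by
        rw [h2, show scalar (Fin n) t - g.1 * F y * g⁻¹.1 =
          g.1 * (scalar (Fin n) t - F y) * g⁻¹.1 by
            rw [Matrix.mul_sub, Matrix.sub_mul, ← (scalar_commute t (Commute.all t) g.1).eq,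
              Matrix.mul_assoc (scalar (Fin n) t), val_mul_inv_val, Matrix.mul_one], det_mul, det_mul, mul_right_comm,
          ← det_mul, val_mul_inv_val, det_one, one_mul])
    rw [eval_charpoly, h, h3, sub_zero]
    simp
  have hCH := aeval_self_charpoly (F x)
  rw [hchar, map_pow, Polynomial.aeval_X] at hCH
  exact ⟨n, hCH⟩

end CentralFiberPoints

end BouquetQuiver

namespace BouquetQuiver

open Matrix Filter Topology TopologicalSpace

/-! ### Local rings of subvarieties of the quiver variety -/

section SubvarietyStalks

variable {n ℓ : ℕ} {Z : Set (QuiverVariety n ℓ)} {ws : Fin n → List (Fin ℓ ⊕ Fin ℓ)}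

theorem isUnit_of_stalkValue_ne_zero {z : Z} {s : RegularFunctions.stalk z}
    (hs : stalkValue z s ≠ 0) : IsUnit s := by
  obtain ⟨_, _, ⟨m, a, ha, b, hb, hbz, rfl⟩, rfl⟩ := s
  have haz : a (QuiverVariety.rep z.1) ≠ 0 := fun h => hs (by
    change a (QuiverVariety.rep z.1) / b (QuiverVariety.rep z.1) = 0
    rw [h, zero_div])
  let f : RegularFunctions.stalk z.1 := ⟨_, m, a, ha, b, hb, hbz, rfl⟩
  let g : RegularFunctions.stalk z.1 := ⟨_, m, b, hb, a, ha, haz, rfl⟩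
  have hfg : f * g = 1 := by
    refine Subtype.ext (Filter.Germ.coe_eq.mpr ?_)
    filter_upwards [eventually_ne QuiverVariety.rep (semiInvariants n ℓ) hb z.1 hbz,
      eventually_ne QuiverVariety.rep (semiInvariants n ℓ) ha z.1 haz] with q h1 h2
    change a q.rep / b q.rep * (b q.rep / a q.rep) = 1
    rw [div_mul_div_cancel₀ h1, div_self h2]
  exact (IsUnit.of_mul_eq_one g hfg).map ((inclusion Z).stalkMap z)

theorem isLocalRing_stalk (z : Z) : IsLocalRing (RegularFunctions.stalk z) := by
  have : Nontrivial (RegularFunctions.stalk z) := (stalkValue z).toRingHom.domain_nontrivial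
  refine IsLocalRing.of_isUnit_or_isUnit_one_sub_self fun s => ?_
  by_cases h : stalkValue z s = 0
  · right
    refine isUnit_of_stalkValue_ne_zero ?_
    rw [map_sub, h, map_one, sub_zero]
    exact one_ne_zero
  · exact .inl (isUnit_of_stalkValue_ne_zero h)

/-- The functions on the slice as germs of regular functions on a subvariety. -/
noncomputable def restrictedGerm {z : Z} (hz : z.1 ∈ chartSet ws) :
    coordinateRing n ℓ →ₐ[ℂ] RegularFunctions.stalk z :=
  ((inclusion Z).stalkMap z).comp (chartGerm (p := (inclusion Z).toMap z) hz)

theorem eventually_mem_chartSet {z : Z} (hz : z.1 ∈ chartSet ws) :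
    ∀ᶠ q : Z in 𝓝 z, q.1 ∈ chartSet ws :=
  continuous_subtype_val.continuousAt.eventually (isOpen_chartSet.mem_nhds hz)

theorem restrictedGerm_eq_zero {z : Z} (hz : z.1 ∈ chartSet ws) {φ : coordinateRing n ℓ}
    (h : ∀ q : Z, q.1 ∈ chartSet ws → φ.1 (slicePoint ws q.1) = 0) : restrictedGerm hz φ = 0 :=
  stalk_ext (G := fun _ => 0) rfl rfl ((eventually_mem_chartSet hz).mono h)

/-- Every germ is a fraction of functions on the slice. -/
theorem exists_restrictedGerm_mul {z : Z} (hz : z.1 ∈ chartSet ws)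
    (s : RegularFunctions.stalk z) : ∃ φ ψ : coordinateRing n ℓ,
      IsUnit (restrictedGerm hz ψ) ∧ s * restrictedGerm hz ψ = restrictedGerm hz φ := by
  obtain ⟨_, _, ⟨m, a, ha, b, hb, hbz, rfl⟩, rfl⟩ := s
  refine ⟨⟨a, ha.1⟩, ⟨b, hb.1⟩, isUnit_of_stalkValue_ne_zero ?_, ?_⟩
  · change b (slicePoint ws z.1) ≠ 0
    exact (semiInvariant_slicePoint_eq_zero hb z.1).not.mpr hbz
  · refine stalk_ext (F := fun q : Z => a q.1.rep / b q.1.rep * b (slicePoint ws q.1)) rfl rfl ?_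
    filter_upwards [continuous_subtype_val.continuousAt.eventually
      (eventually_ne QuiverVariety.rep (semiInvariants n ℓ) hb z.1 hbz)] with q hq
    rw [semiInvariant_div_slicePoint (ws := ws) ha hb,
      div_mul_cancel₀ _ ((semiInvariant_slicePoint_eq_zero hb q.1).not.mpr hq)]
    rfl

/-- The generic representation over the local ring. -/
noncomputable def localLetters {z : Z} (hz : z.1 ∈ chartSet ws) (c : Fin ℓ ⊕ Fin ℓ) :
    Matrix (Fin n) (Fin n) (RegularFunctions.stalk z) :=
  (genericLetters n ℓ c).map (restrictedGerm hz)

noncomputable def localJ {z : Z} (hz : z.1 ∈ chartSet ws) (r : Fin n) : RegularFunctions.stalk z :=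
  restrictedGerm hz (genericJ n ℓ r)

theorem wordProd_localLetters {z : Z} (hz : z.1 ∈ chartSet ws) (w : List (Fin ℓ ⊕ Fin ℓ)) :
    wordProd (localLetters hz) w = (wordProd (genericLetters n ℓ) w).map (restrictedGerm hz) :=
  (wordProd_map (genericLetters n ℓ)
    (restrictedGerm hz : coordinateRing n ℓ →+* RegularFunctions.stalk z) w).symm

theorem generic_wordProd_val (w : List (Fin ℓ ⊕ Fin ℓ)) (r s : Fin n) (x : MomentZero n ℓ) :
    (wordProd (genericLetters n ℓ) w r s).1 x = wordProd (letters x.1) w r s :=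
  congrFun (congrFun (generic_wordProd_eval x w) r) s

theorem localFrame_eq_one {z : Z} (hz : z.1 ∈ chartSet ws) :
    (of fun r a => (wordProd (localLetters hz) (ws a) *ᵥ localJ hz) r) = 1 := by
  ext1 r a
  have h1 : (wordProd (localLetters hz) (ws a) *ᵥ localJ hz) r =
      restrictedGerm hz ((wordProd (genericLetters n ℓ) (ws a) *ᵥ genericJ n ℓ) r) := by
    rw [wordProd_localLetters]
    exact (RingHom.map_mulVec
      (restrictedGerm hz : coordinateRing n ℓ →+* RegularFunctions.stalk z) _ _ r).symm
  have h2 : ∀ x : MomentZero n ℓ, ((wordProd (genericLetters n ℓ) (ws a) *ᵥ genericJ n ℓ) r).1 x =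
      frame ws x.1 r a := by
    intro x
    have := RingHom.map_mulVec (evalPoint x : coordinateRing n ℓ →+* ℂ)
      (wordProd (genericLetters n ℓ) (ws a)) (genericJ n ℓ) r
    refine this.trans ?_
    change ((wordProd (genericLetters n ℓ) (ws a)).map (evalPoint x) *ᵥ _) r = _
    rw [generic_wordProd_eval]
    rfl
  rw [of_apply, h1, ← sub_eq_zero]
  have h3 : (1 : Matrix (Fin n) (Fin n) (RegularFunctions.stalk z)) r a =
      restrictedGerm hz (algebraMap ℂ _ ((1 : Matrix (Fin n) (Fin n) ℂ) r a)) := by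
    rw [AlgHom.commutes, Matrix.one_apply, Matrix.one_apply]
    split_ifs
    · rw [map_one]
    · rw [map_zero]
  rw [h3, ← map_sub]
  refine restrictedGerm_eq_zero hz fun q hq => ?_
  have h4 := h2 (slicePoint ws q.1)
  rw [frame_slicePoint hq] at h4
  exact sub_eq_zero.mpr h4

variable {hw : Z ⊆ centralFiber n ℓ}

include hw

theorem restrictedGerm_genericI {z : Z} (hz : z.1 ∈ chartSet ws) (r : Fin n) :
    restrictedGerm hz (genericI n ℓ r) = 0 := by
  refine restrictedGerm_eq_zero hz fun q hq => ?_
  have h0 : rho q.1 = AffineQuiverVariety.zero n ℓ := hw q.2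
  rw [rho_eq_affineQuotientMap ws] at h0
  exact congrFun (i_eq_zero_of_centralFiber (frame_slicePoint hq) h0) r

theorem wordProd_localLetters_eq_zero {z : Z} (hz : z.1 ∈ chartSet ws)
    {w : List (Fin ℓ ⊕ Fin ℓ)} (hwl : w.length = n) : wordProd (localLetters hz) w = 0 := by
  rw [wordProd_localLetters]
  ext1 r s
  refine restrictedGerm_eq_zero hz fun q hq => ?_
  have h0 : rho q.1 = AffineQuiverVariety.zero n ℓ := hw q.2
  rw [rho_eq_affineQuotientMap ws] at h0
  rw [generic_wordProd_val, wordProd_eq_zero_of_centralFiber h0 hwl]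
  rfl

theorem localLetters_moment {z : Z} (hz : z.1 ∈ chartSet ws) :
    ∑ k, (localLetters hz (.inl k) * localLetters hz (.inr k) -
      localLetters hz (.inr k) * localLetters hz (.inl k)) = 0 := by
  have h := congrArg (fun A => A.map (restrictedGerm hz)) (generic_moment (n := n) (ℓ := ℓ))
  beta_reduce at h
  have h0 : (vecMulVec (genericJ n ℓ) (genericI n ℓ)).map (restrictedGerm hz) = 0 := by
    ext1 r s
    rw [Matrix.map_apply, vecMulVec_apply, map_mul, restrictedGerm_genericI (hw := hw) hz, mul_zero]
    rfl
  rw [h0] at h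
  rw [← h]
  ext1 r s
  simp only [Matrix.map_apply, Matrix.sum_apply, map_sum, Matrix.sub_apply, map_sub, Matrix.mul_apply,
    map_mul, localLetters]

/-- The covector `i` is zero along the central fibre, so the matrix entries and `j` alone generate;
this matches the generators in `entrySet`. -/
theorem restrictedGerm_mem_adjoin {z : Z} (hz : z.1 ∈ chartSet ws) (φ : coordinateRing n ℓ) :
    restrictedGerm hz φ ∈ Algebra.adjoin ℂ (entrySet (localLetters hz) (localJ hz)) := by
  let S : Subalgebra ℂ (MomentZero n ℓ → ℂ) :=
    ((Algebra.adjoin ℂ (entrySet (localLetters hz) (localJ hz))).comap (restrictedGerm hz)).map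
      (coordinateRing n ℓ).val
  have hlet : ∀ c, EntriesIn S fun x : MomentZero n ℓ => letters x.1 c := fun c r s =>
    ⟨genericLetters n ℓ c r s, Algebra.subset_adjoin (.inl ⟨(c, r, s), rfl⟩), rfl⟩
  obtain ⟨ψ, hψ, hψφ⟩ : φ.1 ∈ S := comp_mem_of_mem_coordinateRing (F := id) (fun k => hlet (.inl k))
    (fun k => hlet (.inr k)) (fun r => ⟨genericI n ℓ r, by
      change restrictedGerm hz (genericI n ℓ r) ∈
        Algebra.adjoin ℂ (entrySet (localLetters hz) (localJ hz))
      rw [restrictedGerm_genericI (hw := hw) hz]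
      exact zero_mem _, rfl⟩)
    (fun r => ⟨genericJ n ℓ r, Algebra.subset_adjoin (.inr ⟨r, rfl⟩), rfl⟩) φ.2
  rwa [← show ψ = φ from Subtype.ext hψφ]

theorem exists_mul_mem_adjoin {z : Z} (hz : z.1 ∈ chartSet ws) (s : RegularFunctions.stalk z) :
    ∃ t ∈ Algebra.adjoin ℂ (entrySet (localLetters hz) (localJ hz)), IsUnit t ∧
      s * t ∈ Algebra.adjoin ℂ (entrySet (localLetters hz) (localJ hz)) := by
  obtain ⟨φ, ψ, hu, h⟩ := exists_restrictedGerm_mul hz s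
  exact ⟨_, restrictedGerm_mem_adjoin (hw := hw) hz ψ, hu,
    h ▸ restrictedGerm_mem_adjoin (hw := hw) hz φ⟩

omit hw

/-- The central fibre, and every subvariety of it, is isotropic. -/
theorem isIsotropic_of_subset_centralFiber (hw : Z ⊆ centralFiber n ℓ) {Ω : BilinearField n ℓ}
    (hΩ : IsReducedSymplecticForm Ω) : IsIsotropic Ω Z := by
  rintro z ⟨hfin, hdim⟩ ξ η
  obtain ⟨ws, hz⟩ := exists_mem_chartSet z.1
  have hp : (inclusion Z).toMap z ∈ chartSet ws := hz
  rw [hΩ.eq_chartForm hp, chartForm_apply, omega_eq_tracePairing]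
  have hvel : ∀ ζ : TangentVec z, chartVelocity hp ((inclusion Z).differential z ζ) =
      underlyingVector (ζ.1 ∘ₗ (restrictedGerm hz).toLinearMap) := fun _ => rfl
  -- Since `i` vanishes identically on the fibre, the summand `di ∧ dj` drops out and only the trace
  -- pairing is left.
  have hi : ∀ ζ : TangentVec z,
      (chartVelocity hp ((inclusion Z).differential z ζ)).i = 0 := by
    intro ζ
    rw [hvel, underlyingVector_i]
    funext r
    change ζ.1 (restrictedGerm hz (genericI n ℓ r)) = 0
    rw [restrictedGerm_genericI (hw := hw) hz, map_zero]
  have hlet : ∀ ζ : TangentVec z, letters (chartVelocity hp ((inclusion Z).differential z ζ)) =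
      fun c => (localLetters hz c).map ζ.1 := by
    intro ζ
    funext c
    rw [hvel, letters_underlyingVector]
    rfl
  have := isLocalRing_stalk z
  rw [hi, hi, zero_dotProduct, zero_dotProduct, sub_zero, add_zero, hlet, hlet]
  exact tracePairing_tangent_eq_zero (localLetters hz) (localJ hz)
    (fun w hwl => wordProd_localLetters_eq_zero (hw := hw) hz hwl) (localLetters_moment (hw := hw) hz)
    (exists_mul_mem_adjoin (hw := hw) hz) (stalkValue z) (TangentVec z) (fun _ => Iff.rfl) hdim
    ξ.2 η.2

end SubvarietyStalks

/-! ### The dimension of the central fibre -/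

section UpperBound

variable {n ℓ : ℕ} {Z : Set (QuiverVariety n ℓ)}

/-- The germs of regular functions which vanish on a closed subset. -/
noncomputable def vanishingIdeal (C : Set Z) {z : Z} (hz : z ∈ C) :
    Ideal (RegularFunctions.stalk z) :=
  RingHom.ker ((pullbackGerm (inclusionMap C) ⟨z, hz⟩).comp (RegularFunctions.stalk z).val)

theorem mem_vanishingIdeal {C : Set Z} {z : Z} (hz : z ∈ C) {s : RegularFunctions.stalk z}
    {F : Z → ℂ} (hs : s.1 = F) : s ∈ vanishingIdeal C hz ↔ ∀ᶠ y in 𝓝 z, y ∈ C → F y = 0 := by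
  rw [vanishingIdeal, RingHom.mem_ker]
  change pullbackGerm (inclusionMap C) ⟨z, hz⟩ s.1 = 0 ↔ _
  rw [hs]
  refine Iff.trans (b := ∀ᶠ y : C in 𝓝 ⟨z, hz⟩, F y = 0) Filter.Germ.coe_eq ?_
  exact (eventually_nhds_subtype_iff C ⟨z, hz⟩ fun y => F y = 0).trans eventually_nhdsWithin_iff

theorem exists_semiInvariant_of_mem_isOpen {U : Set Z} (hU : IsOpen U) {z : Z} (hz : z ∈ U) :
    ∃ m, ∃ f ∈ semiInvariants n ℓ m, f z.1.rep ≠ 0 ∧ ∀ y : Z, f y.1.rep ≠ 0 → y ∈ U := by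
  obtain ⟨V, hV, rfl⟩ := isOpen_induced_iff.mp hU
  have hbasis : IsTopologicalBasis
      {U : Set (QuiverVariety n ℓ) | ∃ m, ∃ f ∈ semiInvariants n ℓ m, U = {p | f p.rep ≠ 0}} := by
    refine ⟨?_, ?_, rfl⟩
    · rintro _ ⟨m, f, hf, rfl⟩ _ ⟨m', g, hg, rfl⟩ p ⟨hp, hp'⟩
      exact ⟨_, ⟨m + m', f * g, SetLike.mul_mem_graded hf hg, rfl⟩, mul_ne_zero hp hp',
        fun q hq => ⟨left_ne_zero_of_mul hq, right_ne_zero_of_mul hq⟩⟩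
    · exact Set.eq_univ_of_forall fun p => Set.mem_sUnion.mpr
        ⟨_, ⟨0, 1, SetLike.GradedOne.one_mem, rfl⟩, one_ne_zero⟩
  obtain ⟨_, ⟨m, f, hf, rfl⟩, h1, h2⟩ := hbasis.exists_subset_of_mem_open hz hV
  exact ⟨m, f, hf, h1, fun y hy => h2 hy⟩

theorem isOpen_ne_zero {m : ℕ} {f : MomentZero n ℓ → ℂ} (hf : f ∈ semiInvariants n ℓ m) :
    IsOpen {y : Z | f y.1.rep ≠ 0} :=
  (isOpen_generateFrom_of_mem ⟨m, f, hf, rfl⟩ : IsOpen {p : QuiverVariety n ℓ | f p.rep ≠ 0}).preimage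
    continuous_subtype_val

/-- A semi-invariant which vanishes on an irreducible set near a point vanishes on it. -/
theorem eq_zero_of_eventually {C : Set Z} (hC : IsIrreducible C) {z : Z} (hz : z ∈ C) {m : ℕ}
    {f : MomentZero n ℓ → ℂ} (hf : f ∈ semiInvariants n ℓ m)
    (h : ∀ᶠ y in 𝓝 z, y ∈ C → f y.1.rep = 0) : ∀ y ∈ C, f y.1.rep = 0 := by
  intro y hy
  by_contra hne
  obtain ⟨U, hU, hUo, hzU⟩ := eventually_nhds_iff.mp h
  obtain ⟨y', hy', h1, h2⟩ := hC.isPreirreducible U {y : Z | f y.1.rep ≠ 0} hUo (isOpen_ne_zero hf)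
    ⟨z, hz, hzU⟩ ⟨y, hy, hne⟩
  exact h2 (hU y' h1 hy')

/-- By irreducibility, vanishing near `z` and vanishing on all of `C` are the same condition on the
numerator. -/
theorem mem_vanishingIdeal_iff {C : Set Z} (hC : IsIrreducible C) {z : Z} (hz : z ∈ C)
    {s : RegularFunctions.stalk z} {m : ℕ} {a b : MomentZero n ℓ → ℂ}
    (ha : a ∈ semiInvariants n ℓ m) (hb : b ∈ semiInvariants n ℓ m) (hbz : b z.1.rep ≠ 0)
    (hs : s.1 = ((fun y => a y.1.rep / b y.1.rep : Z → ℂ) : (𝓝 z).Germ ℂ)) :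
    s ∈ vanishingIdeal C hz ↔ ∀ y ∈ C, a y.1.rep = 0 := by
  rw [mem_vanishingIdeal hz hs]
  constructor
  · intro h
    refine eq_zero_of_eventually hC hz ha ?_
    filter_upwards [h, (isOpen_ne_zero hb).mem_nhds hbz] with y hy hby hyC
    exact (div_eq_zero_iff.mp (hy hyC)).resolve_right hby
  · exact fun h => Eventually.of_forall fun y hy => by rw [h y hy, zero_div]

theorem exists_ratio {z : Z} (s : RegularFunctions.stalk z) :
    ∃ m, ∃ a ∈ semiInvariants n ℓ m, ∃ b ∈ semiInvariants n ℓ m, b z.1.rep ≠ 0 ∧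
      s.1 = ((fun y => a y.1.rep / b y.1.rep : Z → ℂ) : (𝓝 z).Germ ℂ) := by
  obtain ⟨_, _, ⟨m, a, ha, b, hb, hbz, rfl⟩, rfl⟩ := s
  exact ⟨m, a, ha, b, hb, hbz, rfl⟩

theorem vanishingIdeal_isPrime {C : Set Z} (hC : IsIrreducible C) {z : Z} (hz : z ∈ C) :
    (vanishingIdeal C hz).IsPrime := by
  refine ⟨fun h => ?_, fun {s t} hst => ?_⟩
  · have h1 := (Ideal.eq_top_iff_one _).mp h
    rw [mem_vanishingIdeal hz (F := fun _ => 1) rfl] at h1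
    exact one_ne_zero (h1.self_of_nhds hz)
  · obtain ⟨m, a, ha, b, hb, hbz, hs⟩ := exists_ratio s
    obtain ⟨m', a', ha', b', hb', hbz', ht⟩ := exists_ratio t
    rw [mem_vanishingIdeal_iff hC hz (SetLike.mul_mem_graded ha ha') (SetLike.mul_mem_graded hb hb')
      (mul_ne_zero hbz hbz') (by
        rw [MulMemClass.coe_mul, hs, ht, ← Filter.Germ.coe_mul]
        refine congrArg _ (funext fun y => ?_)
        exact div_mul_div_comm _ _ _ _)] at hst
    rw [mem_vanishingIdeal_iff hC hz ha hb hbz hs, mem_vanishingIdeal_iff hC hz ha' hb' hbz' ht]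
    by_contra! hcon
    obtain ⟨⟨y, hy, hne⟩, ⟨y', hy', hne'⟩⟩ := hcon
    obtain ⟨q, hq, h1, h2⟩ := hC.isPreirreducible _ _ (isOpen_ne_zero ha) (isOpen_ne_zero ha')
      ⟨y, hy, hne⟩ ⟨y', hy', hne'⟩
    exact mul_ne_zero h1 h2 (hst q hq)

/-- For strictness, separate a point of `C' \ C` from `C` by a semi-invariant, and divide it by a
power of a frame determinant that is nonzero at `z` to obtain a germ. -/
theorem vanishingIdeal_lt {C C' : Set Z} (hC : IsIrreducible C) (hC' : IsIrreducible C')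
    (hcl : IsClosed C) (hlt : C ⊂ C') {z : Z} (hz : z ∈ C) :
    vanishingIdeal C' (hlt.subset hz) < vanishingIdeal C hz := by
  refine lt_of_le_of_ne (fun s hs => ?_) fun heq => ?_
  · obtain ⟨m, a, ha, b, hb, hbz, hs'⟩ := exists_ratio s
    rw [mem_vanishingIdeal_iff hC' _ ha hb hbz hs'] at hs
    rw [mem_vanishingIdeal_iff hC _ ha hb hbz hs']
    exact fun y hy => hs y (hlt.subset hy)
  · obtain ⟨y, hy, hyC⟩ := Set.exists_of_ssubset hlt
    obtain ⟨m, a, ha, hay, haC⟩ := exists_semiInvariant_of_mem_isOpen hcl.isOpen_compl hyC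
    obtain ⟨ws, hzw⟩ := exists_mem_chartSet z.1
    have hb : (fun x : MomentZero n ℓ => (frame ws x.1).det ^ m) ∈ semiInvariants n ℓ m := by
      have := SetLike.pow_mem_graded m (det_frame_mem (ℓ := ℓ) ws)
      rw [smul_eq_mul, mul_one] at this
      exact this
    have hbz := pow_ne_zero m hzw
    let s : RegularFunctions.stalk z := ⟨_, _, ⟨m, a, ha, _, hb, hbz, rfl⟩, rfl⟩
    have h1 : s ∈ vanishingIdeal C hz := by
      rw [mem_vanishingIdeal_iff hC hz ha hb hbz rfl]
      intro q hq
      by_contra h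
      exact haC q h hq
    rw [← heq, mem_vanishingIdeal_iff hC' _ ha hb hbz rfl] at h1
    exact hay (h1 y hy)

/-- The dimension of the central fibre is at most `(n - 1) ((ℓ - 1) n + 1)`. -/
theorem topologicalKrullDim_centralFiber_le (hn : 0 < n) (hℓ : 0 < ℓ) {d : ℕ}
    (hd : ((d : ℕ) : WithBot ℕ∞) ≤ topologicalKrullDim (centralFiber n ℓ)) :
    d + n ^ 2 + 1 ≤ ℓ * (n ^ 2 - n) + 2 * n := by
  obtain ⟨p, rfl⟩ := Order.le_krullDim_iff.mp hd
  -- A point of the smallest member lies in all of them, so the whole chain is visible, in reversed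
  -- order, as primes of one local ring.
  obtain ⟨z, hz0⟩ := (p 0).isIrreducible'.nonempty
  have hz : ∀ a, z ∈ (p a).carrier := fun a => p.monotone (Fin.zero_le a) hz0
  obtain ⟨ws, hzw⟩ := exists_mem_chartSet z.1
  let P : Fin (p.length + 1) → PrimeSpectrum (RegularFunctions.stalk z) := fun a =>
    ⟨vanishingIdeal (p a.rev).carrier (hz _), vanishingIdeal_isPrime (p a.rev).isIrreducible' _⟩
  have hP : StrictMono P := by
    intro a b hab
    have h1 : p b.rev < p a.rev := p.strictMono (Fin.rev_lt_rev.mpr hab)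
    exact vanishingIdeal_lt (p b.rev).isIrreducible' (p a.rev).isIrreducible' (p b.rev).isClosed' h1
      (hz _)
  have hw : centralFiber n ℓ ⊆ centralFiber n ℓ := le_rfl
  exact length_primes_le hn hℓ (localLetters hzw) (localJ hzw)
    (fun w hwl => wordProd_localLetters_eq_zero (hw := hw) hzw hwl)
    (localLetters_moment (hw := hw) hzw) ws (localFrame_eq_one hzw)
    (exists_mul_mem_adjoin (hw := hw) hzw) P hP

end UpperBound

end BouquetQuiver

namespace BouquetQuiver

open Matrix Filter Topology TopologicalSpace

/-! ### Linear families in topological spaces -/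

section LinearFamilies

variable {V : Type*} [AddCommGroup V] [Module ℂ V]

/-- The polynomial functions on a vector space. -/
def polynomialFunctions (V : Type*) [AddCommGroup V] [Module ℂ V] : Subalgebra ℂ (V → ℂ) :=
  Algebra.adjoin ℂ {f | ∃ φ : Module.Dual ℂ V, f = φ}

theorem dual_mem_polynomialFunctions (φ : Module.Dual ℂ V) : ⇑φ ∈ polynomialFunctions V :=
  Algebra.subset_adjoin ⟨φ, rfl⟩

theorem exists_polynomial_on_line {p : V → ℂ} (hp : p ∈ polynomialFunctions V) (a b : V) :
    ∃ P : Polynomial ℂ, ∀ t : ℂ, p (a + t • b) = P.eval t := by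
  induction hp using Algebra.adjoin_induction with
  | mem p hp =>
    obtain ⟨φ, rfl⟩ := hp
    refine ⟨Polynomial.C (φ a) + Polynomial.X * Polynomial.C (φ b), fun t => ?_⟩
    simp
    ring
  | algebraMap r => exact ⟨Polynomial.C r, fun t => by simp⟩
  | add p q _ _ hp hq =>
    obtain ⟨P, hP⟩ := hp
    obtain ⟨Q, hQ⟩ := hq
    exact ⟨P + Q, fun t => by simp [hP, hQ]⟩
  | mul p q _ _ hp hq =>
    obtain ⟨P, hP⟩ := hp
    obtain ⟨Q, hQ⟩ := hq
    exact ⟨P * Q, fun t => by simp [hP, hQ]⟩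

/-- On the line through `a` and `b` both functions are nonzero polynomials in one variable, hence so
is their product. This is the irreducibility of linear subspaces. -/
theorem exists_ne_zero_of_submodule {p q : V → ℂ} (hp : p ∈ polynomialFunctions V)
    (hq : q ∈ polynomialFunctions V) {L : Submodule ℂ V} {a b : V} (ha : a ∈ L) (hb : b ∈ L)
    (hpa : p a ≠ 0) (hqb : q b ≠ 0) : ∃ c ∈ L, p c ≠ 0 ∧ q c ≠ 0 := by
  obtain ⟨P, hP⟩ := exists_polynomial_on_line hp a (b - a)
  obtain ⟨Q, hQ⟩ := exists_polynomial_on_line hq a (b - a)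
  have hP0 : P ≠ 0 := by
    rintro rfl
    have := hP 0
    rw [zero_smul, add_zero, Polynomial.eval_zero] at this
    exact hpa this
  have hQ0 : Q ≠ 0 := by
    rintro rfl
    have := hQ 1
    rw [one_smul, add_sub_cancel, Polynomial.eval_zero] at this
    exact hqb this
  obtain ⟨t, ht⟩ : ∃ t, (P * Q).eval t ≠ 0 := by
    by_contra! h
    exact mul_ne_zero hP0 hQ0 (Polynomial.funext fun t => by rw [h, Polynomial.eval_zero])
  rw [Polynomial.eval_mul] at ht
  refine ⟨a + t • (b - a), L.add_mem ha (L.smul_mem t (L.sub_mem hb ha)), ?_, ?_⟩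
  · rw [hP]
    exact left_ne_zero_of_mul ht
  · rw [hQ]
    exact right_ne_zero_of_mul ht

/-- The dimension of a space is at least the dimension of a vector space whose Zariski topology it
induces. -/
theorem finrank_le_topologicalKrullDim [Module.Finite ℂ V] {X : Type*} [TopologicalSpace X]
    (f : V → X)
    (h1 : ∀ U : Set X, IsOpen U → ∀ v, f v ∈ U →
      ∃ p ∈ polynomialFunctions V, p v ≠ 0 ∧ ∀ w, p w ≠ 0 → f w ∈ U)
    (h2 : ∀ (φ : Module.Dual ℂ V) (v : V), φ v ≠ 0 →
      ∃ U : Set X, IsOpen U ∧ f v ∈ U ∧ ∀ w, f w ∈ U → φ w ≠ 0) :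
    ((Module.finrank ℂ V : ℕ) : WithBot ℕ∞) ≤ topologicalKrullDim X := by
  let : TopologicalSpace V := induced f inferInstance
  have hind : IsInducing f := ⟨rfl⟩
  have hirr : ∀ L : Submodule ℂ V, IsIrreducible (L : Set V) := by
    intro L
    refine ⟨⟨0, L.zero_mem⟩, ?_⟩
    rintro U U' hU hU' ⟨a, ha, haU⟩ ⟨b, hb, hbU⟩
    obtain ⟨U, hUo, rfl⟩ := hind.isOpen_iff.mp hU
    obtain ⟨U', hUo', rfl⟩ := hind.isOpen_iff.mp hU'
    obtain ⟨p, hp, hpa, hpU⟩ := h1 U hUo a haU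
    obtain ⟨q, hq, hqb, hqU⟩ := h1 U' hUo' b hbU
    obtain ⟨c, hc, h3, h4⟩ := exists_ne_zero_of_submodule hp hq ha hb hpa hqb
    exact ⟨c, hc, hpU c h3, hqU c h4⟩
  have hcl : ∀ L : Submodule ℂ V, IsClosed (L : Set V) := by
    intro L
    rw [← isOpen_compl_iff, isOpen_iff_mem_nhds]
    intro v hv
    obtain ⟨φ, hφv, hφL⟩ := Submodule.exists_le_ker_of_notMem hv
    obtain ⟨U, hU, hvU, hUφ⟩ := h2 φ v hφv
    exact mem_of_superset ((hU.preimage hind.continuous).mem_nhds hvU) fun w hw hwL =>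
      hUφ w hw (hφL hwL)
  refine le_trans ?_ hind.topologicalKrullDim_le
  -- Linear subspaces are irreducible and closed for the induced topology, so a complete flag is a
  -- chain of length equal to the dimension.
  have h3 := Order.krullDim_le_of_strictMono
    (fun L : Submodule ℂ V => (⟨L, hirr L, hcl L⟩ : IrreducibleCloseds V)) fun L L' h => h
  rw [← Module.coe_length, Module.length_eq_finrank] at h3
  exact h3

end LinearFamilies

/-! ### A family of large dimension -/

section Family

variable {n m : ℕ}

/-- Traceless matrices. -/
abbrev tracelessMatrices (n : ℕ) : Submodule ℂ (Matrix (Fin n) (Fin n) ℂ) :=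
  LinearMap.ker (traceLinearMap (Fin n) ℂ ℂ)

theorem finrank_tracelessMatrices (hn : 0 < n) :
    Module.finrank ℂ (tracelessMatrices n) + 1 = n ^ 2 := by
  have h := LinearMap.finrank_range_add_finrank_ker (traceLinearMap (Fin n) ℂ ℂ)
  have hr : LinearMap.range (traceLinearMap (Fin n) ℂ ℂ) = ⊤ := by
    refine LinearMap.range_eq_top.mpr fun c => ⟨Matrix.single ⟨0, hn⟩ ⟨0, hn⟩ c, ?_⟩
    rw [traceLinearMap_apply, trace_single_eq_same]
  rw [hr, finrank_top, Module.finrank_self, Module.finrank_matrix, Module.finrank_self,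
    Fintype.card_fin] at h
  rw [add_comm, h]
  ring

/-- The parameters of the family. -/
abbrev FamilyParameters (n m : ℕ) : Type :=
  ((Fin m → tracelessMatrices n) × (Fin m → tracelessMatrices n)) × ℂ

theorem finrank_familyParameters (hn : 0 < n) :
    Module.finrank ℂ (FamilyParameters n m) = 2 * (m * (n ^ 2 - 1)) + 1 := by
  have h := finrank_tracelessMatrices hn
  have h' : Module.finrank ℂ (tracelessMatrices n) = n ^ 2 - 1 := by omega
  rw [Module.finrank_prod, Module.finrank_prod, Module.finrank_pi_fintype, Module.finrank_self]
  simp only [h', Finset.sum_const, Finset.card_univ, Fintype.card_fin, smul_eq_mul]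
  ring

/-- Distinct numbers with sum zero. -/
def spacing (n : ℕ) (r : Fin n) : ℂ := 2 * (r : ℕ) - ((n : ℂ) - 1)

theorem spacing_injective (n : ℕ) : Function.Injective (spacing n) := by
  intro r s h
  have h1 : (2 : ℂ) * (r : ℕ) = 2 * (s : ℕ) := sub_left_injective h
  exact Fin.ext (Nat.cast_injective (mul_left_cancel₀ two_ne_zero h1))

theorem sum_spacing (n : ℕ) : ∑ r, spacing n r = 0 := by
  have h : ∀ k : ℕ, ∑ r ∈ Finset.range k, (2 * (r : ℂ) - ((n : ℂ) - 1)) = k * (k - n) := by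
    intro k
    induction k with
    | zero => simp
    | succ k ih =>
      rw [Finset.sum_range_succ, ih]
      push_cast
      ring
  have h1 := Fin.sum_univ_eq_sum_range (fun r : ℕ => (2 * (r : ℂ) - ((n : ℂ) - 1))) n
  exact h1.trans ((h n).trans (by rw [sub_self, mul_zero]))

/-- The sum of the commutators of the free matrices. -/
def familyCommutator (v : FamilyParameters n m) : Matrix (Fin n) (Fin n) ℂ :=
  ∑ k, ((v.1.1 k).1 * (v.1.2 k).1 - (v.1.2 k).1 * (v.1.1 k).1)

/-- The matrix which is paired with a diagonal matrix. -/
noncomputable def familyMatrix (v : FamilyParameters n m) : Matrix (Fin n) (Fin n) ℂ :=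
  of fun r s => (familyCommutator v s s - familyCommutator v r s) * (spacing n r - spacing n s)⁻¹ +
    v.2 * (Matrix.diagonal (spacing n)) r s

/-- A family of representations with `X_1` a fixed diagonal matrix and `j = (1, …, 1)`. -/
noncomputable def familyRep (v : FamilyParameters n m) : Rep n (m + 1) :=
  (Fin.cons (Matrix.diagonal (spacing n)) fun k => (v.1.1 k).1,
    Fin.cons (familyMatrix v) fun k => (v.1.2 k).1, fun s => familyCommutator v s s, fun _ => 1)

theorem familyRep_mem (v : FamilyParameters n m) : familyRep v ∈ cotangentBar n (m + 1) := by
  constructor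
  · intro k
    refine Fin.cases ?_ (fun k => ?_) k
    · change (Matrix.diagonal (spacing n)).trace = 0
      rw [trace_diagonal, sum_spacing]
    · exact (v.1.1 k).2
  · intro k
    refine Fin.cases ?_ (fun k => ?_) k
    · change (familyMatrix v).trace = 0
      have : ∀ r, familyMatrix v r r = v.2 * spacing n r := by
        intro r
        simp [familyMatrix]
      simp only [Matrix.trace, diag_apply, this, ← Finset.mul_sum, sum_spacing, mul_zero]
    · exact (v.1.2 k).2

/-- With `D` diagonal, `[D, Y_1]_{rs} = (d_r - d_s) Y_{1,rs}` must equal `i_s - C_{rs}`, where `C`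
is the sum of the other commutators. The diagonal forces `i_s = C_{ss}`, the off-diagonal entries of
`Y_1` are solved for, and its diagonal is free. -/
theorem familyRep_moment (v : FamilyParameters n m) : moment (familyRep v) = 0 := by
  have h1 : moment (familyRep v) = (Matrix.diagonal (spacing n) * familyMatrix v -
      familyMatrix v * Matrix.diagonal (spacing n)) + familyCommutator v -
      vecMulVec (fun _ => 1) (fun s => familyCommutator v s s) := by
    rw [moment, Fin.sum_univ_succ]
    rfl
  rw [h1]
  ext r s
  rw [Matrix.sub_apply, Matrix.add_apply, Matrix.sub_apply, diagonal_mul, mul_diagonal,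
    vecMulVec_apply, one_mul, Matrix.zero_apply]
  by_cases hrs : r = s
  · subst hrs
    ring
  · have hne : spacing n r - spacing n s ≠ 0 := sub_ne_zero.mpr ((spacing_injective n).ne hrs)
    have : (spacing n r - spacing n s) * familyMatrix v r s =
        familyCommutator v s s - familyCommutator v r s := by
      simp only [familyMatrix, of_apply, Matrix.diagonal_apply_ne _ hrs, mul_zero, add_zero]
      rw [mul_comm, mul_assoc, inv_mul_cancel₀ hne, mul_one]
    linear_combination this

noncomputable def familyPoint (v : FamilyParameters n m) : MomentZero n (m + 1) :=
  ⟨familyRep v, familyRep_mem v, familyRep_moment v⟩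

def familyWords (n m : ℕ) (a : Fin n) : List (Fin (m + 1) ⊕ Fin (m + 1)) :=
  List.replicate a (.inl 0)

/-- The words are powers of the diagonal matrix and `j = (1, …, 1)`, so the frame does not depend on
the parameters. -/
theorem frame_familyRep (v : FamilyParameters n m) :
    frame (familyWords n m) (familyRep v) = vandermonde (spacing n) := by
  ext r a
  have h1 : wordProd (letters (familyRep v)) (familyWords n m a) =
      Matrix.diagonal (spacing n ^ (a : ℕ)) := by
    rw [wordProd, familyWords, List.map_replicate, List.prod_replicate, ← diagonal_pow]
    rfl
  change (wordProd (letters (familyRep v)) (familyWords n m a) *ᵥ fun _ => 1) r = _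
  rw [h1, mulVec_diagonal, mul_one]
  rfl

theorem det_frame_familyRep (v : FamilyParameters n m) :
    (frame (familyWords n m) (familyPoint v).1).det ≠ 0 := by
  change (frame (familyWords n m) (familyRep v)).det ≠ 0
  rw [frame_familyRep, det_vandermonde_ne_zero_iff]
  exact spacing_injective n

theorem comp_familyPoint_mem {f : MomentZero n (m + 1) → ℂ} (hf : f ∈ coordinateRing n (m + 1)) :
    (fun v => f (familyPoint v)) ∈ polynomialFunctions (FamilyParameters n m) := by
  have hX : ∀ k, EntriesIn (polynomialFunctions (FamilyParameters n m)) fun v => (v.1.1 k).1 :=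
    fun k r s => dual_mem_polynomialFunctions
      ⟨⟨fun v : FamilyParameters n m => (v.1.1 k).1 r s, fun _ _ => rfl⟩, fun _ _ => rfl⟩
  have hY : ∀ k, EntriesIn (polynomialFunctions (FamilyParameters n m)) fun v => (v.1.2 k).1 :=
    fun k r s => dual_mem_polynomialFunctions
      ⟨⟨fun v : FamilyParameters n m => (v.1.2 k).1 r s, fun _ _ => rfl⟩, fun _ _ => rfl⟩
  have ht : (fun v => v.2) ∈ polynomialFunctions (FamilyParameters n m) :=
    dual_mem_polynomialFunctions ⟨⟨fun v : FamilyParameters n m => v.2, fun _ _ => rfl⟩,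
      fun _ _ => rfl⟩
  have hR : EntriesIn (polynomialFunctions (FamilyParameters n m)) familyCommutator :=
    EntriesIn.sum _ fun k _ => ((hX k).mul (hY k)).sub ((hY k).mul (hX k))
  refine comp_mem_of_mem_coordinateRing (fun k => ?_) (fun k => ?_) (fun s => hR s s)
    (fun s => Subalgebra.algebraMap_mem _ 1) hf
  · refine Fin.cases ?_ (fun k => ?_) k
    · exact EntriesIn.const _
    · exact hX k
  · refine Fin.cases ?_ (fun k => ?_) k
    · exact fun r s => add_mem (mul_mem (sub_mem (hR s s) (hR r s))
        (Subalgebra.algebraMap_mem _ _)) (mul_mem ht (Subalgebra.algebraMap_mem _ _))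
    · exact hY k

/-- A linear section of the parametrization. -/
theorem exists_dual_familyRep (hn : 1 < n) (φ : Module.Dual ℂ (FamilyParameters n m)) :
    ∃ ψ : Module.Dual ℂ (Rep n (m + 1)), ∀ v, ψ (familyRep v) = φ v := by
  let ι : FamilyParameters n m →ₗ[ℂ]
      ((Fin m → Matrix (Fin n) (Fin n) ℂ) × (Fin m → Matrix (Fin n) (Fin n) ℂ)) × ℂ :=
    ⟨⟨fun v => ((fun k => (v.1.1 k).1, fun k => (v.1.2 k).1), v.2), fun _ _ => rfl⟩, fun _ _ => rfl⟩
  have hι : Function.Injective ι := by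
    rintro ⟨⟨X, Y⟩, t⟩ ⟨⟨X', Y'⟩, t'⟩ h
    simp only [ι, LinearMap.coe_mk, AddHom.coe_mk, Prod.mk.injEq] at h
    obtain ⟨⟨h1, h2⟩, rfl⟩ := h
    rw [show X = X' from funext fun k => Subtype.ext (congrFun h1 k),
      show Y = Y' from funext fun k => Subtype.ext (congrFun h2 k)]
  obtain ⟨χ, rfl⟩ := LinearMap.dualMap_surjective_of_injective hι φ
  -- The scalar parameter is read off from a diagonal entry of `Y_1`, which needs a nonzero spacing;
  -- `1 - n ≠ 0` because `n > 1`.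
  let z : Fin n := ⟨0, by omega⟩
  have hz : spacing n z ≠ 0 := by
    have : spacing n z = 1 - (n : ℂ) := by
      simp only [spacing, z]
      push_cast
      ring
    rw [this, sub_ne_zero]
    exact_mod_cast hn.ne
  let pr : Rep n (m + 1) →ₗ[ℂ]
      ((Fin m → Matrix (Fin n) (Fin n) ℂ) × (Fin m → Matrix (Fin n) (Fin n) ℂ)) × ℂ :=
    { toFun := fun x => ((fun k => x.X k.succ, fun k => x.Y k.succ), (spacing n z)⁻¹ * x.Y 0 z z)
      map_add' := fun x y => Prod.ext rfl (mul_add _ _ _)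
      map_smul' := fun a x => Prod.ext rfl (mul_left_comm _ _ _) }
  refine ⟨χ ∘ₗ pr, fun v => congrArg χ (Prod.ext rfl ?_)⟩
  change (spacing n z)⁻¹ * familyMatrix v z z = v.2
  simp only [familyMatrix, of_apply, sub_self, zero_mul, zero_add, Matrix.diagonal_apply_eq]
  rw [mul_comm, mul_assoc, mul_inv_cancel₀ hz, mul_one]

/-- The dimension of the quiver variety is larger than `2 (ℓ - 1) (n² - 1)`. -/
theorem le_topologicalKrullDim_quiverVariety (hn : 1 < n) :
    ((2 * (m * (n ^ 2 - 1)) + 1 : ℕ) : WithBot ℕ∞) ≤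
      topologicalKrullDim (QuiverVariety n (m + 1)) := by
  rw [← finrank_familyParameters (m := m) (by omega)]
  let s : FamilyParameters n m → semistable n (m + 1) := fun v =>
    ⟨familyPoint v, mem_semistable_of_det_frame_ne_zero (det_frame_familyRep v)⟩
  have hrep : ∀ {d : ℕ} {f : MomentZero n (m + 1) → ℂ}, f ∈ semiInvariants n (m + 1) d →
      ∀ v, f ((quotientMap n (m + 1)).toMap (s v)).rep = 0 ↔ f (familyPoint v) = 0 :=
    fun hf v => rep_mk_rel (s v) _ _ hf
  refine finrank_le_topologicalKrullDim (fun v => (quotientMap n (m + 1)).toMap (s v)) ?_ ?_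
  · intro U hU v hv
    have hU' : IsOpen (Subtype.val ⁻¹' U : Set (Set.univ : Set (QuiverVariety n (m + 1)))) :=
      hU.preimage continuous_subtype_val
    obtain ⟨d, f, hf, h1, h2⟩ := exists_semiInvariant_of_mem_isOpen hU'
      (z := ⟨(quotientMap n (m + 1)).toMap (s v), trivial⟩) hv
    refine ⟨_, comp_familyPoint_mem hf.1, (hrep hf v).not.mp h1, fun w hw => ?_⟩
    exact h2 ⟨(quotientMap n (m + 1)).toMap (s w), trivial⟩ ((hrep hf w).not.mpr hw)
  · intro φ v hv
    obtain ⟨ψ, hψ⟩ := exists_dual_familyRep hn φ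
    obtain ⟨g, hg, -⟩ := normalize_eq_act (det_frame_familyRep v)
    have hψg : (fun x : MomentZero n (m + 1) => ψ (act g x.1)) ∈ coordinateRing n (m + 1) :=
      dual_rep_comp_mem (F := fun x : MomentZero n (m + 1) => act g x.1)
        (fun k => ((EntriesIn.const _).mul (entriesIn_letters (.inl k))).mul (EntriesIn.const _))
        (fun k => ((EntriesIn.const _).mul (entriesIn_letters (.inr k))).mul (EntriesIn.const _))
        (coordsIn_i.vecMul (EntriesIn.const _)) ((EntriesIn.const _).mulVec coordsIn_j) ψ
    obtain ⟨d, A, hA, hA'⟩ := exists_semiInvariant_normalize (familyWords n m) hψg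
    have hval : ∀ w, φ w * (frame (familyWords n m) (familyPoint w).1).det ^ d =
        A (familyPoint w) := by
      intro w
      obtain ⟨g', hg', h⟩ := normalize_eq_act (det_frame_familyRep w)
      -- All members share one frame, so a single `g` undoes the normalization, and the linear
      -- parameters are recovered from semi-invariants.
      have hgg : g' = g := Units.ext (hg'.trans (((frame_familyRep w).trans
        (frame_familyRep v).symm).trans hg.symm))
      rw [← hA' _ (det_frame_familyRep w), h, hgg]
      congr 1
      change _ = ψ (act g (act g⁻¹ (familyRep w)))
      rw [← act_mul, mul_inv_cancel, act_one, hψ]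
    refine ⟨{p | A p.rep ≠ 0}, isOpen_generateFrom_of_mem ⟨d, A, hA, rfl⟩, ?_, fun w hw => ?_⟩
    · refine (hrep hA v).not.mpr ?_
      rw [← hval]
      exact mul_ne_zero hv (pow_ne_zero d (det_frame_familyRep v))
    · have := (hrep hA w).not.mp hw
      rw [← hval] at this
      exact left_ne_zero_of_mul this

end Family

end BouquetQuiver

namespace BouquetQuiver

open Matrix Filter Topology TopologicalSpace

/-! ### A point of the central fibre. -/

section Nonempty

variable {n ℓ : ℕ}

/-- Strictly triangular representations with `i = 0` lie over `0`: they are contracted to `0` by a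
one-parameter subgroup. -/
theorem affineQuotientMap_eq_zero_of_strict {x : MomentZero n ℓ} (hi : x.1.i = 0)
    (hx : ∀ c r s, letters x.1 c r s ≠ 0 → s < r) :
    affineQuotientMap x = AffineQuiverVariety.zero n ℓ := by
  refine AlgHom.ext fun f => ?_
  change f.1 x = f.1 (MomentZero.zero n ℓ)
  obtain ⟨F, hF, hFf⟩ := exists_continuous_of_mem_coordinateRing f.2.1
  -- Truncated subtraction is harmless: this is applied only to strictly lower triangular matrices,
  -- whose entries with `r ≤ s` are zero.
  let A : ℂ → Matrix (Fin n) (Fin n) ℂ → Matrix (Fin n) (Fin n) ℂ := fun t X =>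
    of fun r s => t ^ ((r : ℕ) - s) * X r s
  let y : ℂ → Rep n ℓ := fun t =>
    (fun k => A t (x.1.X k), fun k => A t (x.1.Y k), 0, fun r => t ^ ((r : ℕ) + 1) * x.1.j r)
  have hA : ∀ X, Continuous fun t => A t X := fun X =>
    continuous_pi fun r => continuous_pi fun s => (continuous_pow _).mul continuous_const
  have hy : Continuous y :=
    (continuous_pi fun k => hA _).prodMk ((continuous_pi fun k => hA _).prodMk
      (continuous_const.prodMk (continuous_pi fun r => (continuous_pow _).mul continuous_const)))
  -- The shift by one in the exponents also contracts the first coordinate of `j`.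
  let g : ∀ t : ℂ, t ≠ 0 → GL (Fin n) ℂ := fun t ht =>
    ⟨Matrix.diagonal fun r => t ^ ((r : ℕ) + 1), Matrix.diagonal fun r => (t ^ ((r : ℕ) + 1))⁻¹,
      by simp [diagonal_mul_diagonal, ht], by simp [diagonal_mul_diagonal, ht]⟩
  have hlet : ∀ t (ht : t ≠ 0) c,
      (g t ht).1 * letters x.1 c * (g t ht)⁻¹.1 = A t (letters x.1 c) := by
    intro t ht c
    ext r s
    change ((Matrix.diagonal fun r : Fin n => t ^ ((r : ℕ) + 1)) * letters x.1 c *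
      Matrix.diagonal fun r : Fin n => (t ^ ((r : ℕ) + 1))⁻¹) r s = t ^ ((r : ℕ) - s) * letters x.1 c r s
    rw [mul_diagonal, diagonal_mul]
    by_cases h : letters x.1 c r s = 0
    · rw [h]; ring
    · have hsr : (s : ℕ) < r := hx c r s h
      have : t ^ ((r : ℕ) + 1) = t ^ ((r : ℕ) - s) * t ^ ((s : ℕ) + 1) := by
        rw [← pow_add]
        congr 1
        omega
      rw [this]
      field_simp
  have hyg : ∀ t (ht : t ≠ 0), (MomentZero.act (g t ht) x).1 = y t := by
    intro t ht
    refine Prod.ext (funext fun k => hlet t ht (.inl k)) (Prod.ext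
      (funext fun k => hlet t ht (.inr k)) (Prod.ext ?_ ?_))
    · change x.1.i ᵥ* _ = 0
      rw [hi, zero_vecMul]
    · funext r
      change (Matrix.diagonal _ *ᵥ x.1.j) r = _
      rw [mulVec_diagonal]
  have hval : ∀ t : ℂ, t ≠ 0 → F (y t) = f.1 x := by
    intro t ht
    rw [← hyg t ht, ← hFf]
    exact f.2.2 _ _
  have hconst : (fun t => F (y t)) = fun _ => f.1 x :=
    (hF.comp hy).ext_on (dense_compl_singleton (0 : ℂ)) continuous_const fun t ht => hval t ht
  have h0 := congrFun hconst 0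
  have hy0 : y 0 = (MomentZero.zero n ℓ).1 := by
    have h : ∀ c, A 0 (letters x.1 c) = 0 := by
      intro c
      ext r s
      change 0 ^ ((r : ℕ) - s) * letters x.1 c r s = 0
      by_cases h : letters x.1 c r s = 0
      · rw [h, mul_zero]
      · have hsr : (s : ℕ) < r := hx c r s h
        rw [zero_pow (by omega), zero_mul]
    refine Prod.ext (funext fun k => h (.inl k)) (Prod.ext (funext fun k => h (.inr k))
      (Prod.ext rfl (funext fun r => ?_)))
    change 0 ^ ((r : ℕ) + 1) * x.1.j r = 0
    rw [zero_pow (by omega), zero_mul]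
  beta_reduce at h0
  rw [← h0, hy0, hFf]

/-- The lower shift matrix. -/
def shiftMatrix (n : ℕ) : Matrix (Fin n) (Fin n) ℂ :=
  of fun r s => if (r : ℕ) = s + 1 then 1 else 0

/-- One matrix is the full nilpotent Jordan block, the others vanish, and `j` is the first basis
vector. Without such a point the condition on irreducible components would be vacuous. -/
theorem centralFiber_nonempty (hn : 0 < n) (hℓ : 0 < ℓ) : (centralFiber n ℓ).Nonempty := by
  let z : Fin n := ⟨0, hn⟩
  let k₀ : Fin ℓ := ⟨0, hℓ⟩
  let y : Rep n ℓ := (Pi.single k₀ (shiftMatrix n), 0, 0, Pi.single z 1)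
  have hX : ∀ k, y.X k = 0 ∨ y.X k = shiftMatrix n := by
    intro k
    by_cases h : k = k₀
    · right
      rw [h]
      exact Pi.single_eq_same (M := fun _ => Matrix (Fin n) (Fin n) ℂ) k₀ _
    · left
      exact Pi.single_eq_of_ne (M := fun _ => Matrix (Fin n) (Fin n) ℂ) h _
  have htr : (shiftMatrix n).trace = 0 := by
    refine Finset.sum_eq_zero fun r _ => ?_
    simp [shiftMatrix]
  let x : MomentZero n ℓ := ⟨y, ⟨fun k => by rcases hX k with h | h <;> simp [h, htr],
    fun k => trace_zero _ _⟩, by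
      change ∑ k, (y.X k * 0 - 0 * y.X k) - vecMulVec _ 0 = 0
      simp⟩
  have hpow : ∀ a : ℕ, ∀ r : Fin n, (shiftMatrix n ^ a *ᵥ Pi.single z 1) r =
      if (r : ℕ) = a then 1 else 0 := by
    intro a
    induction a with
    | zero =>
      intro r
      rw [pow_zero, one_mulVec, Pi.single_apply]
      congr 1
      exact propext (Fin.ext_iff)
    | succ a ih =>
      intro r
      rw [pow_succ', ← mulVec_mulVec, show shiftMatrix n ^ a *ᵥ Pi.single z 1 =
        fun r : Fin n => if (r : ℕ) = a then 1 else 0 from funext ih]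
      change ∑ b, shiftMatrix n r b * (if (b : ℕ) = a then 1 else 0) = _
      simp only [shiftMatrix, of_apply]
      by_cases h : (r : ℕ) = a + 1
      · rw [Finset.sum_eq_single ⟨a, by omega⟩]
        · simp [h]
        · intro b _ hb
          rw [if_neg (c := (b : ℕ) = a) fun hba => hb (Fin.ext hba), mul_zero]
        · simp
      · rw [if_neg h]
        refine Finset.sum_eq_zero fun b _ => ?_
        by_cases hb : (b : ℕ) = a
        · rw [if_neg (by omega), zero_mul]
        · rw [if_neg hb, mul_zero]
  have hframe : frame (fun a => List.replicate a (.inl k₀)) x.1 = 1 := by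
    ext r a
    have h1 : wordProd (letters y) (List.replicate a (.inl k₀)) = shiftMatrix n ^ (a : ℕ) := by
      rw [wordProd, List.map_replicate, List.prod_replicate]
      congr 1
    change (wordProd (letters y) (List.replicate a (.inl k₀)) *ᵥ Pi.single z 1) r = _
    rw [h1, hpow, Matrix.one_apply]
    congr 1
    exact propext Fin.ext_iff.symm
  have hss : x ∈ semistable n ℓ :=
    mem_semistable_of_det_frame_ne_zero (ws := fun a => List.replicate a (.inl k₀))
      (by rw [hframe, det_one]; exact one_ne_zero)
  refine ⟨Quotient.mk (gitSetoid n ℓ) ⟨x, hss⟩, affineQuotientMap_eq_zero_of_strict rfl ?_⟩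
  intro c r s h
  rcases c with k | k
  · change y.X k r s ≠ 0 at h
    rcases hX k with h0 | h0
    · rw [h0] at h
      exact absurd rfl h
    · rw [h0] at h
      have h1 : (r : ℕ) = s + 1 := by
        by_contra hrs
        exact h (if_neg hrs)
      exact Fin.lt_def.mpr (by omega)
  · exact absurd rfl h

end Nonempty

/-! ### Comparison of the two dimensions. -/

section DimensionComparison

variable {n ℓ : ℕ}

theorem krullDim_le_of_forall {α : Type*} [Preorder α] {N : ℕ}
    (h : ∀ d : ℕ, ((d : ℕ) : WithBot ℕ∞) ≤ Order.krullDim α → d ≤ N) :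
    Order.krullDim α ≤ (N : ℕ) :=
  iSup_le fun p => by
    have := h p.length (Order.le_krullDim_iff.mpr ⟨p, rfl⟩)
    exact_mod_cast this

theorem two_mul_topologicalKrullDim_centralFiber_lt (hn : 1 < n) (hℓ : 1 < ℓ) :
    2 * topologicalKrullDim (centralFiber n ℓ) < topologicalKrullDim (QuiverVariety n ℓ) := by
  obtain ⟨m, rfl⟩ : ∃ m, ℓ = m + 1 := ⟨ℓ - 1, by omega⟩
  have hup : topologicalKrullDim (centralFiber n (m + 1)) ≤
      (((m + 1) * (n ^ 2 - n) + 2 * n - (n ^ 2 + 1) : ℕ) : WithBot ℕ∞) :=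
    krullDim_le_of_forall fun d hd => by
      have := topologicalKrullDim_centralFiber_le (by omega) (by omega) hd
      omega
  have hlow := le_topologicalKrullDim_quiverVariety (n := n) (m := m) hn
  have h2 : 2 * topologicalKrullDim (centralFiber n (m + 1)) ≤
      2 * (((m + 1) * (n ^ 2 - n) + 2 * n - (n ^ 2 + 1) : ℕ) : WithBot ℕ∞) := by gcongr
  refine h2.trans_lt (lt_of_lt_of_le ?_ hlow)
  -- Here `m = ℓ - 1`. For `m = 1` the left side equals `2(n² - 1)`, so the extra scalar parameter
  -- of the family is exactly what makes the inequality strict.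
  have key : 2 * ((m + 1) * (n ^ 2 - n) + 2 * n - (n ^ 2 + 1)) < 2 * (m * (n ^ 2 - 1)) + 1 := by
    obtain ⟨k, rfl⟩ : ∃ k, n = k + 2 := ⟨n - 2, by omega⟩
    obtain ⟨l, rfl⟩ : ∃ l, m = l + 1 := ⟨m - 1, by omega⟩
    have e1 : (k + 2) ^ 2 - (k + 2) = k ^ 2 + 3 * k + 2 := by
      rw [Nat.sub_eq_iff_eq_add (by nlinarith)]
      ring
    have e2 : (k + 2) ^ 2 - 1 = k ^ 2 + 4 * k + 3 := by
      rw [Nat.sub_eq_iff_eq_add (by nlinarith)]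
      ring
    rw [e1, e2]
    have e3 : (l + 1 + 1) * (k ^ 2 + 3 * k + 2) + 2 * (k + 2) - ((k + 2) ^ 2 + 1) ≤
        (l + 1) * (k ^ 2 + 4 * k + 3) := by
      rw [Nat.sub_le_iff_le_add]
      nlinarith [Nat.zero_le (l * k)]
    omega
  exact_mod_cast key

/-- The irreducible component of any point has dimension at most that of the fibre, which is already
too small. -/
theorem not_isLagrangian_centralFiber (hn : 1 < n) (hℓ : 1 < ℓ) (Ω : BilinearField n ℓ) :
    ¬ IsLagrangian Ω (centralFiber n ℓ) := by
  rintro ⟨-, h⟩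
  obtain ⟨p, hp⟩ := centralFiber_nonempty (n := n) (ℓ := ℓ) (by omega) (by omega)
  let z : centralFiber n ℓ := ⟨p, hp⟩
  have h1 := h (irreducibleComponent z) (irreducibleComponent_mem_irreducibleComponents z)
  have h2 := two_mul_topologicalKrullDim_centralFiber_lt hn hℓ
  have h3 := topologicalKrullDim_subspace_le (centralFiber n ℓ) (irreducibleComponent z)
  have h4 : 2 * topologicalKrullDim (irreducibleComponent z) ≤
      2 * topologicalKrullDim (centralFiber n ℓ) := by gcongr
  exact absurd (h1 ▸ h4) (not_le.mpr h2)

end DimensionComparison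

end BouquetQuiver

namespace BouquetQuiver

open Matrix Filter Topology TopologicalSpace

/-! ### Homogeneous functions -/

section Homogeneous

variable {N : ℕ}

theorem homogeneousFunctions_smul {m : ℕ} {f : (Fin (N + 1) → ℂ) → ℂ}
    (hf : f ∈ homogeneousFunctions N m) (c : ℂ) (v : Fin (N + 1) → ℂ) : f (c • v) = c ^ m * f v := by
  obtain ⟨F, hF, rfl⟩ := hf
  simp only [MvPolynomial.eval_eq', Finset.mul_sum]
  refine Finset.sum_congr rfl fun d hd => ?_
  have h : ∑ k, d k = m := by
    have := hF (MvPolynomial.mem_support_iff.mp hd)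
    rw [Finsupp.weight_apply, Finsupp.sum_fintype _ _ (by simp)] at this
    simpa using this
  simp only [Pi.smul_apply, smul_eq_mul, mul_pow, Finset.prod_mul_distrib, Finset.prod_pow_eq_pow_sum,
    h]
  ring

/-- The functions given by polynomials. -/
noncomputable def polynomialAlgebra (N : ℕ) : Subalgebra ℂ ((Fin (N + 1) → ℂ) → ℂ) :=
  (MvPolynomial.aeval (fun (k : Fin (N + 1)) (v : Fin (N + 1) → ℂ) => v k)).range

theorem exists_eval_of_mem {f : (Fin (N + 1) → ℂ) → ℂ} (hf : f ∈ polynomialAlgebra N) :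
    ∃ F : MvPolynomial (Fin (N + 1)) ℂ, f = fun v => MvPolynomial.eval v F := by
  obtain ⟨F, rfl⟩ := hf
  refine ⟨F, funext fun v => ?_⟩
  exact (MvPolynomial.comp_aeval_apply _ (Pi.evalAlgHom ℂ (fun _ => ℂ) v) F).trans rfl

theorem coord_mem_polynomialAlgebra (k : Fin (N + 1)) :
    (fun v : Fin (N + 1) → ℂ => v k) ∈ polynomialAlgebra N :=
  ⟨MvPolynomial.X k, MvPolynomial.aeval_X _ k⟩

/-- For fixed `v`, compare `f (c v)` with `c^m f v` as polynomials in `c`: only the component of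
degree `m` survives. -/
theorem mem_homogeneousFunctions {f : (Fin (N + 1) → ℂ) → ℂ} (hf : f ∈ polynomialAlgebra N) {m : ℕ}
    (h : ∀ c : ℂ, c ≠ 0 → ∀ v, f (c • v) = c ^ m * f v) : f ∈ homogeneousFunctions N m := by
  obtain ⟨F, rfl⟩ := exists_eval_of_mem hf
  refine ⟨MvPolynomial.homogeneousComponent m F,
    MvPolynomial.homogeneousComponent_isHomogeneous m F, funext fun v => ?_⟩
  have hsum : ∀ w, MvPolynomial.eval w F = ∑ d ∈ Finset.range (F.totalDegree + 1),
      MvPolynomial.eval w (MvPolynomial.homogeneousComponent d F) := by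
    intro w
    conv_lhs => rw [← MvPolynomial.sum_homogeneousComponent F]
    rw [map_sum]
  let A : Polynomial ℂ := ∑ d ∈ Finset.range (F.totalDegree + 1),
    Polynomial.monomial d (MvPolynomial.eval v (MvPolynomial.homogeneousComponent d F))
  have hA : A = Polynomial.monomial m (MvPolynomial.eval v F) := by
    refine Polynomial.eq_of_infinite_eval_eq _ _ (Set.Infinite.mono (s := {0}ᶜ) ?_
      (Set.finite_singleton 0).infinite_compl)
    intro c hc
    have h1 := h c hc v
    beta_reduce at h1
    rw [hsum] at h1
    change A.eval c = (Polynomial.monomial m _).eval c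
    rw [Polynomial.eval_finsetSum, Polynomial.eval_monomial, mul_comm, ← h1]
    refine Finset.sum_congr rfl fun d _ => ?_
    rw [Polynomial.eval_monomial, mul_comm]
    exact (homogeneousFunctions_smul ⟨_, MvPolynomial.homogeneousComponent_isHomogeneous d F, rfl⟩
      c v).symm
  have h2 := congrArg (fun P => P.coeff m) hA
  beta_reduce at h2
  rw [Polynomial.coeff_monomial_same, Polynomial.finsetSum_coeff] at h2
  rw [← h2]
  simp only [Polynomial.coeff_monomial, Finset.sum_ite_eq', Finset.mem_range]
  split_ifs with hm
  · rfl
  · rw [MvPolynomial.homogeneousComponent_eq_zero _ _ (by omega), map_zero]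

end Homogeneous

/-! ### The central fibre for `n = 2` -/

section Rank2

variable {ℓ : ℕ}

/-- The word list `(1, c)`. -/
def pairWords (c : Fin ℓ ⊕ Fin ℓ) : Fin 2 → List (Fin ℓ ⊕ Fin ℓ) := ![[], [c]]

/-- The semi-invariants `det (j, X_c j)` of weight `θ`. -/
def pairDet (c : Fin ℓ ⊕ Fin ℓ) (x : MomentZero 2 ℓ) : ℂ := (frame (pairWords c) x.1).det

theorem pairDet_mem (c : Fin ℓ ⊕ Fin ℓ) : pairDet c ∈ semiInvariants 2 ℓ 1 :=
  det_frame_mem (pairWords c)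

theorem pairDet_eq (c : Fin ℓ ⊕ Fin ℓ) (x : MomentZero 2 ℓ) :
    pairDet c x = x.1.j 0 * (letters x.1 c *ᵥ x.1.j) 1 - (letters x.1 c *ᵥ x.1.j) 0 * x.1.j 1 := by
  have h0 : ∀ r, frame (pairWords c) x.1 r 0 = x.1.j r := fun r => by
    change (wordProd (letters x.1) [] *ᵥ x.1.j) r = _
    rw [wordProd_nil, one_mulVec]
  have h1 : ∀ r, frame (pairWords c) x.1 r 1 = (letters x.1 c *ᵥ x.1.j) r := fun r => by
    change (wordProd (letters x.1) [c] *ᵥ x.1.j) r = _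
    rw [wordProd_cons, wordProd_nil, Matrix.mul_one]
  rw [pairDet, det_fin_two, h0, h0, h1, h1]

/-- Otherwise every `X_c j` is parallel to `j`, so all words map `j` to vectors parallel to `j` and
no frame is invertible. The cases on `j` avoid dividing by a vanishing coordinate. -/
theorem exists_pairDet_ne_zero {x : MomentZero 2 ℓ} (hx : x ∈ semistable 2 ℓ) :
    ∃ c, pairDet c x ≠ 0 := by
  by_contra! h
  obtain ⟨ws, hws⟩ := exists_det_frame_ne_zero hx
  have hpar : ∀ c, ∀ u : Fin 2 → ℂ, u 0 * x.1.j 1 = x.1.j 0 * u 1 →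
      (letters x.1 c *ᵥ u) 0 * x.1.j 1 = x.1.j 0 * (letters x.1 c *ᵥ u) 1 := by
    intro c u hu
    have h1 := h c
    rw [pairDet_eq] at h1
    simp only [mulVec, dotProduct, Fin.sum_univ_two] at h1 ⊢
    by_cases hj0 : x.1.j 0 = 0
    · by_cases hj1 : x.1.j 1 = 0
      · rw [hj0, hj1]
        ring
      · have hu0 : u 0 = 0 := by
          rw [hj0, zero_mul] at hu
          exact (mul_eq_zero.mp hu).resolve_right hj1
        rw [hj0] at h1 ⊢
        rw [hu0]
        have : letters x.1 c 0 1 = 0 := by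
          have h2 : letters x.1 c 0 1 * (x.1.j 1 * x.1.j 1) = 0 := by linear_combination -h1
          exact (mul_eq_zero.mp h2).resolve_right (mul_ne_zero hj1 hj1)
        rw [this]
        ring
    · refine mul_left_cancel₀ hj0 ?_
      linear_combination (-u 0) * h1 + (letters x.1 c 1 1 * x.1.j 0 - letters x.1 c 0 1 * x.1.j 1) * hu
  have hword : ∀ w : List (Fin ℓ ⊕ Fin ℓ), (wordProd (letters x.1) w *ᵥ x.1.j) 0 * x.1.j 1 =
      x.1.j 0 * (wordProd (letters x.1) w *ᵥ x.1.j) 1 := by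
    intro w
    induction w with
    | nil => rw [wordProd_nil, one_mulVec]
    | cons c w ih =>
      rw [wordProd_cons, ← mulVec_mulVec]
      exact hpar c _ ih
  refine hws ?_
  have h0 := hword (ws 0)
  have h1 := hword (ws 1)
  rw [det_fin_two]
  change (wordProd (letters x.1) (ws 0) *ᵥ x.1.j) 0 * (wordProd (letters x.1) (ws 1) *ᵥ x.1.j) 1 -
    (wordProd (letters x.1) (ws 1) *ᵥ x.1.j) 0 * (wordProd (letters x.1) (ws 0) *ᵥ x.1.j) 1 = 0
  by_cases hj0 : x.1.j 0 = 0
  · by_cases hj1 : x.1.j 1 = 0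
    · have hj : x.1.j = 0 := by
        funext r
        fin_cases r
        · exact hj0
        · exact hj1
      rw [hj, mulVec_zero, mulVec_zero]
      simp
    · rw [hj0, zero_mul] at h0 h1
      rw [(mul_eq_zero.mp h0).resolve_right hj1, (mul_eq_zero.mp h1).resolve_right hj1]
      ring
  · refine mul_left_cancel₀ hj0 ?_
    linear_combination -(wordProd (letters x.1) (ws 0) *ᵥ x.1.j) 0 * h1 +
      (wordProd (letters x.1) (ws 1) *ᵥ x.1.j) 0 * h0

/-- The matrix `E_{21}`. -/
def lowerUnit : Matrix (Fin 2) (Fin 2) ℂ := Matrix.single 1 0 1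

theorem trace_smul_lowerUnit (a : ℂ) : (a • lowerUnit).trace = 0 := by
  rw [trace_smul, lowerUnit, trace_single_eq_of_ne _ _ _ one_ne_zero, smul_zero]

/-- The representation with matrices `v_c E_{21}`, `i = 0` and `j = e_1`. -/
def nilpotentPoint (v : Fin ℓ ⊕ Fin ℓ → ℂ) : MomentZero 2 ℓ :=
  ⟨(fun k => v (.inl k) • lowerUnit, fun k => v (.inr k) • lowerUnit, 0, Pi.single 0 1),
    ⟨fun k => trace_smul_lowerUnit _, fun k => trace_smul_lowerUnit _⟩, by
      simp [moment, mul_comm, Rep.X, Rep.Y, Rep.i, smul_smul]⟩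

theorem letters_nilpotentPoint (v : Fin ℓ ⊕ Fin ℓ → ℂ) (c : Fin ℓ ⊕ Fin ℓ) :
    letters (nilpotentPoint v).1 c = v c • lowerUnit := by
  rcases c with k | k <;> rfl

theorem pairDet_nilpotentPoint (v : Fin ℓ ⊕ Fin ℓ → ℂ) (c : Fin ℓ ⊕ Fin ℓ) :
    pairDet c (nilpotentPoint v) = v c := by
  rw [pairDet_eq, letters_nilpotentPoint]
  change (Pi.single 0 1 : Fin 2 → ℂ) 0 * ((v c • lowerUnit) *ᵥ Pi.single 0 1) 1 -
    ((v c • lowerUnit) *ᵥ Pi.single 0 1) 0 * (Pi.single 0 1 : Fin 2 → ℂ) 1 = v c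
  simp [lowerUnit]

theorem nilpotentPoint_smul {t : ℂ} (ht : t ≠ 0) (v : Fin ℓ ⊕ Fin ℓ → ℂ) :
    ∃ g : GL (Fin 2) ℂ, g.1.det = t ∧
      nilpotentPoint (t • v) = MomentZero.act g (nilpotentPoint v) := by
  let g : GL (Fin 2) ℂ := ⟨Matrix.diagonal ![1, t], Matrix.diagonal ![1, t⁻¹],
    by ext r s; fin_cases r <;> fin_cases s <;> simp [ht],
    by ext r s; fin_cases r <;> fin_cases s <;> simp [ht]⟩
  have hE : ∀ a : ℂ, g.1 * (a • lowerUnit) * g⁻¹.1 = (t * a) • lowerUnit := by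
    intro a
    change Matrix.diagonal ![1, t] * (a • lowerUnit) * Matrix.diagonal ![1, t⁻¹] = _
    ext r s
    rw [mul_diagonal, diagonal_mul]
    fin_cases r <;> fin_cases s <;> simp [lowerUnit]
  refine ⟨g, ?_, Subtype.ext (Prod.ext (funext fun k => (hE _).symm) (Prod.ext
    (funext fun k => (hE _).symm) (Prod.ext ?_ ?_)))⟩
  · change (Matrix.diagonal (![1, t] : Fin 2 → ℂ)).det = t
    simp
  · change (0 : Fin 2 → ℂ) = 0 ᵥ* g⁻¹.1
    rw [zero_vecMul]
  · change (Pi.single 0 1 : Fin 2 → ℂ) = Matrix.diagonal ![1, t] *ᵥ Pi.single 0 1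
    funext r
    rw [mulVec_diagonal]
    fin_cases r <;> simp

theorem nilpotentPoint_mem_semistable {v : Fin ℓ ⊕ Fin ℓ → ℂ} (hv : v ≠ 0) :
    nilpotentPoint v ∈ semistable 2 ℓ := by
  obtain ⟨c, hc⟩ := Function.ne_iff.mp hv
  exact ⟨1, le_rfl, _, pairDet_mem c, by rw [pairDet_nilpotentPoint]; exact hc⟩

theorem affineQuotientMap_nilpotentPoint (v : Fin ℓ ⊕ Fin ℓ → ℂ) :
    affineQuotientMap (nilpotentPoint v) = AffineQuiverVariety.zero 2 ℓ := by
  refine affineQuotientMap_eq_zero_of_strict rfl fun c r s h => ?_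
  rw [letters_nilpotentPoint] at h
  fin_cases r <;> fin_cases s <;> simp [lowerUnit] at h ⊢

/-- Points of the central fibre are represented by `nilpotentPoint`. -/
theorem slicePoint_eq_nilpotentPoint {p : QuiverVariety 2 ℓ} (hp : p ∈ centralFiber 2 ℓ)
    {c : Fin ℓ ⊕ Fin ℓ} (hc : p ∈ chartSet (pairWords c)) :
    slicePoint (pairWords c) p =
      nilpotentPoint fun a => pairDet a (slicePoint (pairWords c) p) := by
  let x := slicePoint (pairWords c) p
  have hframe : frame (pairWords c) x.1 = 1 := frame_slicePoint hc
  have h0 : affineQuotientMap x = AffineQuiverVariety.zero 2 ℓ :=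
    (rho_eq_affineQuotientMap _ p).symm.trans hp
  have hi : x.1.i = 0 := i_eq_zero_of_centralFiber hframe h0
  have hj : x.1.j = Pi.single 0 1 := by
    funext r
    have := congrFun (congrFun hframe r) 0
    change (wordProd (letters x.1) [] *ᵥ x.1.j) r = _ at this
    rw [wordProd_nil, one_mulVec, Matrix.one_apply] at this
    rw [this, Pi.single_apply]
  have hcj : ∀ r, letters x.1 c r 0 = (1 : Matrix (Fin 2) (Fin 2) ℂ) r 1 := by
    intro r
    have := congrFun (congrFun hframe r) 1
    change (wordProd (letters x.1) [c] *ᵥ x.1.j) r = _ at this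
    rw [wordProd_cons, wordProd_nil, Matrix.mul_one, hj, mulVec_single_one] at this
    exact this
  -- In the slice `X_c e_1 = e_2`, and the word `X_a X_c` of length two vanishes, so `X_a e_2 = 0`.
  -- Tracelessness then removes the remaining diagonal entry.
  have hcol : ∀ a r, letters x.1 a r 1 = 0 := by
    intro a r
    have h1 := wordProd_eq_zero_of_centralFiber h0 (w := [a, c]) rfl
    rw [wordProd_cons, wordProd_cons, wordProd_nil, Matrix.mul_one] at h1
    have h2 := congrFun (congrFun h1 r) 0
    rw [Matrix.mul_apply, Fin.sum_univ_two, hcj, hcj] at h2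
    simpa using h2
  have htr : ∀ a, (letters x.1 a).trace = 0 := by
    rintro (k | k)
    · exact x.2.1.1 k
    · exact x.2.1.2 k
  have hdiag : ∀ a, letters x.1 a 0 0 = 0 := by
    intro a
    have := htr a
    rwa [trace_fin_two, hcol a 1, add_zero] at this
  have hdet : ∀ a, pairDet a x = letters x.1 a 1 0 := by
    intro a
    rw [pairDet_eq, hj, mulVec_single_one]
    simp
  have hlet : ∀ a, letters x.1 a = pairDet a x • lowerUnit := by
    intro a
    rw [hdet]
    ext r s
    fin_cases r <;> fin_cases s <;> simp [lowerUnit, hcol, hdiag]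
  exact Subtype.ext (Prod.ext (funext fun k => hlet (.inl k)) (Prod.ext
    (funext fun k => hlet (.inr k)) (Prod.ext hi hj)))

end Rank2

end BouquetQuiver

namespace BouquetQuiver

open Matrix Filter Topology TopologicalSpace

/-! ### The isomorphism with projective space. -/

section ProjectiveSpaceIsomorphism

variable {ℓ N : ℕ}

theorem ProjectiveSpace.exists_coords_mk {v : Fin (N + 1) → ℂ} (hv : v ≠ 0) :
    ∃ t : ℂ, t ≠ 0 ∧ ProjectiveSpace.coords (Projectivization.mk ℂ v hv : ProjectiveSpace N) =
      t • v := by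
  obtain ⟨a, ha⟩ := Projectivization.exists_smul_eq_mk_rep ℂ v hv
  exact ⟨a, a.ne_zero, ha.symm⟩

theorem ProjectiveSpace.coords_ne_zero (p : ProjectiveSpace N) : p.coords ≠ 0 :=
  Projectivization.rep_nonzero p

variable (e : Fin (N + 1) ≃ Fin ℓ ⊕ Fin ℓ)

/-- The vector of the semi-invariants `det (j, X_c j)`. -/
def pairVector (x : MomentZero 2 ℓ) : Fin (N + 1) → ℂ := fun k => pairDet (e k) x

theorem pairVector_ne_zero {x : MomentZero 2 ℓ} (hx : x ∈ semistable 2 ℓ) :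
    pairVector e x ≠ 0 := by
  obtain ⟨c, hc⟩ := exists_pairDet_ne_zero hx
  intro h
  refine hc ?_
  have := congrFun h (e.symm c)
  rwa [pairVector, Equiv.apply_symm_apply] at this

theorem pairVector_act (g : GL (Fin 2) ℂ) (x : MomentZero 2 ℓ) :
    pairVector e (MomentZero.act g x) = g.1.det • pairVector e x := by
  funext k
  change pairDet (e k) _ = g.1.det * pairDet (e k) x
  rw [semiInvariant_act (pairDet_mem (e k)), pow_one]

theorem pairVector_nilpotentPoint (v : Fin (N + 1) → ℂ) :
    pairVector e (nilpotentPoint (v ∘ e.symm)) = v := by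
  funext k
  rw [pairVector, pairDet_nilpotentPoint, Function.comp_apply, Equiv.symm_apply_apply]

theorem pairVector_of_rel {x y : semistable 2 ℓ} (h : (gitSetoid 2 ℓ).r x y) :
    ∃ t : ℂ, t ≠ 0 ∧ pairVector e x.1 = t • pairVector e y.1 := by
  obtain ⟨c, hc⟩ := exists_pairDet_ne_zero x.2
  have hc' : pairDet c y.1 ≠ 0 := (not_congr (h 1 _ (pairDet_mem c))).mp hc
  refine ⟨pairDet c x.1 / pairDet c y.1, div_ne_zero hc hc', funext fun k => ?_⟩
  have h1 := div_eq_div_of_rel h (pairDet_mem (e k)) (pairDet_mem c)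
  change pairDet (e k) x.1 = pairDet c x.1 / pairDet c y.1 * pairDet (e k) y.1
  rw [div_eq_div_iff hc hc'] at h1
  rw [div_mul_eq_mul_div, eq_div_iff hc', h1, mul_comm]

theorem comp_pairVector_mem {m : ℕ} {f : (Fin (N + 1) → ℂ) → ℂ} (hf : f ∈ homogeneousFunctions N m) :
    (fun x => f (pairVector e x)) ∈ semiInvariants 2 ℓ m := by
  refine mem_semiInvariants_iff.mpr ⟨?_, fun g x => ?_⟩
  · obtain ⟨F, hF, rfl⟩ := hf
    simp only [MvPolynomial.eval_eq']
    exact sum_fun_mem _ fun d _ => mul_mem (Subalgebra.algebraMap_mem _ _)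
      (prod_fun_mem _ fun k _ => pow_mem (pairDet_mem (e k)).1 _)
  · rw [pairVector_act, homogeneousFunctions_smul hf]

/-- Rescaling `v` by `t` is the action of a group element of determinant `t`, so the weight of a
semi-invariant becomes the degree of a homogeneous function. -/
theorem comp_nilpotentPoint_mem {m : ℕ} {f : MomentZero 2 ℓ → ℂ} (hf : f ∈ semiInvariants 2 ℓ m) :
    (fun v : Fin (N + 1) → ℂ => f (nilpotentPoint (v ∘ e.symm))) ∈ homogeneousFunctions N m := by
  refine mem_homogeneousFunctions ?_ fun t ht v => ?_
  · have hE : ∀ c : Fin ℓ ⊕ Fin ℓ, EntriesIn (polynomialAlgebra N)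
        fun v : Fin (N + 1) → ℂ => v (e.symm c) • lowerUnit := fun c =>
      EntriesIn.smul (coord_mem_polynomialAlgebra _) (EntriesIn.const _)
    exact comp_mem_of_mem_coordinateRing
      (F := fun v : Fin (N + 1) → ℂ => nilpotentPoint (v ∘ e.symm)) (fun k => hE (.inl k))
      (fun k => hE (.inr k)) (fun r => (polynomialAlgebra N).zero_mem) (fun r => Subalgebra.algebraMap_mem _ _) hf.1
  · obtain ⟨g, hg, h⟩ := nilpotentPoint_smul ht (v ∘ e.symm)
    have : (t • v) ∘ e.symm = t • (v ∘ e.symm) := rfl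
    rw [this, h, semiInvariant_act hf, hg]

/-- The point of the projective space given by the semi-invariants. -/
noncomputable def toProjectiveSpace (p : QuiverVariety 2 ℓ) : ProjectiveSpace N :=
  Projectivization.mk ℂ (pairVector e p.rep) (pairVector_ne_zero e p.rep_mem)

/-- The point of the central fibre given by homogeneous coordinates. -/
noncomputable def ofProjectiveSpace (p : ProjectiveSpace N) : centralFiber 2 ℓ :=
  ⟨Quotient.mk (gitSetoid 2 ℓ) ⟨nilpotentPoint (p.coords ∘ e.symm), nilpotentPoint_mem_semistable
    fun h => p.coords_ne_zero (funext fun k => by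
      have := congrFun h (e k)
      rwa [Function.comp_apply, Equiv.symm_apply_apply] at this)⟩,
    affineQuotientMap_nilpotentPoint _⟩

theorem eval_coords_toProjectiveSpace (p : QuiverVariety 2 ℓ) : ∃ t : ℂ, t ≠ 0 ∧
    ∀ (m : ℕ) (f : (Fin (N + 1) → ℂ) → ℂ), f ∈ homogeneousFunctions N m →
      f (toProjectiveSpace e p).coords = t ^ m * f (pairVector e p.rep) := by
  obtain ⟨t, ht, h⟩ := ProjectiveSpace.exists_coords_mk (pairVector_ne_zero e p.rep_mem)
  refine ⟨t, ht, fun m f hf => ?_⟩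
  rw [← homogeneousFunctions_smul hf, ← h]
  rfl

theorem rep_ofProjectiveSpace_eq_zero (p : ProjectiveSpace N) {m : ℕ} {f : MomentZero 2 ℓ → ℂ}
    (hf : f ∈ semiInvariants 2 ℓ m) :
    f (ofProjectiveSpace e p).1.rep = 0 ↔ f (nilpotentPoint (p.coords ∘ e.symm)) = 0 :=
  rep_mk_rel _ m f hf

theorem div_ofProjectiveSpace (p : ProjectiveSpace N) {m : ℕ} {a b : MomentZero 2 ℓ → ℂ}
    (ha : a ∈ semiInvariants 2 ℓ m) (hb : b ∈ semiInvariants 2 ℓ m) :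
    a (ofProjectiveSpace e p).1.rep / b (ofProjectiveSpace e p).1.rep =
      a (nilpotentPoint (p.coords ∘ e.symm)) / b (nilpotentPoint (p.coords ∘ e.symm)) :=
  div_eq_div_of_rel (rep_mk_rel _) ha hb

theorem to_ofProjectiveSpace (p : ProjectiveSpace N) :
    toProjectiveSpace e (ofProjectiveSpace e p).1 = p := by
  obtain ⟨t, ht, h⟩ := pairVector_of_rel e (rep_mk_rel (ℓ := ℓ) (n := 2)
    ⟨nilpotentPoint (p.coords ∘ e.symm), _⟩)
  rw [pairVector_nilpotentPoint] at h
  conv_rhs => rw [← Projectivization.mk_rep p]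
  exact (Projectivization.mk_eq_mk_iff' ℂ _ _ _ _).mpr ⟨t, h.symm⟩

theorem of_toProjectiveSpace (z : centralFiber 2 ℓ) :
    ofProjectiveSpace e (toProjectiveSpace e z.1) = z := by
  obtain ⟨p, hp⟩ := z
  refine Subtype.ext ?_
  obtain ⟨c, hc⟩ := exists_pairDet_ne_zero p.rep_mem
  obtain ⟨t, ht, h⟩ := ProjectiveSpace.exists_coords_mk (pairVector_ne_zero e p.rep_mem)
  have hslice := slicePoint_eq_nilpotentPoint (c := c) hp hc
  obtain ⟨g, hg⟩ := exists_normalize_eq_act (pairWords c) p.rep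
  have hvec : pairVector e (slicePoint (pairWords c) p) = g.1.det • pairVector e p.rep := by
    rw [slicePoint, hg, pairVector_act]
  have hgdet : g.1.det ≠ 0 := (Matrix.isUnits_det_units g).ne_zero
  -- Two scalars intervene: `t` from the chosen homogeneous coordinates and `det g` from the
  -- normalization. Their combined effect is undone by one group element.
  have hcoords : (toProjectiveSpace e p).coords ∘ e.symm =
      (t * g.1.det⁻¹) • fun a => pairDet a (slicePoint (pairWords c) p) := by
    funext a
    have h1 := congrFun hvec (e.symm a)
    rw [pairVector, Equiv.apply_symm_apply] at h1
    change (toProjectiveSpace e p).coords (e.symm a) = _ * pairDet a _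
    rw [h1]
    change ProjectiveSpace.coords (Projectivization.mk ℂ _ _ : ProjectiveSpace N) (e.symm a) = _
    rw [h, Pi.smul_apply, Pi.smul_apply, smul_eq_mul, smul_eq_mul]
    field_simp
  obtain ⟨g', -, hg'⟩ := nilpotentPoint_smul (mul_ne_zero ht (inv_ne_zero hgdet))
    fun a => pairDet a (slicePoint (pairWords c) p)
  rw [← hslice] at hg'
  refine Eq.trans (Quotient.sound fun m f hf => ?_) (mk_slicePoint (ws := pairWords c) p)
  change f (nilpotentPoint ((toProjectiveSpace e p).coords ∘ e.symm)) = 0 ↔ _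
  rw [hcoords, hg', semiInvariant_act_eq_zero hf]

theorem continuous_toProjectiveSpace :
    Continuous fun z : centralFiber 2 ℓ => toProjectiveSpace e z.1 := by
  refine continuous_generateFrom_iff.mpr ?_
  rintro _ ⟨m, f, hf, rfl⟩
  convert isOpen_ne_zero (Z := centralFiber 2 ℓ) (comp_pairVector_mem e hf) using 1
  ext z
  obtain ⟨t, ht, h⟩ := eval_coords_toProjectiveSpace e z.1
  change f (toProjectiveSpace e z.1).coords ≠ 0 ↔ f (pairVector e z.1.rep) ≠ 0
  rw [h m f hf]
  simp [ht]

theorem continuous_ofProjectiveSpace : Continuous (ofProjectiveSpace e) := by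
  refine Continuous.subtype_mk (continuous_generateFrom_iff.mpr ?_) _
  rintro _ ⟨m, f, hf, rfl⟩
  have : IsOpen {p : ProjectiveSpace N | f (nilpotentPoint (p.coords ∘ e.symm)) ≠ 0} :=
    isOpen_generateFrom_of_mem ⟨m, _, comp_nilpotentPoint_mem e hf, rfl⟩
  convert this using 1
  ext p
  exact (rep_ofProjectiveSpace_eq_zero e p hf).not

/-- The central fibre for `n = 2` is a projective space. -/
theorem isIsomorphic_projectiveSpace (e : Fin (N + 1) ≃ Fin ℓ ⊕ Fin ℓ) :
    IsIsomorphic (centralFiber 2 ℓ) (ProjectiveSpace N) := by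
  refine ⟨⟨⟨_, continuous_toProjectiveSpace e⟩, ?_⟩, ⟨⟨_, continuous_ofProjectiveSpace e⟩, ?_⟩,
    of_toProjectiveSpace e, to_ofProjectiveSpace e⟩
  · rintro z _ ⟨m, a, ha, b, hb, hbz, rfl⟩
    have hval : ∀ y : centralFiber 2 ℓ, a (toProjectiveSpace e y.1).coords /
        b (toProjectiveSpace e y.1).coords =
          a (pairVector e y.1.rep) / b (pairVector e y.1.rep) := by
      intro y
      obtain ⟨t, ht, h⟩ := eval_coords_toProjectiveSpace e y.1
      rw [h m a ha, h m b hb, mul_div_mul_left _ _ (pow_ne_zero m ht)]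
    obtain ⟨t, ht, h⟩ := eval_coords_toProjectiveSpace e z.1
    refine ⟨_, ⟨m, _, comp_pairVector_mem e ha, _, comp_pairVector_mem e hb, fun h0 => hbz ?_, rfl⟩,
      Filter.Germ.coe_eq.mpr (Eventually.of_forall fun y => (hval y).symm)⟩
    exact (h m b hb).trans (by
      have h1 : b (pairVector e z.1.rep) = 0 := h0
      rw [h1, mul_zero])
  · rintro p _ ⟨_, ⟨m, a, ha, b, hb, hbz, rfl⟩, rfl⟩
    refine ⟨m, _, comp_nilpotentPoint_mem e ha, _, comp_nilpotentPoint_mem e hb, ?_,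
      Filter.Germ.coe_eq.mpr (Eventually.of_forall fun q => div_ofProjectiveSpace e q ha hb)⟩
    exact (rep_ofProjectiveSpace_eq_zero e p hb).not.mp hbz

end ProjectiveSpaceIsomorphism

end BouquetQuiver

theorem mainTheorem9 :
    (∀ ℓ : ℕ, 1 ≤ ℓ →
      BouquetQuiver.IsIsomorphic (BouquetQuiver.centralFiber 2 ℓ)
        (BouquetQuiver.ProjectiveSpace (2 * ℓ - 1))) ∧
    (∀ n ℓ : ℕ, 1 < n → 1 < ℓ →
      2 * topologicalKrullDim (BouquetQuiver.centralFiber n ℓ) <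
          topologicalKrullDim (BouquetQuiver.QuiverVariety n ℓ) ∧
      (∃! Ω : BouquetQuiver.BilinearField n ℓ, BouquetQuiver.IsReducedSymplecticForm Ω) ∧
      ∀ Ω : BouquetQuiver.BilinearField n ℓ, BouquetQuiver.IsReducedSymplecticForm Ω →
        BouquetQuiver.IsIsotropic Ω (BouquetQuiver.centralFiber n ℓ) ∧
        ¬ BouquetQuiver.IsLagrangian Ω (BouquetQuiver.centralFiber n ℓ)) := by
  refine ⟨fun ℓ hℓ => ?_, fun n ℓ hn hℓ =>
    ⟨BouquetQuiver.two_mul_topologicalKrullDim_centralFiber_lt hn hℓ,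
      BouquetQuiver.existsUnique_isReducedSymplecticForm n ℓ, fun Ω hΩ =>
        ⟨BouquetQuiver.isIsotropic_of_subset_centralFiber le_rfl hΩ,
          BouquetQuiver.not_isLagrangian_centralFiber hn hℓ Ω⟩⟩⟩
  -- The hypothesis `ℓ ≥ 1` makes `(2ℓ - 1) + 1 = 2ℓ` valid for truncated subtraction.
  exact BouquetQuiver.isIsomorphic_projectiveSpace
    ((finCongr (show 2 * ℓ - 1 + 1 = ℓ + ℓ by omega)).trans finSumFinEquiv.symm)
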